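/- **Setup.** Let $M=\{m_{ij} : i,j\in\mathbb Z_3\}$, and let $\mathcal C$ consist of the six contexts $C_i^{hor}=\{m_{ij}: j\in\mathbb Z_3\}$ and $C_j^{ver}=\{m_{ij}: i\in\mathbb Z_3\}$. For $\beta:\mathcal C\to\mathbb Z_2$ the Mermin polytope $MP_\beta$ is the set of families $p=(p_C)_{C\in\mathcal C}$ of probability distributions $p_C$ on $\mathbb Z_2^C$ whose marginals agree on the intersections $C\cap C'$ and such that $p_C(s)>0$ implies $\sum_{m\in C}s(m)=\beta(C)$. Let $MP_0$ be the case $\beta=0$, and $MP_1$ the case $\beta=\beta_1$, where $\beta_1=0$ on horizontal and $\beta_1=1$ on vertical contexts. The graph of a polytope has the vertices of the polytope as its vertices; two distinct vertices are neighbors if the segment between them is a face. $N(p)$ is the set of neighbors of $p$. A set $\Omega\subset M$ is closed if it contains every context of which it contains two measurements; an outcome assignment on $\Omega$ is a function $s:\Omega\to\mathbb Z_2$ with $\sum_{m\in C}s(m)=\beta_1(C)$ for all contexts $C\subset\Omega$; $\Omega$ is cnc if it is closed and admits an outcome assignment. A maximal cnc set is of type 1 if it consists of three measurements, no two of which lie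 in a common context, and of type 2 if it is the union of two distinct contexts that share exactly one measurement. A vertex $p$ of $MP_1$ is of type $k$ if there are a maximal cnc set $\Omega$ of type $k$ and an outcome assignment $s$ on it such that the probability of outcome $0$ of the measurement $m$ is $p_m^0=(1+(-1)^{s(m)})/2$ for $m\in\Omega$ and $p_m^0=1/2$ for $m\notin\Omega$. A loop is the edge set $L\subset M$ of a cycle of the graph $K_{3,3}$ that has the contexts as vertices and the measurements as edges ($m_{ij}$ joins $C_i^{hor}$ and $C_j^{ver}$). A signed loop is a loop $L$ with a function $\varphi:L\to\{\pm1\}$, extended by $0$ to $M$; put $p^\varphi_C(s)=\frac12\sum_{m\in C}(-1)^{s(m)}\varphi(m)$ if $\sum_{m\in C}s(m)=\beta_1(C)$ and $p^\varphi_C(s)=0$ otherwise. Let $X,Y,Z$ be the Pauli matrices and $(T_{m_{ij}})$ the square with rows $(X\otimes X,\,Y\otimes Z,\,Z\otimes Y)$, $(Z\otimes Z,\,X\otimes Y,\,Y\otimes X)$, $(Y\otimes Y,\,Z\otimes X,\,X\otimes Z)$. To $p\in MP_1$ assign the operator $\rho_p=\frac14\bigl(1+\sum_{m\in M}(p_m^0-p_m^1)\,T_m\bigr)$.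 Let $G_1$ be the group of two-qubit unitaries modulo phases generated by all $U\otimes V$, with $U,V$ one-qubit Clifford unitaries, and by SWAP; it acts on operators by conjugation. **Theorem.** 1. The graph of $MP_0$ is the complete graph $K_{16}$. 2. For the graph of $MP_1$ the following hold. * The map $p\mapsto\rho_p$ is injective on $MP_1$ and its image is invariant under $G_1$. (So $G_1$ acts on $MP_1$; points and operators are identified below.) * $MP_1$ has $120$ vertices; each is of exactly one of the types 1 and 2; $48$ are of type 1 and $72$ of type 2. * If $q_1,q_2$ are neighboring vertices, there is a signed loop $\varphi$ such that the edge between them is $\{q_1+\alpha p^\varphi : 0\le\alpha\le 1/2\}$, with $q_1+\frac12p^\varphi=q_2$. * If $q$ is a vertex of type 1, then $N(q)$ consists of $12$ vertices, all of type 2, and they form a single orbit of $\mathrm{Stab}_{G_1}(q)$. * If $p$ is a vertex of type 2, then $N(p)$ contains exactly $8$ vertices of type 1, which form a single orbit of $\mathrm{Stab}_{G_1}(p)$, and exactly $16$ vertices of type 2, which form two orbits of $\mathrm{Stab}_{G_1}(p)$ of size $8$ each. * The operators $q_0=\frac14(1+X\otimes Y-Y\otimes Y+Z\otimes Y)$ and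 $q_1=\frac14(1+Z\otimes X-Z\otimes Y+Z\otimes Z)$ are vertices of type 1, and $p_0=\frac14(1+X\otimes X+X\otimes Y+Y\otimes X-Y\otimes Y+Z\otimes Z)$, $p_1=\frac14(1+X\otimes X+X\otimes Y-Y\otimes Z+Z\otimes X-Z\otimes Y)$, $p_2=\frac14(1+X\otimes X-Y\otimes Y-Y\otimes Z-Z\otimes Y+Z\otimes Z)$ are vertices of type 2. $N(q_0)$ is the $\mathrm{Stab}_{G_1}(q_0)$-orbit of $p_0$; the type 1 part of $N(p_0)$ is the $\mathrm{Stab}_{G_1}(p_0)$-orbit of $q_0$, and its type 2 part is the disjoint union of the $\mathrm{Stab}_{G_1}(p_0)$-orbits of $p_1$ and $p_2$. Moreover $q_1\notin N(p_0)$, although $q_1=p_0+\frac12p^\varphi$ for some signed loop $\varphi$. -/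

import Mathlib

open scoped Kronecker

noncomputable section

namespace Mermin

/-! ### The Mermin scenario and its polytopes -/

/-- The nine measurements `m_{ij}`. -/
abbrev Meas : Type := Fin 3 × Fin 3

/-- The six contexts: `Sum.inl i` is the horizontal context `C_i^hor`,
`Sum.inr j` the vertical context `C_j^ver`. -/
abbrev Ctx : Type := Fin 3 ⊕ Fin 3

/-- The set of measurements that belong to a context. -/
def ctx : Ctx → Finset Meas
  | Sum.inl i => Finset.univ.filter fun m => m.1 = i
  | Sum.inr j => Finset.univ.filter fun m => m.2 = j

/-- Functions `U → ℤ₂`. -/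
abbrev Assign (U : Finset Meas) : Type := {m : Meas // m ∈ U} → ZMod 2

/-- The ambient real vector space of families `(p_C)_C` of functions `p_C : ℤ₂^C → ℝ`. -/
abbrev Dist : Type := (C : Ctx) → Assign (ctx C) → ℝ

/-- Restriction of functions to a smaller set of measurements. -/
def restrict {U V : Finset Meas} (h : V ⊆ U) (s : Assign U) : Assign V :=
  fun m => s ⟨m.1, h m.2⟩

/-- Marginalization of a function on `ℤ₂^U` to `ℤ₂^V`. -/
def marginal {U V : Finset Meas} (h : V ⊆ U) (f : Assign U → ℝ) : Assign V → ℝ :=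
  fun t => ∑ s with restrict h s = t, f s

/-- The nonsignaling polytope of the Mermin scenario. -/
def NS : Set Dist :=
  {p | (∀ C s, 0 ≤ p C s) ∧ (∀ C, ∑ s, p C s = 1) ∧
    ∀ C C' : Ctx,
      marginal (Finset.inter_subset_left : ctx C ∩ ctx C' ⊆ ctx C) (p C) =
        marginal (Finset.inter_subset_right : ctx C ∩ ctx C' ⊆ ctx C') (p C')}

/-- The Mermin polytope `MP_β`: the support of each `p_C` consists of functions whose
values add up to `β C`. -/
def MP (β : Ctx → ZMod 2) : Set Dist :=
  {p | p ∈ NS ∧ ∀ C s, 0 < p C s → ∑ m, s m = β C}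

/-- The even case. -/
def beta0 : Ctx → ZMod 2 := fun _ => 0

/-- The odd case: `0` on horizontal and `1` on vertical contexts. -/
def beta1 : Ctx → ZMod 2
  | Sum.inl _ => 0
  | Sum.inr _ => 1

/-! ### The graph of a polytope -/

/-- The graph of a polytope `P`: its vertices are the extreme points of `P`, and two distinct
vertices are neighbors if the segment between them is a face of `P`. -/
def polytopeGraph {E : Type} [AddCommGroup E] [Module ℝ E] [TopologicalSpace E] (P : Set E) :
    SimpleGraph (P.extremePoints ℝ) where
  Adj v w := v ≠ w ∧ IsExposed ℝ P (segment ℝ (v : E) (w : E))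
  symm := ⟨fun v w h => ⟨h.1.symm, by rw [segment_symm]; exact h.2⟩⟩
  loopless := ⟨fun _ h => h.1 rfl⟩

/-- The vertices of `MP_1`. -/
abbrev Vertex : Type := (MP beta1).extremePoints ℝ

/-- The set `N(p)` of neighbors of a vertex `p` of `MP_1`. -/
def N (p : Vertex) : Set Vertex := (polytopeGraph (MP beta1)).neighborSet p

/-! ### Closed noncontextual sets and the two types of vertices -/

/-- The sign `(-1)^a`. -/
def sgn (a : ZMod 2) : ℝ := (-1) ^ a.val

/-- `Ω` is closed (under inference): with two measurements of a context it contains the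
whole context. -/
def IsClosedSet (Ω : Finset Meas) : Prop :=
  ∀ C : Ctx, ∀ a ∈ ctx C, ∀ b ∈ ctx C, a ≠ b → a ∈ Ω → b ∈ Ω → ctx C ⊆ Ω

/-- Outcome assignments on `Ω` with respect to `β`. -/
def IsOutcome (β : Ctx → ZMod 2) (Ω : Finset Meas) (s : Assign Ω) : Prop :=
  ∀ (C : Ctx) (h : ctx C ⊆ Ω), ∑ m, restrict h s m = β C

/-- Closed noncontextual (cnc) sets. -/
def IsCNC (β : Ctx → ZMod 2) (Ω : Finset Meas) : Prop :=
  IsClosedSet Ω ∧ ∃ s, IsOutcome β Ω s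

/-- Type 1 maximal cnc sets: three measurements, no two of which lie in a common context. -/
def IsType1Set (Ω : Finset Meas) : Prop :=
  Maximal (IsCNC beta1) Ω ∧ Ω.card = 3 ∧
    ∀ a ∈ Ω, ∀ b ∈ Ω, a ≠ b → ¬ ∃ C, a ∈ ctx C ∧ b ∈ ctx C

/-- Type 2 maximal cnc sets: the union of two distinct contexts that share one measurement. -/
def IsType2Set (Ω : Finset Meas) : Prop :=
  Maximal (IsCNC beta1) Ω ∧
    ∃ C C' : Ctx, C ≠ C' ∧ (ctx C ∩ ctx C').card = 1 ∧ Ω = ctx C ∪ ctx C'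

/-- `p_m^a`, the probability of the outcome `a` of the measurement `m`, computed in `C ∋ m`. -/
def prob (p : Dist) (C : Ctx) (m : {m : Meas // m ∈ ctx C}) (a : ZMod 2) : ℝ :=
  ∑ s with s m = a, p C s

/-- The single-measurement marginals of `p` are the deterministic ones given by `s` on `Ω`, and
uniform outside `Ω`. -/
def HasMarginals (p : Dist) (Ω : Finset Meas) (s : Assign Ω) : Prop :=
  ∀ (C : Ctx) (m : {m : Meas // m ∈ ctx C}),
    (∀ h : m.1 ∈ Ω, prob p C m 0 = (1 + sgn (s ⟨m.1, h⟩)) / 2) ∧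
      (m.1 ∉ Ω → prob p C m 0 = 1 / 2)

/-- The vertices of type 1. -/
def Type1 : Set Vertex :=
  {p | ∃ (Ω : Finset Meas) (s : Assign Ω), IsType1Set Ω ∧ IsOutcome beta1 Ω s ∧
    HasMarginals p.1 Ω s}

/-- The vertices of type 2. -/
def Type2 : Set Vertex :=
  {p | ∃ (Ω : Finset Meas) (s : Assign Ω), IsType2Set Ω ∧ IsOutcome beta1 Ω s ∧
    HasMarginals p.1 Ω s}

/-! ### Signed loops -/

/-- `L` is the set of measurements on a loop, that is, the edge set of a cycle in the graph
`K_{3,3}` whose vertices are the contexts and whose edges are the measurements; `m_{ij}` joins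
`C_i^hor` and `C_j^ver`. -/
def IsLoop (L : Finset Meas) : Prop :=
  ∃ (C : Ctx) (w : (completeBipartiteGraph (Fin 3) (Fin 3)).Walk C C),
    w.IsCycle ∧ ∀ m : Meas, m ∈ L ↔ s(Sum.inl m.1, Sum.inr m.2) ∈ w.edges

/-- The direction `p^φ` of a signed loop `φ : L → {±1}`: on the function
`(x, y, z) ↦ (a, b, c)` with `a + b + c = β₁(C)` on `C = {x, y, z}` its value is
`((-1)^a φ(x) + (-1)^b φ(y) + (-1)^c φ(z)) / 2`, where `φ` is `0` outside `L`. -/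
def loopDir (L : Finset Meas) (φ : {m : Meas // m ∈ L} → ℤˣ) : Dist :=
  fun C s =>
    if ∑ m, s m = beta1 C then
      (∑ m, sgn (s m) * (if h : m.1 ∈ L then (((φ ⟨m.1, h⟩ : ℤˣ) : ℤ) : ℝ) else 0)) / 2
    else 0

/-! ### Points of `MP_1` as two-qubit operators -/

/-- One-qubit operators. -/
abbrev Op1 : Type := Matrix (Fin 2) (Fin 2) ℂ

/-- Two-qubit operators. -/
abbrev Op2 : Type := Matrix (Fin 2 × Fin 2) (Fin 2 × Fin 2) ℂ

/-- The Pauli matrix `X`. -/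
def X : Op1 := !![0, 1; 1, 0]

/-- The Pauli matrix `Y`. -/
def Y : Op1 := !![0, -Complex.I; Complex.I, 0]

/-- The Pauli matrix `Z`. -/
def Z : Op1 := !![1, 0; 0, -1]

/-- The Mermin square of nonlocal Pauli operators: the operators in each row and each column
commute, each row has product `1` and each column has product `-1`. -/
def pauliSquare : Matrix (Fin 3) (Fin 3) Op2 :=
  !![X ⊗ₖ X, Y ⊗ₖ Z, Z ⊗ₖ Y;
     Z ⊗ₖ Z, X ⊗ₖ Y, Y ⊗ₖ X;
     Y ⊗ₖ Y, Z ⊗ₖ X, X ⊗ₖ Z]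

/-- The expectation value `p_m^0 - p_m^1`, computed in the horizontal context of `m`. -/
def expect (p : Dist) (m : Meas) : ℝ :=
  prob p (Sum.inl m.1) ⟨m, by simp [ctx]⟩ 0 - prob p (Sum.inl m.1) ⟨m, by simp [ctx]⟩ 1

/-- The operator `ρ_p` of a distribution `p`. -/
def toOp (p : Dist) : Op2 :=
  (1 / 4 : ℂ) • (1 + ∑ m : Meas, (expect p m : ℂ) • pauliSquare m.1 m.2)

/-- The operators of a set of vertices. -/
def toOps (S : Set Vertex) : Set Op2 := (fun p : Vertex => toOp p.1) '' S

/-! ### The symmetry group `G_1` -/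

/-- The one-qubit Pauli group. -/
def pauliGroup : Set Op1 :=
  {A | ∃ k : ℕ, ∃ B ∈ ({1, X, Y, Z} : Set Op1), A = Complex.I ^ k • B}

/-- The one-qubit Clifford unitaries. -/
def IsClifford (U : Op1) : Prop :=
  U ∈ Matrix.unitaryGroup (Fin 2) ℂ ∧ ∀ A ∈ pauliGroup, U * A * star U ∈ pauliGroup

/-- The swap of the two qubits. -/
def swapOp : Op2 := Matrix.of fun x y => if x = y.swap then 1 else 0

/-- The conjugation `A ↦ U A U†` by a unitary; its kernel consists of the phases `e^{iθ} 1`. -/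
def conj : Matrix.unitaryGroup (Fin 2 × Fin 2) ℂ →* (Op2 ≃ₐ[ℂ] Op2) where
  toFun U := (Unitary.conjStarAlgAut ℂ Op2 U).toAlgEquiv
  map_one' := by ext1 A; simp
  map_mul' U V := by ext1 A; simp [mul_assoc]

/-- The group `G_1 = ⟨Cl_1 × Cl_1, SWAP⟩` of unitaries modulo phases, a unitary modulo phases
being given as the conjugation by it. -/
def G1 : Subgroup (Op2 ≃ₐ[ℂ] Op2) :=
  (Subgroup.closure {g : Matrix.unitaryGroup (Fin 2 × Fin 2) ℂ |
    (∃ U V : Op1, IsClifford U ∧ IsClifford V ∧ (g : Op2) = U ⊗ₖ V) ∨ (g : Op2) = swapOp}).map conj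

/-- The orbit of the operator of `r` under the stabilizer in `G_1` of the operator of `p`. -/
def stabOrbit (p r : Vertex) : Set Op2 :=
  MulAction.orbit (MulAction.stabilizer G1 (toOp p.1)) (toOp r.1)

end Mermin

end

open scoped Kronecker

noncomputable section

namespace Mermin

/-! ### Signs -/

/-! On a context the parity condition leaves four functions, and a distribution on them is the same
as three expectation values: `p_C(s) = (1 + ∑ (-1)^{s(m)} e_m) / 4`. Agreement of marginals then
says only that `e_m` does not depend on the context. So `MP_β` is an affine copy of a polytope in
`ℝ^9`, `corrPolytope β`, cut out by four inequalities per context (`MP_eq_image`), and vertices and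
edges can be studied there.

Let `e` be a vertex and `Z` the set of measurements with `|e_m| = 1`. Then `Z` is closed. Two
distinct tight inequalities of a context agree on exactly one measurement and force it into `Z`; so,
modulo the coordinates in `Z`, each context contributes at most one further linear condition, and
none if it lies inside `Z`. Since the tight conditions at a vertex have rank 9, `|Z|` is at least 3
plus the number of contexts inside `Z` (`card_le_of_mem_extremePoints`). The closed sets with this
property are the transversals, the crosses (a row together with a column) and `M` itself.

In the even case the outcomes on `Z` always extend to a global assignment, and this forces `e` to be
the corresponding deterministic point (`eq_detPoint_of_extend`). There are 16 of them. The set on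
which two of them differ is connected through contexts, so their common face has a single parameter
and is a segment.

In the odd case no global assignment exists, which leaves the transversals (type 1) and the crosses
(type 2). Given the outcomes on `Z`, the remaining coordinates are related up to sign along a cycle
with an odd number of sign changes, hence vanish. So there are `6·8` and `9·8` vertices. Signed
permutations of the coordinates that preserve the scenario act transitively on each type and
preserve the scalar product, and this pair of data decides adjacency: there is an edge exactly for
scalar product 2 between the types, 2 or 3 within type 2 (for distinct vertices), and never within
type 1. Edges are verified at `q₀` and `p₀` by solving the common tight equations; non-edges by
writing `z + w` as another sum `u + u'` with `u` a vertex different from `z` and `w`, and `u'` in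
the polytope. Explicit symmetries fixing `q₀` or `p₀` permute the neighbors with a given scalar
product transitively.

It remains to compare with `G_1`. A one-qubit Clifford unitary acts on the Pauli axes as a rotation
of the cube, so every element of `G_1` acts as a signed permutation preserving the scenario
(`exists_implements_of_mem_G1`); conversely all 24 rotations arise from words in two gates, so the
symmetries used above come from `G_1` (`codeGroup_le_implGroup`). A stabilizer orbit is thus bounded
above by the invariants (type and scalar product) and below by the explicit symmetries, and the
bounds agree. -/

/-- The sign `(-1)^a` as an integer. -/
def sgnZ (a : ZMod 2) : ℤ := (-1) ^ a.val

theorem cast_sgnZ (a : ZMod 2) : ((sgnZ a : ℤ) : ℝ) = sgn a := by simp [sgnZ, sgn]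

theorem sgn_zero : sgn 0 = 1 := by simp [sgn]

theorem sgn_one : sgn 1 = -1 := by
  have h : (1 : ZMod 2).val = 1 := by decide
  simp [sgn, h]

theorem zmod2_eq_zero_or_one (a : ZMod 2) : a = 0 ∨ a = 1 := by revert a; decide

theorem sgn_eq_or (a : ZMod 2) : (a = 0 ∧ sgn a = 1) ∨ (a = 1 ∧ sgn a = -1) := by
  rcases zmod2_eq_zero_or_one a with rfl | rfl
  · exact Or.inl ⟨rfl, sgn_zero⟩
  · exact Or.inr ⟨rfl, sgn_one⟩

theorem sgn_add (a b : ZMod 2) : sgn (a + b) = sgn a * sgn b := by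
  have h : sgnZ (a + b) = sgnZ a * sgnZ b := by revert a b; decide
  rw [← cast_sgnZ, h]; push_cast [cast_sgnZ]; rfl

theorem sgn_mul_self (a : ZMod 2) : sgn a * sgn a = 1 := by
  rcases sgn_eq_or a with ⟨-, h⟩ | ⟨-, h⟩ <;> simp [h]

theorem sgn_ne_zero (a : ZMod 2) : sgn a ≠ 0 := fun h => by
  simpa [h] using sgn_mul_self a

theorem sgn_injective : Function.Injective sgn := by
  intro a b h
  rcases sgn_eq_or a with ⟨rfl, ha⟩ | ⟨rfl, ha⟩ <;> rcases sgn_eq_or b with ⟨rfl, hb⟩ | ⟨rfl, hb⟩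
  · rfl
  · rw [ha, hb] at h; norm_num at h
  · rw [ha, hb] at h; norm_num at h
  · rfl

theorem exists_sgn_eq {x : ℝ} (h : |x| = 1) : ∃ a, x = sgn a := by
  rcases eq_or_eq_neg_of_abs_eq h with h | h
  · exact ⟨0, by rw [h, sgn_zero]⟩
  · exact ⟨1, by rw [h, sgn_one]⟩

/-! ### Sums over the functions of fixed parity on a context -/

/-- Distinct functions of equal parity differ in exactly two of three places. This orthogonality
relation is what recovers a distribution from its expectation values. -/
theorem sum_sgnZ_mul_sgnZ : ∀ (C : Ctx) (s t : Assign (ctx C)), ∑ m, s m = ∑ m, t m →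
    ∑ m, sgnZ (s m) * sgnZ (t m) = if s = t then 3 else -1 := by
  decide +kernel

theorem card_filter_parity : ∀ (C : Ctx) (b : ZMod 2) (m : {m // m ∈ ctx C}) (a : ZMod 2),
    (Finset.univ.filter fun s : Assign (ctx C) => s m = a ∧ ∑ m, s m = b).card = 2 := by
  decide +kernel

/-- The two functions with value `a` at `m` and parity `b` are opposite on the other two
measurements, where the signs cancel. -/
theorem sum_filter_parity : ∀ (C : Ctx) (b : ZMod 2) (m m' : {m // m ∈ ctx C}) (a : ZMod 2),
    ∑ s : Assign (ctx C) with s m = a ∧ ∑ m, s m = b, sgnZ (s m') =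
      if m' = m then 2 * sgnZ a else 0 := by
  decide +kernel

/-! ### Correlation vectors -/

/-- Vectors of expectation values. -/
abbrev Corr : Type := Meas → ℝ

/-- Four times the probability of the outcomes `t` on the context `C`. -/
def slack (C : Ctx) (t : Meas → ZMod 2) (e : Corr) : ℝ := 1 + ∑ m ∈ ctx C, sgn (t m) * e m

/-- The polytope of the vectors of expectation values of the points of `MP_β`. -/
def corrPolytope (β : Ctx → ZMod 2) : Set Corr :=
  {e | ∀ C t, ∑ m ∈ ctx C, t m = β C → 0 ≤ slack C t e}

/-- The distribution with given expectation values. -/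
def distOf (β : Ctx → ZMod 2) (e : Corr) : Dist := fun C s =>
  if ∑ m, s m = β C then (1 + ∑ m, sgn (s m) * e m.1) / 4 else 0

/-- Extension by zero of a function on a context. -/
def extendZero {C : Ctx} (s : Assign (ctx C)) : Meas → ZMod 2 :=
  fun m => if h : m ∈ ctx C then s ⟨m, h⟩ else 0

theorem sum_extendZero {C : Ctx} (s : Assign (ctx C)) :
    ∑ m ∈ ctx C, extendZero s m = ∑ m, s m := by
  rw [← Finset.sum_coe_sort]
  exact Finset.sum_congr rfl fun m _ => by simp [extendZero]

theorem slack_extendZero {C : Ctx} (s : Assign (ctx C)) (e : Corr) :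
    slack C (extendZero s) e = 1 + ∑ m, sgn (s m) * e m.1 := by
  rw [slack, ← Finset.sum_coe_sort]
  congr 1
  exact Finset.sum_congr rfl fun m _ => by simp [extendZero]

/-- Only the term of `m` survives the summation. The value depends on `C` only through membership of
`m`, so every vector `e` yields agreeing marginals. -/
theorem prob_distOf (β : Ctx → ZMod 2) (e : Corr) (C : Ctx) (m : {m : Meas // m ∈ ctx C})
    (a : ZMod 2) : prob (distOf β e) C m a = (1 + sgn a * e m.1) / 2 := by
  have h1 : prob (distOf β e) C m a =
      ∑ s : Assign (ctx C) with s m = a ∧ ∑ m, s m = β C, (1 + ∑ m', sgn (s m') * e m'.1) / 4 := by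
    rw [prob, ← Finset.filter_filter]
    exact (Finset.sum_filter _ _).symm
  have h2 : ∀ m' : {m : Meas // m ∈ ctx C},
      ∑ s : Assign (ctx C) with s m = a ∧ ∑ m, s m = β C, sgn (s m') =
        if m' = m then 2 * sgn a else 0 := by
    intro m'
    have := congrArg (Int.cast : ℤ → ℝ) (sum_filter_parity C (β C) m m' a)
    push_cast [cast_sgnZ] at this
    exact this
  rw [h1, ← Finset.sum_div, Finset.sum_add_distrib, Finset.sum_comm]
  simp_rw [← Finset.sum_mul, h2]
  rw [Finset.sum_const, card_filter_parity]
  simp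
  ring

theorem sum_eq_prob_add_prob (p : Dist) (C : Ctx) (m : {m : Meas // m ∈ ctx C}) :
    ∑ s, p C s = prob p C m 0 + prob p C m 1 := by
  rw [prob, prob, ← Finset.sum_filter_add_sum_filter_not Finset.univ (fun s => s m = 0)]
  congr 2
  ext s
  have := zmod2_eq_zero_or_one (s m)
  aesop

theorem sum_sgn_eq_prob_sub_prob (p : Dist) (C : Ctx) (m : {m : Meas // m ∈ ctx C}) :
    ∑ s, sgn (s m) * p C s = prob p C m 0 - prob p C m 1 := by
  rw [prob, prob, ← Finset.sum_filter_add_sum_filter_not Finset.univ (fun s => s m = 0),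
    sub_eq_add_neg, ← Finset.sum_neg_distrib]
  congr 1
  · refine Finset.sum_congr rfl fun s hs => ?_
    rw [(Finset.mem_filter.1 hs).2, sgn_zero, one_mul]
  · refine Finset.sum_congr ?_ fun s hs => ?_
    · ext s
      have := zmod2_eq_zero_or_one (s m)
      aesop
    · rw [(Finset.mem_filter.1 hs).2, sgn_one, neg_one_mul]

theorem exists_mem_ctx (C : Ctx) : ∃ m, m ∈ ctx C := by revert C; decide

theorem ctx_inter_cases : ∀ C C' : Ctx,
    C = C' ∨ ctx C ∩ ctx C' = ∅ ∨ ∃ m, ctx C ∩ ctx C' = {m} := by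
  decide +kernel

theorem marginal_singleton {U V : Finset Meas} (h : V ⊆ U) (f : Assign U → ℝ) {m : Meas}
    (hV : V = {m}) (hm : m ∈ V) (t : Assign V) :
    marginal h f t = ∑ s with s ⟨m, h hm⟩ = t ⟨m, hm⟩, f s := by
  subst hV
  refine Finset.sum_congr ?_ fun _ _ => rfl
  ext s
  simp only [Finset.mem_filter, Finset.mem_univ, true_and]
  constructor
  · rintro rfl; rfl
  · intro hs
    ext ⟨x, hx⟩
    obtain rfl := Finset.mem_singleton.1 hx
    rw [← hs]; rfl

theorem marginal_empty {U V : Finset Meas} (h : V ⊆ U) (f : Assign U → ℝ) (hV : V = ∅)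
    (t : Assign V) : marginal h f t = ∑ s, f s := by
  subst hV
  refine Finset.sum_congr ?_ fun _ _ => rfl
  ext s
  simp only [Finset.mem_filter, Finset.mem_univ, true_and, iff_true]
  ext ⟨x, hx⟩
  simp at hx

theorem prob_eq_of_mem_NS {p : Dist} (hp : p ∈ NS) {C C' : Ctx} {m : Meas} (hC : m ∈ ctx C)
    (hC' : m ∈ ctx C') (a : ZMod 2) : prob p C ⟨m, hC⟩ a = prob p C' ⟨m, hC'⟩ a := by
  have hmem : m ∈ ctx C ∩ ctx C' := Finset.mem_inter.2 ⟨hC, hC'⟩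
  rcases ctx_inter_cases C C' with rfl | h | ⟨m', h⟩
  · rfl
  · simp [h] at hmem
  · obtain rfl : m = m' := by simpa [h] using hmem
    have := congrFun (hp.2.2 C C') (fun _ => a)
    rwa [marginal_singleton _ _ h hmem, marginal_singleton _ _ h hmem] at this

theorem distOf_mem_MP {β : Ctx → ZMod 2} {e : Corr} (he : e ∈ corrPolytope β) :
    distOf β e ∈ MP β := by
  have hsum : ∀ C, ∑ s, distOf β e C s = 1 := by
    intro C
    obtain ⟨m, hm⟩ := exists_mem_ctx C
    rw [sum_eq_prob_add_prob _ C ⟨m, hm⟩, prob_distOf, prob_distOf, sgn_zero, sgn_one]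
    ring
  refine ⟨⟨fun C s => ?_, hsum, fun C C' => ?_⟩, fun C s hs => ?_⟩
  · rw [distOf]
    split_ifs with h
    · rw [← slack_extendZero]
      have := he C (extendZero s) (by rw [sum_extendZero, h])
      positivity
    · rfl
  · rcases ctx_inter_cases C C' with rfl | h | ⟨m, h⟩
    · rfl
    · ext t
      rw [marginal_empty _ _ h, marginal_empty _ _ h, hsum, hsum]
    · ext t
      have hmem : m ∈ ctx C ∩ ctx C' := by rw [h]; exact Finset.mem_singleton_self m
      rw [marginal_singleton _ _ h hmem, marginal_singleton _ _ h hmem]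
      exact (prob_distOf β e C ⟨m, _⟩ _).trans (prob_distOf β e C' ⟨m, _⟩ _).symm
  · by_contra hne
    rw [distOf, if_neg hne] at hs
    exact lt_irrefl _ hs

theorem expect_distOf (β : Ctx → ZMod 2) (e : Corr) : expect (distOf β e) = e := by
  ext m
  rw [expect, prob_distOf, prob_distOf, sgn_zero, sgn_one]
  ring

theorem distOf_expect {β : Ctx → ZMod 2} {p : Dist} (hp : p ∈ MP β) :
    distOf β (expect p) = p := by
  have hzero : ∀ C s, ∑ m, s m ≠ β C → p C s = 0 := fun C s h =>
    le_antisymm (not_lt.1 fun h' => h (hp.2 C s h')) (hp.1.1 C s)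
  ext C t
  rw [distOf]
  split_ifs with ht
  · have hexp : ∀ m : {m : Meas // m ∈ ctx C}, expect p m.1 = ∑ s, sgn (s m) * p C s := by
      intro m
      rw [sum_sgn_eq_prob_sub_prob, expect]
      exact congrArg₂ _ (prob_eq_of_mem_NS hp.1 _ m.2 0) (prob_eq_of_mem_NS hp.1 _ m.2 1)
    have hcomm : ∑ m, sgn (t m) * expect p m.1 =
        ∑ s, (∑ m, sgn (s m) * sgn (t m)) * p C s := by
      simp_rw [hexp, Finset.mul_sum, Finset.sum_mul]
      rw [Finset.sum_comm]
      exact Finset.sum_congr rfl fun s _ => Finset.sum_congr rfl fun m _ => by ring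
    -- The factor is 3 for `s = t` and -1 for other `s` of the right parity, and `p C s` vanishes
    -- for the wrong parity. Summing over `s` gives `4 p_C(t) - 1`.
    have hval : ∀ s, (∑ m, sgn (s m) * sgn (t m)) * p C s =
        (if s = t then 4 * p C t else 0) - p C s := by
      intro s
      by_cases hs : ∑ m, s m = β C
      · have := congrArg (Int.cast : ℤ → ℝ) (sum_sgnZ_mul_sgnZ C s t (hs.trans ht.symm))
        push_cast [cast_sgnZ] at this
        rw [this]
        split_ifs with h
        · rw [h]; ring
        · ring
      · have hne : s ≠ t := fun h => hs (h ▸ ht)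
        rw [hzero C s hs, if_neg hne]; ring
    rw [hcomm, Finset.sum_congr rfl fun s _ => hval s, Finset.sum_sub_distrib, hp.1.2.1 C]
    simp
  · exact (hzero C t ht).symm

theorem expect_mem_corrPolytope {β : Ctx → ZMod 2} {p : Dist} (hp : p ∈ MP β) :
    expect p ∈ corrPolytope β := by
  intro C t ht
  have h : ∑ m : {m : Meas // m ∈ ctx C}, t m.1 = β C := by
    rw [← ht, ← Finset.sum_coe_sort (ctx C)]
  have h1 := hp.1.1 C (fun m => t m.1)
  rw [← distOf_expect hp, distOf, if_pos h] at h1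
  rw [slack, ← Finset.sum_coe_sort (ctx C)]
  linarith

theorem MP_eq_image (β : Ctx → ZMod 2) : MP β = distOf β '' corrPolytope β :=
  Set.Subset.antisymm (fun p hp => ⟨expect p, expect_mem_corrPolytope hp, distOf_expect hp⟩)
    (Set.image_subset_iff.2 fun _ he => distOf_mem_MP he)

theorem distOf_injective (β : Ctx → ZMod 2) : Function.Injective (distOf β) :=
  Function.LeftInverse.injective (expect_distOf β)

/-- The linear part of `distOf β`. -/
def distOfLin (β : Ctx → ZMod 2) : Corr →ₗ[ℝ] Dist where
  toFun e := fun C s => if ∑ m, s m = β C then (∑ m, sgn (s m) * e m.1) / 4 else 0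
  map_add' x y := by
    ext C s
    simp only [Pi.add_apply]
    split_ifs
    · rw [← add_div, ← Finset.sum_add_distrib]; simp only [mul_add]
    · simp
  map_smul' a x := by
    ext C s
    simp only [Pi.smul_apply, smul_eq_mul, RingHom.id_apply]
    split_ifs
    · rw [← mul_div_assoc, Finset.mul_sum]; simp only [mul_left_comm]
    · simp

theorem distOf_add (β : Ctx → ZMod 2) (x d : Corr) :
    distOf β (x + d) = distOf β x + distOfLin β d := by
  ext C s
  simp only [distOf, distOfLin, LinearMap.coe_mk, AddHom.coe_mk, Pi.add_apply]
  split_ifs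
  · simp only [mul_add, Finset.sum_add_distrib]; ring
  · simp

/-- `distOf β` as an affine map. -/
def distOfAff (β : Ctx → ZMod 2) : Corr →ᵃ[ℝ] Dist where
  toFun := distOf β
  linear := distOfLin β
  map_vadd' x d := by simp only [vadd_eq_add]; rw [add_comm d x, distOf_add, add_comm]

/-- `expect` as a continuous linear map. -/
def expectCLM : Dist →L[ℝ] Corr :=
  LinearMap.toContinuousLinearMap
    { toFun := expect
      map_add' := fun p q => by
        ext m
        simp only [expect, prob, Pi.add_apply, Finset.sum_add_distrib]; ring
      map_smul' := fun a p => by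
        ext m
        simp only [expect, prob, Pi.smul_apply, smul_eq_mul, ← Finset.mul_sum,
          RingHom.id_apply]; ring }

/-! ### Extreme points and exposed segments under affine embeddings -/

section Transport

variable {E F : Type} [AddCommGroup E] [Module ℝ E] [AddCommGroup F] [Module ℝ F]

theorem extremePoints_image_affine (f : E →ᵃ[ℝ] F) (hf : Function.Injective f) (P : Set E) :
    (f '' P).extremePoints ℝ = f '' P.extremePoints ℝ := by
  ext y
  simp only [mem_extremePoints, Set.mem_image]
  constructor
  · rintro ⟨⟨x, hx, rfl⟩, h⟩
    refine ⟨x, ⟨hx, fun a ha b hb hab => ?_⟩, rfl⟩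
    have := h (f a) ⟨a, ha, rfl⟩ (f b) ⟨b, hb, rfl⟩
      (by rw [← image_openSegment]; exact ⟨x, hab, rfl⟩)
    exact ⟨hf this.1, hf this.2⟩
  · rintro ⟨x, ⟨hx, h⟩, rfl⟩
    refine ⟨⟨x, hx, rfl⟩, ?_⟩
    rintro _ ⟨a, ha, rfl⟩ _ ⟨b, hb, rfl⟩ hab
    rw [← image_openSegment] at hab
    obtain ⟨x', hx', hxx⟩ := hab
    rw [hf hxx] at hx'
    have := h a ha b hb hx'
    exact ⟨congrArg f this.1, congrArg f this.2⟩

/-- The exposing functional is carried over by composing it with the linear left inverse `g`; for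
`MP β` this is `expectCLM`. -/
theorem isExposed_image_of_leftInverse [TopologicalSpace E] [TopologicalSpace F]
    (f : E →ᵃ[ℝ] F) (g : F →L[ℝ] E) (hg : ∀ x, g (f x) = x)
    {P B : Set E} (h : IsExposed ℝ P B) : IsExposed ℝ (f '' P) (f '' B) := by
  rintro ⟨_, b, hb, rfl⟩
  obtain ⟨l, hl⟩ := h ⟨b, hb⟩
  refine ⟨l.comp g, ?_⟩
  ext y
  constructor
  · rintro ⟨x, hx, rfl⟩
    rw [hl] at hx
    refine ⟨⟨x, hx.1, rfl⟩, ?_⟩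
    rintro _ ⟨z, hz, rfl⟩
    simpa [hg] using hx.2 z hz
  · rintro ⟨⟨x, hx, rfl⟩, hy⟩
    refine ⟨x, ?_, rfl⟩
    rw [hl]
    exact ⟨hx, fun z hz => by simpa [hg] using hy (f z) ⟨z, hz, rfl⟩⟩

/-- Non-adjacency is deduced from the failure of extremality, which is weaker than exposedness and
can be pulled back along any injective affine map. -/
theorem isExtreme_of_image (f : E →ᵃ[ℝ] F) (hf : Function.Injective f) {P B : Set E}
    (h : IsExtreme ℝ (f '' P) (f '' B)) : IsExtreme ℝ P B := by
  refine ⟨(Set.image_subset_image_iff hf).1 h.1, fun x hx y hy z hz hxy => ?_⟩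
  have := h.2 ⟨x, hx, rfl⟩ ⟨y, hy, rfl⟩ ⟨z, hz, rfl⟩
    (by rw [← image_openSegment]; exact ⟨z, hxy, rfl⟩)
  exact hf.mem_set_image.1 this

end Transport

/-! ### The faces of the polytopes of correlation vectors -/

/-- `(C, t)` is a facet inequality of `corrPolytope β` that is tight at `e`. -/
def Tight (β : Ctx → ZMod 2) (e : Corr) (C : Ctx) (t : Meas → ZMod 2) : Prop :=
  ∑ m ∈ ctx C, t m = β C ∧ slack C t e = 0

theorem slack_add_smul (C : Ctx) (t : Meas → ZMod 2) (e d : Corr) (r : ℝ) :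
    slack C t (e + r • d) = slack C t e + r * ∑ m ∈ ctx C, sgn (t m) * d m := by
  simp only [slack, Pi.add_apply, Pi.smul_apply, smul_eq_mul, mul_add, Finset.sum_add_distrib,
    Finset.mul_sum, add_assoc]
  congr 2
  exact Finset.sum_congr rfl fun m _ => by ring

theorem slack_sub_slack (C : Ctx) (t : Meas → ZMod 2) (x y : Corr) :
    slack C t x - slack C t y = ∑ m ∈ ctx C, sgn (t m) * (x m - y m) := by
  simp only [slack, mul_sub, Finset.sum_sub_distrib]; ring

/-- The points of the polytope at which all inequalities are tight that are tight at both `v`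
and `w`: the smallest face that contains `v` and `w`. -/
def commonFace (β : Ctx → ZMod 2) (v w : Corr) : Set Corr :=
  {x ∈ corrPolytope β | ∀ C t, Tight β v C t → Tight β w C t → Tight β x C t}

/-- The sum of all slacks that vanish at both `v` and `w` is nonnegative on the polytope, is 0 at
`v`, and vanishes exactly on the common face; minus its linear part is the exposing functional. -/
theorem isExposed_commonFace {β : Ctx → ZMod 2} {v w : Corr} (hv : v ∈ corrPolytope β) :
    IsExposed ℝ (corrPolytope β) (commonFace β v w) := by
  classical
  rintro -
  let S : Finset (Ctx × (Meas → ZMod 2)) :=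
    Finset.univ.filter fun a => Tight β v a.1 a.2 ∧ Tight β w a.1 a.2
  let l : Corr →ₗ[ℝ] ℝ := -∑ a ∈ S, ∑ m ∈ ctx a.1, sgn (a.2 m) • LinearMap.proj m
  have hl : ∀ x, l x = S.card - ∑ a ∈ S, slack a.1 a.2 x := by
    intro x
    simp [l, slack, LinearMap.sum_apply, Finset.sum_add_distrib]
  have hpos : ∀ x ∈ corrPolytope β, ∀ a ∈ S, 0 ≤ slack a.1 a.2 x := fun x hx a ha =>
    hx _ _ (Finset.mem_filter.1 ha).2.1.1
  refine ⟨LinearMap.toContinuousLinearMap l, ?_⟩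
  ext x
  simp only [commonFace, Set.mem_ofPred_eq, LinearMap.coe_toContinuousLinearMap', hl]
  refine and_congr_right fun hx => ⟨fun h y hy => ?_, fun h C t h1 h2 => ?_⟩
  · have h0 : ∑ a ∈ S, slack a.1 a.2 x = 0 := Finset.sum_eq_zero fun a ha =>
      (h a.1 a.2 (Finset.mem_filter.1 ha).2.1 (Finset.mem_filter.1 ha).2.2).2
    have := Finset.sum_nonneg (hpos y hy)
    linarith
  · have h0 : ∑ a ∈ S, slack a.1 a.2 v = 0 := Finset.sum_eq_zero fun a ha =>
      (Finset.mem_filter.1 ha).2.1.2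
    have h3 := h v hv
    have h4 : ∑ a ∈ S, slack a.1 a.2 x = 0 :=
      le_antisymm (by linarith) (Finset.sum_nonneg (hpos x hx))
    have hmem : (C, t) ∈ S := Finset.mem_filter.2 ⟨Finset.mem_univ _, h1, h2⟩
    exact ⟨h1.1, (Finset.sum_eq_zero_iff_of_nonneg (hpos x hx)).1 h4 _ hmem⟩

theorem convex_commonFace (β : Ctx → ZMod 2) (v w : Corr) : Convex ℝ (commonFace β v w) := by
  intro x hx y hy a b ha hb hab
  have key : ∀ C t, slack C t (a • x + b • y) = a * slack C t x + b * slack C t y := by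
    intro C t
    simp only [slack, Pi.add_apply, Pi.smul_apply, smul_eq_mul, mul_add, Finset.sum_add_distrib,
      Finset.mul_sum, mul_one, mul_left_comm (sgn _)]
    linear_combination -hab
  refine ⟨fun C t ht => ?_, fun C t h1 h2 => ⟨h1.1, ?_⟩⟩
  · rw [key]
    have := hx.1 C t ht
    have := hy.1 C t ht
    positivity
  · rw [key, (hx.2 C t h1 h2).2, (hy.2 C t h1 h2).2]; simp

theorem isExposed_segment {β : Ctx → ZMod 2} {v w : Corr} (hv : v ∈ corrPolytope β)
    (hw : w ∈ corrPolytope β) (h : commonFace β v w ⊆ segment ℝ v w) :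
    IsExposed ℝ (corrPolytope β) (segment ℝ v w) := by
  have : commonFace β v w = segment ℝ v w :=
    h.antisymm ((convex_commonFace β v w).segment_subset ⟨hv, fun _ _ h _ => h⟩
      ⟨hw, fun _ _ _ h => h⟩)
  rw [← this]
  exact isExposed_commonFace hv

/-- The case `v = w` of the criterion for segments. -/
theorem mem_extremePoints_of_commonFace {β : Ctx → ZMod 2} {v : Corr} (hv : v ∈ corrPolytope β)
    (h : ∀ x ∈ corrPolytope β, (∀ C t, Tight β v C t → Tight β x C t) → x = v) :
    v ∈ (corrPolytope β).extremePoints ℝ := by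
  have h1 : IsExposed ℝ (corrPolytope β) (segment ℝ v v) :=
    isExposed_segment hv hv fun x hx => by
      rw [h x hx.1 fun C t ht => hx.2 C t ht ht]; exact left_mem_segment ℝ v v
  rw [segment_same] at h1
  exact isExtreme_singleton.1 h1.isExtreme

/-- A direction that keeps the tight inequalities at an extreme point tight vanishes. -/
theorem eq_zero_of_forall_tight {β : Ctx → ZMod 2} {e d : Corr}
    (he : e ∈ (corrPolytope β).extremePoints ℝ)
    (hd : ∀ C t, Tight β e C t → ∑ m ∈ ctx C, sgn (t m) * d m = 0) : d = 0 := by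
  -- Tight inequalities are constant along `d`, and the finitely many strict ones persist for small
  -- `r`. So `e` is the midpoint of two points of the polytope in the directions `d` and `-d`.
  have hev : ∀ᶠ r in nhds (0 : ℝ), ∀ a : Ctx × (Meas → ZMod 2),
      ∑ m ∈ ctx a.1, a.2 m = β a.1 → 0 ≤ slack a.1 a.2 (e + r • d) := by
    refine Filter.eventually_all.2 fun a => ?_
    by_cases ha : ∑ m ∈ ctx a.1, a.2 m = β a.1
    · rcases (he.1 a.1 a.2 ha).eq_or_lt with h | h
      · refine Filter.Eventually.of_forall fun r _ => ?_
        rw [slack_add_smul, ← h, hd a.1 a.2 ⟨ha, h.symm⟩]; simp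
      · have hc : Continuous fun r : ℝ => slack a.1 a.2 (e + r • d) := by
          simp only [slack_add_smul]; fun_prop
        have h0 : 0 < slack a.1 a.2 (e + (0 : ℝ) • d) := by simpa using h
        filter_upwards [(hc.tendsto 0).eventually (lt_mem_nhds h0)] with r hr _ using hr.le
    · exact Filter.Eventually.of_forall fun r h => absurd h ha
  obtain ⟨r, hr0, hr⟩ := Metric.eventually_nhds_iff.1 hev
  have hmem : ∀ x : ℝ, |x| < r → e + x • d ∈ corrPolytope β := fun x hx C t ht =>
    hr (y := x) (by simpa using hx) (C, t) ht
  have h1 := hmem (r / 2) (by rw [abs_of_pos] <;> linarith)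
  have h2 := hmem (-(r / 2)) (by rw [abs_neg, abs_of_pos] <;> linarith)
  have h3 := (mem_extremePoints.1 he).2 _ h1 _ h2
    ⟨1 / 2, 1 / 2, by norm_num, by norm_num, by norm_num, by module⟩
  have h4 : (r / 2) • d = 0 := by simpa using h3.1
  exact (smul_eq_zero.1 h4).resolve_left (by positivity)

/-! ### Closed sets of measurements -/

section Finite

set_option synthInstance.maxHeartbeats 400000
set_option synthInstance.maxSize 2000

instance : DecidablePred IsClosedSet := fun _ => by unfold IsClosedSet; infer_instance

/-- The six sets of three measurements no two of which lie in a common context. -/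
def transversal (o : Bool) (k : Fin 3) : Finset Meas :=
  Finset.univ.filter fun m => m.2 = if o then k + m.1 else k - m.1

/-- The union of the contexts of a measurement. -/
def cross (i j : Fin 3) : Finset Meas := Finset.univ.filter fun m => m.1 = i ∨ m.2 = j

/-- A closed set without a full context has at most one element in each row, hence exactly three
here. If it contains one context, the inequality asks for a further measurement, which shares a
crossing context with the first one; closedness adds that context and gives a cross. Any element
outside a cross generates everything. -/
theorem eq_transversal_or_cross_or_univ : ∀ Z : Finset Meas,
    3 + (Finset.univ.filter fun C => ctx C ⊆ Z).card ≤ Z.card → IsClosedSet Z →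
      (∃ o k, Z = transversal o k) ∨ (∃ i j, Z = cross i j) ∨ Z = Finset.univ := by
  decide +kernel

theorem eq_transversal : ∀ Ω : Finset Meas, Ω.card = 3 →
    (∀ a ∈ Ω, ∀ b ∈ Ω, a ≠ b → ¬ ∃ C, a ∈ ctx C ∧ b ∈ ctx C) →
      ∃ o k, Ω = transversal o k := by
  decide +kernel

theorem transversal_ssubset : ∀ Ω : Finset Meas, ∀ o k, transversal o k ⊆ Ω →
    IsClosedSet Ω → Ω = transversal o k ∨ Ω = Finset.univ := by
  decide +kernel

theorem cross_ssubset : ∀ Ω : Finset Meas, ∀ i j, cross i j ⊆ Ω →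
    IsClosedSet Ω → Ω = cross i j ∨ Ω = Finset.univ := by
  decide +kernel

/-- Applied to the difference of two assignments of equal parity: they agree on the context, or at
exactly one measurement. -/
theorem ctx_parity_cases : ∀ (C : Ctx) (u : Meas → ZMod 2), ∑ m ∈ ctx C, u m = 0 →
    (∀ m ∈ ctx C, u m = 0) ∨ ∃ a ∈ ctx C, u a = 0 ∧ ∀ m ∈ ctx C, m ≠ a → u m = 1 := by
  decide +kernel

theorem ctx_eq_triple : ∀ (C : Ctx), ∀ a ∈ ctx C, ∀ b ∈ ctx C, ∀ c ∈ ctx C,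
    a ≠ b → a ≠ c → b ≠ c → ctx C = {a, b, c} := by
  decide +kernel

theorem exists_ctx_triple : ∀ (C : Ctx), ∀ a ∈ ctx C, ∃ b ∈ ctx C, ∃ c ∈ ctx C,
    a ≠ b ∧ a ≠ c ∧ b ≠ c := by
  decide +kernel

end Finite

theorem mem_ctx_inl (m : Meas) : m ∈ ctx (Sum.inl m.1) := by simp [ctx]

/-! ### Correlations inside one context -/

/-- The three measurements of a context, enumerated. -/
structure Triple (C : Ctx) (a b c : Meas) : Prop where
  mem_a : a ∈ ctx C
  mem_b : b ∈ ctx C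
  mem_c : c ∈ ctx C
  ab : a ≠ b
  ac : a ≠ c
  bc : b ≠ c

theorem exists_triple {C : Ctx} {a : Meas} (ha : a ∈ ctx C) : ∃ b c, Triple C a b c := by
  obtain ⟨b, hb, c, hc, h1, h2, h3⟩ := exists_ctx_triple C a ha
  exact ⟨b, c, ha, hb, hc, h1, h2, h3⟩

namespace Triple

variable {C : Ctx} {a b c : Meas}

theorem ctx_eq (T : Triple C a b c) : ctx C = {a, b, c} :=
  ctx_eq_triple C a T.mem_a b T.mem_b c T.mem_c T.ab T.ac T.bc

theorem sum_eq (T : Triple C a b c) {M : Type*} [AddCommMonoid M] (f : Meas → M) :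
    ∑ m ∈ ctx C, f m = f a + f b + f c := by
  rw [T.ctx_eq, Finset.sum_insert (by simp [T.ab, T.ac]), Finset.sum_insert (by simp [T.bc]),
    Finset.sum_singleton, add_assoc]

theorem slack_eq (T : Triple C a b c) (t : Meas → ZMod 2) (e : Corr) :
    slack C t e = 1 + (sgn (t a) * e a + sgn (t b) * e b + sgn (t c) * e c) := by
  rw [slack, T.sum_eq]

theorem slack_nonneg (T : Triple C a b c) {β : Ctx → ZMod 2} {e : Corr}
    (he : e ∈ corrPolytope β) {x y z : ZMod 2} (h : x + y + z = β C) :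
    0 ≤ 1 + (sgn x * e a + sgn y * e b + sgn z * e c) := by
  have := he C (fun m => if m = a then x else if m = b then y else z)
    (by rw [T.sum_eq]; simpa [T.ab.symm, T.ac.symm, T.bc.symm] using h)
  rw [T.slack_eq] at this
  simpa [T.ab.symm, T.ac.symm, T.bc.symm] using this

/-- Two inequalities with the same sign at `a` and opposite signs at both `b` and `c` add up to `2 ±
2 e a ≥ 0`. -/
theorem abs_le_one (T : Triple C a b c) {β : Ctx → ZMod 2} {e : Corr}
    (he : e ∈ corrPolytope β) : |e a| ≤ 1 := by
  have h1 := T.slack_nonneg he (x := 0) (y := 0) (z := β C) (by ring)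
  have h2 := T.slack_nonneg he (x := 0) (y := 1) (z := β C + 1)
    (by linear_combination CharTwo.two_eq_zero (R := ZMod 2))
  have h3 := T.slack_nonneg he (x := 1) (y := 0) (z := β C + 1)
    (by linear_combination CharTwo.two_eq_zero (R := ZMod 2))
  have h4 := T.slack_nonneg he (x := 1) (y := 1) (z := β C)
    (by linear_combination CharTwo.two_eq_zero (R := ZMod 2))
  simp only [sgn_add, sgn_zero, sgn_one] at h1 h2 h3 h4
  rw [abs_le]
  constructor <;> linarith

theorem eq_sgn (T : Triple C a b c) {β : Ctx → ZMod 2} {e : Corr}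
    (he : e ∈ corrPolytope β) {x y : ZMod 2} (ha : e a = sgn x) (hb : e b = sgn y) :
    e c = sgn (β C + x + y) := by
  have T' : Triple C c a b := ⟨T.mem_c, T.mem_a, T.mem_b, T.ac.symm, T.bc.symm, T.ab⟩
  -- Flipping the outcomes at `a` and `b` makes the inequality `1 - 1 - 1 + sgn z * e c ≥ 0` with `z
  -- = β C + x + y`, so `e c` must be extremal.
  have h1 := T.slack_nonneg he (x := x + 1) (y := y + 1) (z := β C + x + y)
    (by linear_combination (x + y + 1) * CharTwo.two_eq_zero (R := ZMod 2))
  have h2 := abs_le.1 (T'.abs_le_one he)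
  rw [sgn_add, sgn_add, ha, hb, sgn_one] at h1
  have hx := sgn_mul_self x
  have hy := sgn_mul_self y
  have h3 : 1 ≤ sgn (β C + x + y) * e c := by linarith
  rcases sgn_eq_or (β C + x + y) with ⟨-, h⟩ | ⟨-, h⟩ <;> rw [h] at h3 ⊢ <;> linarith

end Triple

theorem abs_le_one {β : Ctx → ZMod 2} {e : Corr} (he : e ∈ corrPolytope β) (m : Meas) :
    |e m| ≤ 1 := by
  obtain ⟨b, c, T⟩ := exists_triple (mem_ctx_inl m)
  exact T.abs_le_one he

/-! ### The deterministic measurements of an extreme point -/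

/-- The measurements with a deterministic outcome. -/
def detSet (e : Corr) : Finset Meas := Finset.univ.filter fun m => |e m| = 1

theorem mem_detSet {e : Corr} {m : Meas} : m ∈ detSet e ↔ |e m| = 1 := by simp [detSet]

theorem isClosedSet_detSet {β : Ctx → ZMod 2} {e : Corr} (he : e ∈ corrPolytope β) :
    IsClosedSet (detSet e) := by
  intro C a ha b hb hab ha1 hb1 c hc
  by_cases hca : c = a
  · exact hca ▸ ha1
  by_cases hcb : c = b
  · exact hcb ▸ hb1
  have T : Triple C a b c := ⟨ha, hb, hc, hab, Ne.symm hca, Ne.symm hcb⟩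
  obtain ⟨x, hx⟩ := exists_sgn_eq (mem_detSet.1 ha1)
  obtain ⟨y, hy⟩ := exists_sgn_eq (mem_detSet.1 hb1)
  rw [mem_detSet, T.eq_sgn he hx hy]
  rcases sgn_eq_or (β C + x + y) with ⟨-, h⟩ | ⟨-, h⟩ <;> simp [h]

/-- If two distinct inequalities of a context are tight, the measurement on which they agree is
deterministic. -/
theorem Tight.eq_or_neg {β : Ctx → ZMod 2} {e : Corr} {C : Ctx} {t t' : Meas → ZMod 2}
    (h : Tight β e C t) (h' : Tight β e C t') :
    (∀ m ∈ ctx C, t' m = t m) ∨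
      ∃ a ∈ ctx C, a ∈ detSet e ∧ ∀ m ∈ ctx C, m ≠ a → sgn (t' m) = -sgn (t m) := by
  rcases ctx_parity_cases C (fun m => t' m - t m)
    (by rw [Finset.sum_sub_distrib, h.1, h'.1, sub_self]) with h0 | ⟨a, ha, hat, hm⟩
  · exact Or.inl fun m hm => sub_eq_zero.1 (h0 m hm)
  · refine Or.inr ⟨a, ha, ?_, ?_⟩
    · obtain ⟨b, c, T⟩ := exists_triple ha
      have h1 := h.2
      have h2 := h'.2
      rw [T.slack_eq] at h1 h2
      rw [sub_eq_zero.1 hat, sub_eq_iff_eq_add.1 (hm b T.mem_b T.ab.symm),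
        sub_eq_iff_eq_add.1 (hm c T.mem_c T.ac.symm), sgn_add, sgn_add, sgn_one] at h2
      -- The sum of the two equations is `2 + 2 sgn (t a) * e a = 0`, as the terms of `b` and `c`
      -- cancel.
      have h3 : sgn (t a) * e a = -1 := by linarith
      rw [mem_detSet]
      rcases sgn_eq_or (t a) with ⟨-, h⟩ | ⟨-, h⟩ <;> rw [h] at h3
      · rw [show e a = -1 by linarith]; simp
      · rw [show e a = 1 by linarith]; simp
    · intro m hmC hma
      rw [sub_eq_iff_eq_add.1 (hm m hmC hma), sgn_add, sgn_one, neg_one_mul]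

/-- Record of a vector the coordinates in `Z = detSet e` and one tight functional for each context
not inside `Z`. At an extreme point this map is injective, whence `9 ≤ |Z| + 6 - #{C ⊆ Z}`. -/
theorem card_le_of_mem_extremePoints {β : Ctx → ZMod 2} {e : Corr}
    (he : e ∈ (corrPolytope β).extremePoints ℝ) :
    3 + (Finset.univ.filter fun C => ctx C ⊆ detSet e).card ≤ (detSet e).card := by
  classical
  -- For a context without tight inequality `t` is the default 0; its functional is an additional
  -- condition that does no harm.
  have hex : ∀ C, ∃ t, (∃ t', Tight β e C t') → Tight β e C t := by
    intro C
    by_cases h : ∃ t', Tight β e C t'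
    · exact ⟨h.choose, fun _ => h.choose_spec⟩
    · exact ⟨0, fun h' => absurd h' h⟩
  choose t ht using hex
  let Φ : Corr →ₗ[ℝ] ({m // m ∈ detSet e} ⊕ {C // ¬ ctx C ⊆ detSet e}) → ℝ :=
    LinearMap.pi fun i => match i with
      | Sum.inl m => LinearMap.proj m.1
      | Sum.inr C => ∑ m ∈ ctx C.1, sgn (t C.1 m) • LinearMap.proj m
  have hinj : Function.Injective Φ := by
    rw [← LinearMap.ker_eq_bot, LinearMap.ker_eq_bot']
    intro d hd
    have h1 : ∀ m ∈ detSet e, d m = 0 := fun m hm => congrFun hd (Sum.inl ⟨m, hm⟩)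
    have h2 : ∀ C, ¬ ctx C ⊆ detSet e → ∑ m ∈ ctx C, sgn (t C m) * d m = 0 := by
      intro C hC
      have := congrFun hd (Sum.inr ⟨C, hC⟩)
      simpa [Φ] using this
    refine eq_zero_of_forall_tight he fun C t' ht' => ?_
    by_cases hC : ctx C ⊆ detSet e
    · exact Finset.sum_eq_zero fun m hm => by rw [h1 m (hC hm), mul_zero]
    -- Any other tight functional of the context is the negative of the chosen one outside a
    -- deterministic `a`, where `d` vanishes.
    · rcases (ht C ⟨t', ht'⟩).eq_or_neg ht' with h | ⟨a, ha, hae, h⟩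
      · rw [← h2 C hC]
        exact Finset.sum_congr rfl fun m hm => by rw [h m hm]
      · rw [← neg_eq_zero, ← h2 C hC, ← Finset.sum_neg_distrib]
        refine Finset.sum_congr rfl fun m hm => ?_
        by_cases hma : m = a
        · rw [hma, h1 a hae]; simp
        · rw [h m hm hma]; ring
  have hle := LinearMap.finrank_le_finrank_of_injective hinj
  rw [Module.finrank_fintype_fun_eq_card, Module.finrank_fintype_fun_eq_card,
    Fintype.card_sum, Fintype.card_coe, Fintype.card_subtype_compl] at hle
  have h3 : Fintype.card {C // ctx C ⊆ detSet e} =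
      (Finset.univ.filter fun C => ctx C ⊆ detSet e).card := Fintype.card_subtype _
  have h4 : (Finset.univ.filter fun C => ctx C ⊆ detSet e).card ≤ 6 :=
    (Finset.card_le_univ _).trans (by decide)
  have h5 : Fintype.card Meas = 9 := by decide
  have h6 : Fintype.card Ctx = 6 := by decide
  rw [h3, h5, h6] at hle
  omega

theorem detSet_cases {β : Ctx → ZMod 2} {e : Corr}
    (he : e ∈ (corrPolytope β).extremePoints ℝ) :
    (∃ o k, detSet e = transversal o k) ∨ (∃ i j, detSet e = cross i j) ∨
      detSet e = Finset.univ :=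
  eq_transversal_or_cross_or_univ _ (card_le_of_mem_extremePoints he) (isClosedSet_detSet he.1)

/-- On a context all of whose measurements are deterministic the outcomes have parity `β`. -/
theorem sum_eq_of_det {β : Ctx → ZMod 2} {e : Corr} (he : e ∈ corrPolytope β) {C : Ctx}
    {t : Meas → ZMod 2} (h : ∀ m ∈ ctx C, e m = sgn (t m)) : ∑ m ∈ ctx C, t m = β C := by
  obtain ⟨a, ha⟩ := exists_mem_ctx C
  obtain ⟨b, c, T⟩ := exists_triple ha
  have h1 := T.eq_sgn he (h a T.mem_a) (h b T.mem_b)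
  rw [h c T.mem_c] at h1
  rw [T.sum_eq, sgn_injective h1]
  linear_combination (t a + t b) * CharTwo.two_eq_zero (R := ZMod 2)

/-- The slack is 4 if `t'` and `t` agree on the context, and otherwise `1 + 1 - 1 - 1 = 0`. -/
theorem sgn_mem_corrPolytope {β : Ctx → ZMod 2} {t : Meas → ZMod 2}
    (h : ∀ C, ∑ m ∈ ctx C, t m = β C) : (fun m => sgn (t m)) ∈ corrPolytope β := by
  intro C t' ht'
  have h1 : slack C t' (fun m => sgn (t m)) = 1 + ∑ m ∈ ctx C, sgn (t' m + t m) := by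
    simp [slack, sgn_add]
  rw [h1]
  rcases ctx_parity_cases C (fun m => t' m + t m)
    (by rw [Finset.sum_add_distrib, h C, ht']; exact CharTwo.add_self_eq_zero _)
    with h0 | ⟨a, ha, hat, hm⟩
  · rw [Finset.sum_congr rfl fun m hm => by rw [h0 m hm, sgn_zero]]
    positivity
  · obtain ⟨b, c, T⟩ := exists_triple ha
    rw [T.sum_eq, hat, hm b T.mem_b T.ab.symm, hm c T.mem_c T.ac.symm, sgn_zero, sgn_one]
    norm_num

/-! ### Deterministic points and the even Mermin polytope -/

section Finite

set_option synthInstance.maxHeartbeats 400000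
set_option synthInstance.maxSize 2000

/-- A parametrization of the functions of even parity on all contexts. -/
def evenFun (x y z w : ZMod 2) : Meas → ZMod 2 := fun m =>
  !![x, y, x + y; z, w, z + w; x + z, y + w, x + y + z + w] m.1 m.2

theorem sum_evenFun : ∀ x y z w C, ∑ m ∈ ctx C, evenFun x y z w m = 0 := by decide +kernel

theorem card_even :
    Fintype.card {t : Meas → ZMod 2 // ∀ C, ∑ m ∈ ctx C, t m = 0} = 16 := by
  decide +kernel

theorem exists_even_transversal : ∀ o k, ∀ s : Fin 3 → ZMod 2, ∃ x y z w,
    ∀ m ∈ transversal o k, evenFun x y z w m = s m.1 := by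
  decide +kernel

theorem exists_even_cross : ∀ i j, ∀ s : Meas → ZMod 2, ∑ m ∈ ctx (Sum.inl i), s m = 0 →
    ∑ m ∈ ctx (Sum.inr j), s m = 0 → ∃ x y z w, ∀ m ∈ cross i j, evenFun x y z w m = s m := by
  decide +kernel

theorem exists_mem_transversal : ∀ o k C, ∃ m ∈ ctx C, m ∈ transversal o k := by decide +kernel

theorem exists_mem_cross : ∀ i j C, ∃ m ∈ ctx C, m ∈ cross i j := by decide +kernel

theorem ctx_subset_cross : ∀ i j, ctx (Sum.inl i) ⊆ cross i j ∧ ctx (Sum.inr j) ⊆ cross i j := by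
  decide +kernel

theorem eq_of_mem_transversal : ∀ o k, ∀ m ∈ transversal o k, ∀ m' ∈ transversal o k,
    m.1 = m'.1 → m = m' := by
  decide +kernel

/-- The support of a function of even parity on all contexts is connected. -/
theorem even_support_connected : ∀ u : Meas → ZMod 2, (∀ C, ∑ m ∈ ctx C, u m = 0) →
    ∀ m₀, u m₀ = 1 → ∀ m, u m = 1 → ∃ m₁, u m₁ = 1 ∧ (∃ C, m₀ ∈ ctx C ∧ m₁ ∈ ctx C) ∧
      ∃ m₂, u m₂ = 1 ∧ (∃ C, m₁ ∈ ctx C ∧ m₂ ∈ ctx C) ∧ ∃ C, m₂ ∈ ctx C ∧ m ∈ ctx C := by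
  decide +kernel

end Finite

/-- The deterministic point with outcomes `t`. -/
def detPoint (t : Meas → ZMod 2) : Corr := fun m => sgn (t m)

theorem detPoint_injective : Function.Injective detPoint := fun s t h => by
  ext m
  exact sgn_injective (congrFun h m)

theorem slack_detPoint {C : Ctx} {t t' : Meas → ZMod 2} :
    slack C t' (detPoint t) = 1 + ∑ m ∈ ctx C, sgn (t' m + t m) := by
  simp [slack, sgn_add, detPoint]

/-- Flipping two outcomes keeps the parity, and at `t'` the slack is `1 - 1 - σ + σ` with `σ = sgn
(t c + t' c)`. With `t' = t` this also gives inequalities tight at `t` itself. -/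
theorem Triple.tight_flip {β : Ctx → ZMod 2} {C : Ctx} {a b c : Meas} (T : Triple C a b c)
    {t t' : Meas → ZMod 2} (ht : ∑ m ∈ ctx C, t m = β C) (h : t b + t' b = t c + t' c)
    (ha : t a = t' a) :
    Tight β (detPoint t') C (fun m => if m = c then t m else t m + 1) := by
  refine ⟨?_, ?_⟩
  · rw [← ht, T.sum_eq, T.sum_eq]
    simp only [T.ac, T.bc, if_false, if_true]
    linear_combination CharTwo.two_eq_zero (R := ZMod 2)
  · rw [slack_detPoint, T.sum_eq]
    simp only [T.ac, T.bc, if_false, if_true]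
    rw [← ha, ← h, show t a + 1 + t a = 1 by
      linear_combination t a * CharTwo.two_eq_zero (R := ZMod 2),
      show t b + 1 + t' b = (t b + t' b) + 1 by ring, sgn_add (t b + t' b) 1, sgn_one]
    ring

/-- On the smallest face containing two deterministic points, the measurements of a context
behave as they do at these two points. -/
theorem Triple.eq_of_mem_commonFace {β : Ctx → ZMod 2} {C : Ctx} {a b c : Meas}
    (T : Triple C a b c) {t t' : Meas → ZMod 2} (ht : ∑ m ∈ ctx C, t m = β C)
    (ht' : ∑ m ∈ ctx C, t' m = β C) (ha : t a = t' a) {x : Corr}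
    (hx : x ∈ commonFace β (detPoint t) (detPoint t')) :
    x a = sgn (t a) ∧ sgn (t b) * x b = sgn (t c) * x c := by
  have T' : Triple C a c b := ⟨T.mem_a, T.mem_c, T.mem_b, T.ac, T.ab, T.bc.symm⟩
  have hbc : t b + t' b = t c + t' c := by
    have := ht.trans ht'.symm
    rw [T.sum_eq, T.sum_eq, ha] at this
    linear_combination this + (t' b - t c) * CharTwo.two_eq_zero (R := ZMod 2)
  -- The flips of `{a, b}` and of `{a, c}` are tight at both points. The sum of the two equations
  -- fixes `x a`, their difference relates `x b` and `x c`.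
  have h1 := (hx.2 C _ (T.tight_flip ht (by
    linear_combination (t b - t c) * CharTwo.two_eq_zero (R := ZMod 2)) rfl)
      (T.tight_flip ht hbc ha)).2
  have h2 := (hx.2 C _ (T'.tight_flip ht (by
    linear_combination (t c - t b) * CharTwo.two_eq_zero (R := ZMod 2)) rfl)
      (T'.tight_flip ht hbc.symm ha)).2
  rw [T.slack_eq] at h1 h2
  simp only [T.ac, T.bc, T.ab, T.bc.symm, if_false, if_true, sgn_add, sgn_one] at h1 h2
  have h3 : sgn (t a) * x a = 1 := by linarith
  refine ⟨?_, by linarith⟩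
  linear_combination sgn (t a) * h3 - x a * sgn_mul_self (t a)

theorem detPoint_mem_extremePoints {β : Ctx → ZMod 2} {t : Meas → ZMod 2}
    (ht : ∀ C, ∑ m ∈ ctx C, t m = β C) : detPoint t ∈ (corrPolytope β).extremePoints ℝ := by
  refine mem_extremePoints_of_commonFace (sgn_mem_corrPolytope ht) fun x hx h => ?_
  ext m
  obtain ⟨b, c, T⟩ := exists_triple (mem_ctx_inl m)
  exact (T.eq_of_mem_commonFace (ht _) (ht _) rfl ⟨hx, fun C t h1 _ => h C t h1⟩).1

/-- On the common face `x m` is fixed where `t` and `t'` agree, and `sgn (t m) * x m` is constant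
along contexts where they differ. Connectedness of the latter set leaves one parameter `r`. -/
theorem isExposed_segment_detPoint {β : Ctx → ZMod 2} {t t' : Meas → ZMod 2}
    (ht : ∀ C, ∑ m ∈ ctx C, t m = β C) (ht' : ∀ C, ∑ m ∈ ctx C, t' m = β C) (hne : t ≠ t') :
    IsExposed ℝ (corrPolytope β) (segment ℝ (detPoint t) (detPoint t')) := by
  refine isExposed_segment (sgn_mem_corrPolytope ht) (sgn_mem_corrPolytope ht') fun x hx => ?_
  have hu : ∀ C, ∑ m ∈ ctx C, (t m + t' m) = 0 := fun C => by
    rw [Finset.sum_add_distrib, ht, ht']; exact CharTwo.add_self_eq_zero _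
  have hu0 : ∀ {m}, t m + t' m = 0 → t m = t' m := fun h => CharTwo.add_eq_zero.1 h
  have hu1 : ∀ {m}, t m + t' m = 1 → t' m = t m + 1 := fun {m} h => by
    linear_combination h - t m * CharTwo.two_eq_zero (R := ZMod 2)
  have hstep : ∀ {m m'}, t m + t' m = 1 → t m' + t' m' = 1 →
      (∃ C, m ∈ ctx C ∧ m' ∈ ctx C) → sgn (t m) * x m = sgn (t m') * x m' := by
    rintro m m' hm hm' ⟨C, hC, hC'⟩
    by_cases h : m = m'
    · rw [h]
    rcases ctx_parity_cases C _ (hu C) with h0 | ⟨a, ha, hat, -⟩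
    · rw [h0 m hC] at hm; exact absurd hm (by decide)
    · have T : Triple C a m m' := ⟨ha, hC, hC', fun h => by
        rw [← h, hat] at hm; exact absurd hm (by decide), fun h => by
        rw [← h, hat] at hm'; exact absurd hm' (by decide), h⟩
      exact (T.eq_of_mem_commonFace (ht C) (ht' C) (hu0 hat) hx).2
  obtain ⟨m₀, hm₀⟩ : ∃ m, t m + t' m = 1 := by
    by_contra hcon
    push Not at hcon
    exact hne (funext fun m => hu0 ((zmod2_eq_zero_or_one _).resolve_right (hcon m)))
  have hconn : ∀ m, t m + t' m = 1 → sgn (t m₀) * x m₀ = sgn (t m) * x m := by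
    intro m hm
    obtain ⟨m₁, h1, h2, m₂, h3, h4, h5⟩ := even_support_connected _ hu m₀ hm₀ m hm
    exact ((hstep hm₀ h1 h2).trans (hstep h1 h3 h4)).trans (hstep h3 hm h5)
  obtain ⟨r, hr⟩ : ∃ r, r = sgn (t m₀) * x m₀ := ⟨_, rfl⟩
  have hr1 : |r| ≤ 1 := by
    have := abs_le_one hx.1 m₀
    rcases sgn_eq_or (t m₀) with ⟨-, h⟩ | ⟨-, h⟩ <;> rw [hr, h] <;> simpa using this
  rw [abs_le] at hr1
  -- The parameter `r` is 1 at `detPoint t` and -1 at `detPoint t'`, which dictates the weights.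
  refine ⟨(1 + r) / 2, (1 - r) / 2, by linarith, by linarith, by ring, ?_⟩
  ext m
  simp only [Pi.add_apply, Pi.smul_apply, smul_eq_mul, detPoint]
  rcases zmod2_eq_zero_or_one (t m + t' m) with h | h
  · obtain ⟨b, c, T⟩ := exists_triple (mem_ctx_inl m)
    rw [(T.eq_of_mem_commonFace (ht _) (ht' _) (hu0 h) hx).1, ← hu0 h]
    ring
  · rw [hu1 h, sgn_add, sgn_one]
    have := hconn m h
    rw [← hr] at this
    rw [this]
    linear_combination x m * sgn_mul_self (t m)

/-- An extreme point whose deterministic outcomes extend to all measurements is deterministic. -/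
theorem eq_detPoint_of_extend {β : Ctx → ZMod 2} {e : Corr}
    (he : e ∈ (corrPolytope β).extremePoints ℝ) {t : Meas → ZMod 2}
    (ht : ∀ C, ∑ m ∈ ctx C, t m = β C) (het : ∀ m ∈ detSet e, e m = sgn (t m))
    (hmeet : ∀ C, ∃ m ∈ ctx C, m ∈ detSet e) : e = detPoint t := by
  -- It suffices that every inequality tight at `e` is tight at `detPoint t`, since then the
  -- difference is a direction preserving tightness.
  have h0 : detPoint t - e = 0 := by
    refine eq_zero_of_forall_tight he fun C t' ht' => ?_
    have hgoal : slack C t' (detPoint t) = 0 → ∑ m ∈ ctx C, sgn (t' m) * (detPoint t - e) m = 0 :=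
      fun h => by
        have := slack_sub_slack C t' (detPoint t) e
        rw [h, ht'.2, sub_zero] at this
        exact this.symm
    apply hgoal
    obtain ⟨a, ha, hae⟩ := hmeet C
    obtain ⟨b, c, T⟩ := exists_triple ha
    have h1 := ht'.2
    rw [T.slack_eq, het a hae, ← sgn_add] at h1
    rw [slack_detPoint, T.sum_eq]
    have hpar : (t' a + t a) + (t' b + t b) + (t' c + t c) = 0 := by
      have h2 := ht'.1
      have h3 := ht C
      rw [T.sum_eq] at h2 h3
      linear_combination h2 - h3 + (t a + t b + t c) * CharTwo.two_eq_zero (R := ZMod 2)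
    -- If `t'` agrees with `t` at `a`, tightness at `e` forces the terms of `b` and `c` to be -1
    -- each, so both are deterministic and their outcomes are those of `t`. Otherwise parity makes
    -- `t'` and `t` agree at exactly one of `b` and `c`, and the slack at `detPoint t` vanishes by
    -- itself.
    rcases sgn_eq_or (t' a + t a) with ⟨h, hs⟩ | ⟨h, hs⟩
    · have hb := abs_le.1 (abs_le_one he.1 b)
      have hc := abs_le.1 (abs_le_one he.1 c)
      rw [hs] at h1
      have hmul : ∀ {m}, -1 ≤ sgn (t' m) * e m ∧ (sgn (t' m) * e m = -1 → m ∈ detSet e) := by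
        intro m
        have hm := abs_le.1 (abs_le_one he.1 m)
        rcases sgn_eq_or (t' m) with ⟨-, h⟩ | ⟨-, h⟩ <;> rw [h]
        · exact ⟨by linarith, fun h' => by
            rw [mem_detSet, show e m = -1 by linarith]; simp⟩
        · exact ⟨by linarith, fun h' => by
            rw [mem_detSet, show e m = 1 by linarith]; simp⟩
      have hb' : sgn (t' b) * e b = -1 := by linarith [(hmul (m := b)).1, (hmul (m := c)).1]
      have hc' : sgn (t' c) * e c = -1 := by linarith [(hmul (m := b)).1, (hmul (m := c)).1]
      rw [het b (hmul.2 hb'), ← sgn_add] at hb'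
      rw [het c (hmul.2 hc'), ← sgn_add] at hc'
      rw [hs, hb', hc']; norm_num
    · rw [h] at hpar
      have hbc : t' b + t b = (t' c + t c) + 1 := by
        linear_combination hpar - (t' c + t c + 1) * CharTwo.two_eq_zero (R := ZMod 2)
      rw [hs, hbc, sgn_add _ 1, sgn_one]; ring
  exact (sub_eq_zero.1 h0).symm

/-- Even parity obstructs no extension: outcomes on a transversal are unconstrained, and those on a
cross only satisfy the parities of its two contexts. -/
theorem extremePoints_corrPolytope_beta0 : (corrPolytope beta0).extremePoints ℝ =
    detPoint '' {t | ∀ C, ∑ m ∈ ctx C, t m = 0} := by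
  refine Set.Subset.antisymm (fun e he => ?_)
    (Set.image_subset_iff.2 fun t ht => detPoint_mem_extremePoints ht)
  have hs : ∀ m, ∃ a, m ∈ detSet e → e m = sgn a := fun m => by
    by_cases h : m ∈ detSet e
    · obtain ⟨a, ha⟩ := exists_sgn_eq (mem_detSet.1 h)
      exact ⟨a, fun _ => ha⟩
    · exact ⟨0, fun h' => absurd h' h⟩
  choose s hs using hs
  rcases detSet_cases he with ⟨o, k, hZ⟩ | ⟨i, j, hZ⟩ | hZ
  · have hrow : ∀ i, ∃ a, ∀ m ∈ transversal o k, m.1 = i → s m = a := by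
      intro i
      by_cases h : ∃ m ∈ transversal o k, m.1 = i
      · obtain ⟨m, hm, hmi⟩ := h
        exact ⟨s m, fun m' hm' h' =>
          congrArg s (eq_of_mem_transversal o k m' hm' m hm (h'.trans hmi.symm))⟩
      · exact ⟨0, fun m hm h' => absurd ⟨m, hm, h'⟩ h⟩
    choose a ha using hrow
    obtain ⟨x, y, z, w, h⟩ := exists_even_transversal o k a
    refine ⟨_, sum_evenFun x y z w, (eq_detPoint_of_extend he (sum_evenFun x y z w)
      (fun m hm => ?_) (hZ ▸ exists_mem_transversal o k)).symm⟩
    rw [hs m hm, h m (hZ ▸ hm), ha m.1 m (hZ ▸ hm) rfl]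
  · have hpar : ∀ C, ctx C ⊆ cross i j → ∑ m ∈ ctx C, s m = 0 := fun C hC =>
      sum_eq_of_det he.1 fun m hm => hs m (hZ ▸ hC hm)
    obtain ⟨x, y, z, w, h⟩ := exists_even_cross i j s (hpar _ (ctx_subset_cross i j).1)
      (hpar _ (ctx_subset_cross i j).2)
    refine ⟨_, sum_evenFun x y z w, (eq_detPoint_of_extend he (sum_evenFun x y z w)
      (fun m hm => ?_) (hZ ▸ exists_mem_cross i j)).symm⟩
    rw [hs m hm, h m (hZ ▸ hm)]
  · have hall : ∀ m, e m = sgn (s m) := fun m => hs m (hZ ▸ Finset.mem_univ m)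
    exact ⟨s, fun C => sum_eq_of_det he.1 fun m _ => hall m, (funext hall).symm⟩

theorem extremePoints_MP (β : Ctx → ZMod 2) :
    (MP β).extremePoints ℝ = distOf β '' (corrPolytope β).extremePoints ℝ := by
  rw [MP_eq_image]
  exact extremePoints_image_affine (distOfAff β) (distOf_injective β) _

theorem isExposed_MP_segment {β : Ctx → ZMod 2} {v w : Corr}
    (h : IsExposed ℝ (corrPolytope β) (segment ℝ v w)) :
    IsExposed ℝ (MP β) (segment ℝ (distOf β v) (distOf β w)) := by
  have := isExposed_image_of_leftInverse (distOfAff β) expectCLM (expect_distOf β) h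
  rw [image_segment] at this
  rwa [MP_eq_image]

theorem isExtreme_corrPolytope_segment {β : Ctx → ZMod 2} {v w : Corr}
    (h : IsExposed ℝ (MP β) (segment ℝ (distOf β v) (distOf β w))) :
    IsExtreme ℝ (corrPolytope β) (segment ℝ v w) := by
  refine isExtreme_of_image (distOfAff β) (distOf_injective β) ?_
  rw [image_segment]
  rw [MP_eq_image] at h
  exact h.isExtreme

theorem polytopeGraph_MP_beta0 :
    Nonempty (polytopeGraph (MP beta0) ≃g (⊤ : SimpleGraph (Fin 16))) := by
  let f : {t : Meas → ZMod 2 // ∀ C, ∑ m ∈ ctx C, t m = 0} → (MP beta0).extremePoints ℝ :=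
    fun t => ⟨distOf beta0 (detPoint t.1), by
      rw [extremePoints_MP]
      exact ⟨_, detPoint_mem_extremePoints t.2, rfl⟩⟩
  have hf : Function.Bijective f := by
    constructor
    · intro s t h
      exact Subtype.ext (detPoint_injective (distOf_injective _ (congrArg Subtype.val h)))
    · rintro ⟨p, hp⟩
      have hp' := hp
      rw [extremePoints_MP, extremePoints_corrPolytope_beta0] at hp'
      obtain ⟨_, ⟨t, ht, rfl⟩, rfl⟩ := hp'
      exact ⟨⟨t, ht⟩, rfl⟩
  let e := (Equiv.ofBijective f hf).symm.trans (Fintype.equivFinOfCardEq card_even)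
  refine ⟨⟨e, fun {p q} => ?_⟩⟩
  simp only [SimpleGraph.top_adj, ne_eq, EmbeddingLike.apply_eq_iff_eq]
  refine ⟨fun hpq => ⟨hpq, ?_⟩, fun h => h.1⟩
  obtain ⟨s, rfl⟩ := hf.2 p
  obtain ⟨t, rfl⟩ := hf.2 q
  exact isExposed_MP_segment (isExposed_segment_detPoint s.2 t.2 fun h =>
    hpq (congrArg f (Subtype.ext h)))

/-! ### Signed permutations of the measurements that preserve the odd polytope -/

/-- The signed permutation `γ` of the coordinates with `(γ e) (τ m) = (-1)^(ε m) e m`. -/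
def signedPerm (τ : Equiv.Perm Meas) (ε : Meas → ZMod 2) : Corr ≃ₗ[ℝ] Corr where
  toFun e := fun m => sgn (ε (τ.symm m)) * e (τ.symm m)
  invFun e := fun m => sgn (ε m) * e (τ m)
  map_add' x y := by ext m; simp [mul_add]
  map_smul' r x := by ext m; simp [mul_left_comm]
  left_inv e := by ext m; simp [← mul_assoc, sgn_mul_self]
  right_inv e := by ext m; simp [← mul_assoc, sgn_mul_self]

theorem signedPerm_apply (τ : Equiv.Perm Meas) (ε : Meas → ZMod 2) (e : Corr) (m : Meas) :
    signedPerm τ ε e (τ m) = sgn (ε m) * e m := by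
  simp [signedPerm]

theorem signedPerm_mul (τ τ' : Equiv.Perm Meas) (ε ε' : Meas → ZMod 2) :
    signedPerm τ ε * signedPerm τ' ε' = signedPerm (τ * τ') (fun m => ε' m + ε (τ' m)) := by
  ext e m
  obtain ⟨m, rfl⟩ := (τ * τ').surjective m
  rw [signedPerm_apply, LinearEquiv.mul_apply, Equiv.Perm.mul_apply, signedPerm_apply,
    signedPerm_apply, sgn_add]
  ring

theorem signedPerm_one : signedPerm 1 0 = 1 := by
  ext e m
  have := signedPerm_apply 1 0 e m
  simpa [sgn_zero] using this

theorem signedPerm_inv (τ : Equiv.Perm Meas) (ε : Meas → ZMod 2) :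
    (signedPerm τ ε)⁻¹ = signedPerm τ⁻¹ (fun m => ε (τ⁻¹ m)) := by
  rw [inv_eq_iff_mul_eq_one, signedPerm_mul, ← signedPerm_one]
  congr 1
  · simp
  · ext m; simp [CharTwo.add_self_eq_zero]

/-- The signed permutation given by `τ` and `ε` preserves the odd Mermin scenario: it permutes the
contexts, and the signs compensate the change of `β₁`. -/
def IsSym (τ : Equiv.Perm Meas) (ε : Meas → ZMod 2) : Prop :=
  ∃ c : Equiv.Perm Ctx, ∀ C, (∀ m, m ∈ ctx C ↔ τ m ∈ ctx (c C)) ∧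
    beta1 (c C) = beta1 C + ∑ m ∈ ctx C, ε m

theorem sum_ctx_map {τ : Equiv.Perm Meas} {C C' : Ctx} (h : ∀ m, m ∈ ctx C ↔ τ m ∈ ctx C')
    {M : Type*} [AddCommMonoid M] (f : Meas → M) :
    ∑ m ∈ ctx C', f m = ∑ m ∈ ctx C, f (τ m) :=
  (Finset.sum_equiv τ h fun _ _ => rfl).symm

theorem IsSym.one : IsSym 1 0 := ⟨1, fun C => by simp⟩

theorem IsSym.mul {τ τ' : Equiv.Perm Meas} {ε ε' : Meas → ZMod 2} (h : IsSym τ ε)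
    (h' : IsSym τ' ε') : IsSym (τ * τ') (fun m => ε' m + ε (τ' m)) := by
  obtain ⟨c, hc⟩ := h
  obtain ⟨c', hc'⟩ := h'
  refine ⟨c * c', fun C => ⟨fun m => ?_, ?_⟩⟩
  · rw [(hc' C).1 m, (hc (c' C)).1]; rfl
  · rw [Equiv.Perm.mul_apply, (hc (c' C)).2, (hc' C).2, sum_ctx_map (hc' C).1,
      Finset.sum_add_distrib, add_assoc]

theorem IsSym.inv {τ : Equiv.Perm Meas} {ε : Meas → ZMod 2} (h : IsSym τ ε) :
    IsSym τ⁻¹ (fun m => ε (τ⁻¹ m)) := by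
  obtain ⟨c, hc⟩ := h
  refine ⟨c⁻¹, fun C => ⟨fun m => ?_, ?_⟩⟩
  · rw [(hc (c⁻¹ C)).1 (τ⁻¹ m)]; simp
  · have h1 := (hc (c⁻¹ C)).2
    have h2 := sum_ctx_map (hc (c⁻¹ C)).1 fun m => ε (τ⁻¹ m)
    simp only [Equiv.Perm.inv_def, Equiv.apply_symm_apply, Equiv.symm_apply_apply] at h1 h2 ⊢
    rw [h1, h2, add_assoc, CharTwo.add_self_eq_zero, add_zero]

/-- The map of contexts is automatically a permutation because distinct contexts are distinct sets;
without it the hypothesis is a finite check context by context. -/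
theorem IsSym.of_forall_exists {τ : Equiv.Perm Meas} {ε : Meas → ZMod 2}
    (h : ∀ C, ∃ C', (∀ m, m ∈ ctx C ↔ τ m ∈ ctx C') ∧
      beta1 C' = beta1 C + ∑ m ∈ ctx C, ε m) : IsSym τ ε := by
  choose c hc using h
  have hinj : Function.Injective c := by
    intro C C' hCC
    have h1 : ctx C = ctx C' := by
      ext m; rw [(hc C).1, (hc C').1, hCC]
    revert h1
    clear * -
    revert C C'
    decide +kernel
  exact ⟨Equiv.ofBijective c (Finite.injective_iff_bijective.1 hinj), hc⟩

/-- The group of the signed permutations that preserve the odd Mermin scenario. -/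
def symGroup : Subgroup (Corr ≃ₗ[ℝ] Corr) where
  carrier := {γ | ∃ τ ε, IsSym τ ε ∧ γ = signedPerm τ ε}
  one_mem' := ⟨1, 0, IsSym.one, signedPerm_one.symm⟩
  mul_mem' := by
    rintro _ _ ⟨τ, ε, h, rfl⟩ ⟨τ', ε', h', rfl⟩
    exact ⟨_, _, h.mul h', signedPerm_mul _ _ _ _⟩
  inv_mem' := by
    rintro _ ⟨τ, ε, h, rfl⟩
    exact ⟨_, _, h.inv, signedPerm_inv _ _⟩

/-- The inequality `(c C, t)` at `γ e` is the inequality `(C, t ∘ τ + ε)` at `e`; the condition on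
`beta1` in `IsSym` says that the latter has the right parity. -/
theorem map_mem_corrPolytope {γ : Corr ≃ₗ[ℝ] Corr} (hγ : γ ∈ symGroup) {e : Corr}
    (he : e ∈ corrPolytope beta1) : γ e ∈ corrPolytope beta1 := by
  obtain ⟨τ, ε, ⟨c, hc⟩, rfl⟩ := hγ
  intro C' t ht
  obtain ⟨C, rfl⟩ := c.surjective C'
  have h1 : slack (c C) t (signedPerm τ ε e) = slack C (fun m => t (τ m) + ε m) e := by
    rw [slack, slack, sum_ctx_map (hc C).1]
    congr 1
    exact Finset.sum_congr rfl fun m _ => by rw [signedPerm_apply, sgn_add]; ring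
  rw [h1]
  refine he C _ ?_
  rw [Finset.sum_add_distrib, ← sum_ctx_map (hc C).1 t, ht, (hc C).2, add_assoc,
    CharTwo.add_self_eq_zero, add_zero]

theorem image_corrPolytope {γ : Corr ≃ₗ[ℝ] Corr} (hγ : γ ∈ symGroup) :
    γ '' corrPolytope beta1 = corrPolytope beta1 := by
  refine Set.Subset.antisymm (Set.image_subset_iff.2 fun e he => map_mem_corrPolytope hγ he)
    fun e he => ⟨γ⁻¹ e, map_mem_corrPolytope (inv_mem hγ) he, ?_⟩
  rw [← LinearEquiv.mul_apply, mul_inv_cancel]; rfl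

theorem dotProduct_map {γ : Corr ≃ₗ[ℝ] Corr} (hγ : γ ∈ symGroup) (u v : Corr) :
    γ u ⬝ᵥ γ v = u ⬝ᵥ v := by
  obtain ⟨τ, ε, -, rfl⟩ := hγ
  rw [dotProduct, dotProduct, ← Equiv.sum_comp τ]
  refine Finset.sum_congr rfl fun m _ => ?_
  rw [signedPerm_apply, signedPerm_apply]
  linear_combination (u m * v m) * sgn_mul_self (ε m)

theorem map_mem_extremePoints {γ : Corr ≃ₗ[ℝ] Corr} (hγ : γ ∈ symGroup) {e : Corr}
    (he : e ∈ (corrPolytope beta1).extremePoints ℝ) :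
    γ e ∈ (corrPolytope beta1).extremePoints ℝ := by
  have := extremePoints_image_affine γ.toLinearMap.toAffineMap γ.injective (corrPolytope beta1)
  have h2 : (γ.toLinearMap.toAffineMap : Corr → Corr) = γ := rfl
  rw [h2, image_corrPolytope hγ] at this
  rw [this]
  exact ⟨e, he, rfl⟩

theorem map_isExposed_segment {γ : Corr ≃ₗ[ℝ] Corr} (hγ : γ ∈ symGroup) {v w : Corr}
    (h : IsExposed ℝ (corrPolytope beta1) (segment ℝ v w)) :
    IsExposed ℝ (corrPolytope beta1) (segment ℝ (γ v) (γ w)) := by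
  have h1 := isExposed_image_of_leftInverse γ.toLinearMap.toAffineMap
    (LinearMap.toContinuousLinearMap γ.symm.toLinearMap) (fun x => γ.symm_apply_apply x) h
  rw [image_segment] at h1
  have h2 : (γ.toLinearMap.toAffineMap : Corr → Corr) = γ := rfl
  rwa [h2, image_corrPolytope hγ] at h1

/-! ### Symmetries from pairs of rotations of the cube -/

/-- Codes for the 24 signed permutations of the three axes of determinant one: an affine
permutation `x ↦ c ± x` of the axes, and the signs of the first two axes. -/
abbrev Rot : Type := Bool × Fin 3 × ZMod 2 × ZMod 2

/-- The permutation of the axes. -/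
def Rot.perm (r : Rot) : Equiv.Perm (Fin 3) where
  toFun x := if r.1 then r.2.1 + x else r.2.1 - x
  invFun x := if r.1 then x - r.2.1 else r.2.1 - x
  left_inv x := by split_ifs <;> simp
  right_inv x := by split_ifs <;> simp

/-- The signs of the axes. -/
def Rot.sign (r : Rot) : Fin 3 → ZMod 2 :=
  -- The permutation `x ↦ c + x` is even and `x ↦ c - x` odd, so the third sign makes the
  -- determinant one.
  ![r.2.2.1, r.2.2.2, r.2.2.1 + r.2.2.2 + if r.1 then 0 else 1]

/-- The measurement `m` is the tensor product of two Pauli operators with these indices. -/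
def pauliIdx : Meas ≃ Fin 3 × Fin 3 where
  toFun m := (m.2 - m.1, -m.1 - m.2)
  invFun a := (a.1 + a.2, a.2 - a.1)
  left_inv := by decide
  right_inv := by decide

/-- The permutation of the measurements given by two rotations. -/
def rotPerm (r r' : Rot) : Equiv.Perm Meas :=
  (pauliIdx.trans (Equiv.prodCongr r.perm r'.perm)).trans pauliIdx.symm

/-- The signs given by two rotations. -/
def rotSign (r r' : Rot) (m : Meas) : ZMod 2 :=
  r.sign (pauliIdx m).1 + r'.sign (pauliIdx m).2

/-- The permutation of the measurements given by the exchange of the qubits. -/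
def swapPerm : Equiv.Perm Meas := (pauliIdx.trans (Equiv.prodComm _ _)).trans pauliIdx.symm

/-- The code of the identity. -/
def Rot.id : Rot := (true, 0, 0, 0)

section Finite

set_option synthInstance.maxHeartbeats 400000
set_option synthInstance.maxSize 2000

theorem isSym_rot_left_aux : ∀ (r : Rot) (C : Ctx), ∃ C',
    (∀ m, m ∈ ctx C ↔ rotPerm r Rot.id m ∈ ctx C') ∧
      beta1 C' = beta1 C + ∑ m ∈ ctx C, rotSign r Rot.id m := by
  decide +kernel

theorem isSym_rot_right_aux : ∀ (r : Rot) (C : Ctx), ∃ C',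
    (∀ m, m ∈ ctx C ↔ rotPerm Rot.id r m ∈ ctx C') ∧
      beta1 C' = beta1 C + ∑ m ∈ ctx C, rotSign Rot.id r m := by
  decide +kernel

theorem isSym_swap_aux : ∀ C : Ctx, ∃ C', (∀ m, m ∈ ctx C ↔ swapPerm m ∈ ctx C') ∧
    beta1 C' = beta1 C + ∑ m ∈ ctx C, (0 : Meas → ZMod 2) m := by
  decide +kernel

end Finite

theorem isSym_swap : IsSym swapPerm 0 := IsSym.of_forall_exists isSym_swap_aux

/-- A pair of rotations is a product of rotations of one qubit each, so the finite checks run over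
24 codes twice and not over all pairs. -/
theorem isSym_rot (r r' : Rot) : IsSym (rotPerm r r') (rotSign r r') := by
  have h := (IsSym.of_forall_exists (isSym_rot_left_aux r)).mul
    (IsSym.of_forall_exists (isSym_rot_right_aux r'))
  have hid : ∀ x, Rot.id.perm x = x := by decide
  have hid' : ∀ x, Rot.id.sign x = 0 := by decide
  convert h using 1
  · ext1 m
    simp [rotPerm, hid, Prod.map]
  · ext1 m
    simp [rotSign, rotPerm, hid, hid', add_comm]

/-- Codes for the symmetries given by two rotations, followed by the exchange of the qubits if
the first component is `true`. -/
abbrev SymCode : Type := Bool × Rot × Rot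

/-- The permutation of the measurements. -/
def SymCode.perm (g : SymCode) : Equiv.Perm Meas :=
  if g.1 then swapPerm * rotPerm g.2.1 g.2.2 else rotPerm g.2.1 g.2.2

/-- The signs of the measurements. -/
def SymCode.sign (g : SymCode) : Meas → ZMod 2 := rotSign g.2.1 g.2.2

/-- The symmetry with a given code. -/
def SymCode.toSym (g : SymCode) : Corr ≃ₗ[ℝ] Corr := signedPerm g.perm g.sign

theorem SymCode.toSym_eq (g : SymCode) : g.toSym = if g.1
    then signedPerm swapPerm 0 * signedPerm (rotPerm g.2.1 g.2.2) (rotSign g.2.1 g.2.2)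
    else signedPerm (rotPerm g.2.1 g.2.2) (rotSign g.2.1 g.2.2) := by
  rw [toSym, perm, sign]
  split_ifs
  · rw [signedPerm_mul]; congr 1; ext m; simp
  · rfl

theorem SymCode.toSym_mem (g : SymCode) : g.toSym ∈ symGroup := by
  rw [toSym_eq]
  split_ifs
  · exact mul_mem ⟨_, _, isSym_swap, rfl⟩ ⟨_, _, isSym_rot _ _, rfl⟩
  · exact ⟨_, _, isSym_rot _ _, rfl⟩

/-! ### Integral points -/

/-- An integral vector as a vector of expectation values. -/
def castV (u : Meas → ℤ) : Corr := fun m => (u m : ℝ)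

theorem castV_injective : Function.Injective castV := fun u v h => by
  ext m
  exact Int.cast_injective (congrFun h m)

/-- The scalar product of integral vectors. -/
def dotZ (u v : Meas → ℤ) : ℤ := ∑ m, u m * v m

theorem castV_dotProduct (u v : Meas → ℤ) : castV u ⬝ᵥ castV v = (dotZ u v : ℤ) := by
  simp [castV, dotZ, dotProduct]

/-- The facet inequalities of the horizontal contexts, times four. -/
def rowZ (u : Meas → ℤ) (i : Fin 3) (s t : ZMod 2) : ℤ :=
  1 + (sgnZ s * u (i, 0) + sgnZ t * u (i, 1) + sgnZ (s + t) * u (i, 2))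

/-- The facet inequalities of the vertical contexts, times four. -/
def colZ (u : Meas → ℤ) (j : Fin 3) (s t : ZMod 2) : ℤ :=
  1 + (sgnZ s * u (0, j) + sgnZ t * u (1, j) + sgnZ (1 + s + t) * u (2, j))

theorem triple_inl (i : Fin 3) : Triple (Sum.inl i) (i, 0) (i, 1) (i, 2) := by
  refine ⟨?_, ?_, ?_, ?_, ?_, ?_⟩ <;> simp [ctx]

theorem triple_inr (j : Fin 3) : Triple (Sum.inr j) (0, j) (1, j) (2, j) := by
  refine ⟨?_, ?_, ?_, ?_, ?_, ?_⟩ <;> simp [ctx]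

/-- Parity determines the third outcome on a context, so two outcomes index the inequalities and
membership of an integral point is decidable. -/
theorem castV_mem_corrPolytope {u : Meas → ℤ} (h1 : ∀ i s t, 0 ≤ rowZ u i s t)
    (h2 : ∀ j s t, 0 ≤ colZ u j s t) : castV u ∈ corrPolytope beta1 := by
  rintro (i | j) t ht
  · rw [(triple_inl i).sum_eq] at ht
    rw [(triple_inl i).slack_eq]
    have h := h1 i (t (i, 0)) (t (i, 1))
    have h3 : t (i, 2) = t (i, 0) + t (i, 1) := by
      have : t (i, 0) + t (i, 1) + t (i, 2) = 0 := ht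
      exact (CharTwo.add_eq_zero.1 this).symm
    rw [h3, ← cast_sgnZ, ← cast_sgnZ, ← cast_sgnZ]
    simp only [rowZ, castV] at h ⊢
    exact_mod_cast h
  · rw [(triple_inr j).sum_eq] at ht
    rw [(triple_inr j).slack_eq]
    have h := h2 j (t (0, j)) (t (1, j))
    have h3 : t (2, j) = 1 + t (0, j) + t (1, j) := by
      have : t (0, j) + t (1, j) + t (2, j) = 1 := ht
      linear_combination this - (t (0, j) + t (1, j)) * CharTwo.two_eq_zero (R := ZMod 2)
    rw [h3, ← cast_sgnZ, ← cast_sgnZ, ← cast_sgnZ]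
    simp only [colZ, castV] at h ⊢
    exact_mod_cast h

theorem row_nonneg {x : Corr} (hx : x ∈ corrPolytope beta1) (i : Fin 3) (s t : ZMod 2) :
    0 ≤ 1 + (sgn s * x (i, 0) + sgn t * x (i, 1) + sgn (s + t) * x (i, 2)) :=
  (triple_inl i).slack_nonneg hx (CharTwo.add_self_eq_zero (s + t))

theorem col_nonneg {x : Corr} (hx : x ∈ corrPolytope beta1) (j : Fin 3) (s t : ZMod 2) :
    0 ≤ 1 + (sgn s * x (0, j) + sgn t * x (1, j) + sgn (1 + s + t) * x (2, j)) :=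
  (triple_inr j).slack_nonneg hx (show s + t + (1 + s + t) = 1 by
    linear_combination (s + t) * CharTwo.two_eq_zero (R := ZMod 2))

theorem tight_row {u : Meas → ℤ} {i : Fin 3} {s t : ZMod 2} (h : rowZ u i s t = 0) :
    Tight beta1 (castV u) (Sum.inl i) (fun m => ![s, t, s + t] m.2) := by
  refine ⟨?_, ?_⟩
  · rw [(triple_inl i).sum_eq]
    exact CharTwo.add_self_eq_zero (s + t)
  · rw [(triple_inl i).slack_eq]
    have := congrArg (Int.cast : ℤ → ℝ) h
    simp only [rowZ] at this
    push_cast [cast_sgnZ] at this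
    exact this

theorem tight_col {u : Meas → ℤ} {j : Fin 3} {s t : ZMod 2} (h : colZ u j s t = 0) :
    Tight beta1 (castV u) (Sum.inr j) (fun m => ![s, t, 1 + s + t] m.1) := by
  refine ⟨?_, ?_⟩
  · rw [(triple_inr j).sum_eq]
    exact show s + t + (1 + s + t) = 1 by
      linear_combination (s + t) * CharTwo.two_eq_zero (R := ZMod 2)
  · rw [(triple_inr j).slack_eq]
    have := congrArg (Int.cast : ℤ → ℝ) h
    simp only [colZ] at this
    push_cast [cast_sgnZ] at this
    exact this

theorem row_eq_zero {u w : Meas → ℤ} {x : Corr}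
    (hx : x ∈ commonFace beta1 (castV u) (castV w)) (i : Fin 3) (s t : ZMod 2)
    (h1 : rowZ u i s t = 0) (h2 : rowZ w i s t = 0) :
    1 + (sgn s * x (i, 0) + sgn t * x (i, 1) + sgn (s + t) * x (i, 2)) = 0 := by
  have := (hx.2 _ _ (tight_row h1) (tight_row h2)).2
  rwa [(triple_inl i).slack_eq] at this

theorem col_eq_zero {u w : Meas → ℤ} {x : Corr}
    (hx : x ∈ commonFace beta1 (castV u) (castV w)) (j : Fin 3) (s t : ZMod 2)
    (h1 : colZ u j s t = 0) (h2 : colZ w j s t = 0) :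
    1 + (sgn s * x (0, j) + sgn t * x (1, j) + sgn (1 + s + t) * x (2, j)) = 0 := by
  have := (hx.2 _ _ (tight_col h1) (tight_col h2)).2
  rwa [(triple_inr j).slack_eq] at this

/-! ### Representatives of the vertices and the edges -/

/-- The expectation values of `q₀`. -/
def q0Z : Meas → ℤ := fun m => !![0, 0, 1; 0, 1, 0; -1, 0, 0] m.1 m.2

/-- The expectation values of `q₁`. -/
def q1Z : Meas → ℤ := fun m => !![0, 0, -1; 1, 0, 0; 0, 1, 0] m.1 m.2

/-- The expectation values of `p₀`. -/
def p0Z : Meas → ℤ := fun m => !![1, 0, 0; 1, 1, 1; -1, 0, 0] m.1 m.2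

/-- The expectation values of `p₁`. -/
def p1Z : Meas → ℤ := fun m => !![1, -1, -1; 0, 1, 0; 0, 1, 0] m.1 m.2

/-- The expectation values of `p₂`. -/
def p2Z : Meas → ℤ := fun m => !![1, -1, -1; 1, 0, 0; -1, 0, 0] m.1 m.2

theorem sgn_one_add_one : sgn (1 + 1) = 1 := by rw [CharTwo.add_self_eq_zero, sgn_zero]

theorem sgn_one_add_one_add_one : sgn (1 + 1 + 1) = -1 := by
  rw [sgn_add, sgn_one_add_one, sgn_one, one_mul]

theorem forall_meas {P : Meas → Prop} (h00 : P (0, 0)) (h01 : P (0, 1)) (h02 : P (0, 2))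
    (h10 : P (1, 0)) (h11 : P (1, 1)) (h12 : P (1, 2)) (h20 : P (2, 0)) (h21 : P (2, 1))
    (h22 : P (2, 2)) (m : Meas) : P m := by
  obtain ⟨i, j⟩ := m
  fin_cases i <;> fin_cases j <;> assumption

/-! ### The representatives as points, vertices and ends of edges. -/

theorem q0_mem : castV q0Z ∈ corrPolytope beta1 :=
  castV_mem_corrPolytope (by decide) (by decide)

theorem p0_mem : castV p0Z ∈ corrPolytope beta1 :=
  castV_mem_corrPolytope (by decide) (by decide)

theorem p1_mem : castV p1Z ∈ corrPolytope beta1 :=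
  castV_mem_corrPolytope (by decide) (by decide)

theorem p2_mem : castV p2Z ∈ corrPolytope beta1 :=
  castV_mem_corrPolytope (by decide) (by decide)

/-- Every context contains one prescribed coordinate, and two of its inequalities make the other two
coordinates equal or opposite. Around the hexagon of the six free coordinates the sign changes three
times, so `x (0, 0) = -x (0, 0)` and all of them vanish. -/
theorem eq_q0 {x : Corr} (hx : x ∈ corrPolytope beta1)
    (h : ∀ m, q0Z m ≠ 0 → x m = q0Z m) : x = castV q0Z := by
  have a1 : x (0, 2) = 1 := by simpa [q0Z] using h (0, 2) (by decide)
  have a2 : x (1, 1) = 1 := by simpa [q0Z] using h (1, 1) (by decide)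
  have a3 : x (2, 0) = -1 := by simpa [q0Z] using h (2, 0) (by decide)
  have r0 := row_nonneg hx 0 0 1
  have r1 := row_nonneg hx 0 1 0
  have r2 := row_nonneg hx 1 0 1
  have r3 := row_nonneg hx 1 1 1
  have r4 := row_nonneg hx 2 0 0
  have r5 := row_nonneg hx 2 0 1
  have c0 := col_nonneg hx 0 0 1
  have c1 := col_nonneg hx 0 1 0
  have c2 := col_nonneg hx 1 0 1
  have c3 := col_nonneg hx 1 1 1
  have c4 := col_nonneg hx 2 1 0
  have c5 := col_nonneg hx 2 1 1
  simp only [add_zero, zero_add, sgn_one_add_one_add_one, sgn_one_add_one, sgn_zero,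
    sgn_one] at r0 r1 r2 r3 r4 r5 c0 c1 c2 c3 c4 c5
  ext m
  revert m
  refine forall_meas ?_ ?_ ?_ ?_ ?_ ?_ ?_ ?_ ?_ <;> simp [castV, q0Z] <;> linarith

/-- The same argument on the square of the four coordinates off the cross, again with three sign
changes. -/
theorem eq_p0 {x : Corr} (hx : x ∈ corrPolytope beta1)
    (h : ∀ m, p0Z m ≠ 0 → x m = p0Z m) : x = castV p0Z := by
  have a1 : x (0, 0) = 1 := by simpa [p0Z] using h (0, 0) (by decide)
  have a2 : x (1, 0) = 1 := by simpa [p0Z] using h (1, 0) (by decide)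
  have a3 : x (2, 0) = -1 := by simpa [p0Z] using h (2, 0) (by decide)
  have a4 : x (1, 1) = 1 := by simpa [p0Z] using h (1, 1) (by decide)
  have a5 : x (1, 2) = 1 := by simpa [p0Z] using h (1, 2) (by decide)
  have r0 := row_nonneg hx 0 1 0
  have r1 := row_nonneg hx 0 1 1
  have r2 := row_nonneg hx 1 0 1
  have r3 := row_nonneg hx 1 1 0
  have r4 := row_nonneg hx 1 1 1
  have r5 := row_nonneg hx 2 0 0
  have r6 := row_nonneg hx 2 0 1
  have c0 := col_nonneg hx 0 0 1
  have c1 := col_nonneg hx 0 1 0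
  have c2 := col_nonneg hx 0 1 1
  have c3 := col_nonneg hx 1 0 1
  have c4 := col_nonneg hx 1 1 1
  have c5 := col_nonneg hx 2 0 1
  have c6 := col_nonneg hx 2 1 1
  simp only [add_zero, zero_add, sgn_one_add_one_add_one, sgn_one_add_one, sgn_zero,
    sgn_one] at r0 r1 r2 r3 r4 r5 r6 c0 c1 c2 c3 c4 c5 c6
  ext m
  revert m
  refine forall_meas ?_ ?_ ?_ ?_ ?_ ?_ ?_ ?_ ?_ <;> simp [castV, p0Z] <;> linarith

/-- The two tight equations of a context add up to the value of its deterministic measurement; the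
rest is rigidity. -/
theorem q0_mem_extremePoints : castV q0Z ∈ (corrPolytope beta1).extremePoints ℝ := by
  refine mem_extremePoints_of_commonFace q0_mem fun x hx h => eq_q0 hx ?_
  have hx' : x ∈ commonFace beta1 (castV q0Z) (castV q0Z) := ⟨hx, fun C t h1 _ => h C t h1⟩
  have r0 := row_eq_zero hx' 0 0 1 (by decide) (by decide)
  have r1 := row_eq_zero hx' 0 1 0 (by decide) (by decide)
  have r2 := row_eq_zero hx' 1 0 1 (by decide) (by decide)
  have r3 := row_eq_zero hx' 1 1 1 (by decide) (by decide)
  have r4 := row_eq_zero hx' 2 0 0 (by decide) (by decide)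
  have r5 := row_eq_zero hx' 2 0 1 (by decide) (by decide)
  have c0 := col_eq_zero hx' 0 0 1 (by decide) (by decide)
  have c1 := col_eq_zero hx' 0 1 0 (by decide) (by decide)
  have c2 := col_eq_zero hx' 1 0 1 (by decide) (by decide)
  have c3 := col_eq_zero hx' 1 1 1 (by decide) (by decide)
  have c4 := col_eq_zero hx' 2 1 0 (by decide) (by decide)
  have c5 := col_eq_zero hx' 2 1 1 (by decide) (by decide)
  simp only [add_zero, zero_add, sgn_one_add_one_add_one, sgn_one_add_one, sgn_zero,
    sgn_one] at r0 r1 r2 r3 r4 r5 c0 c1 c2 c3 c4 c5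
  refine forall_meas ?_ ?_ ?_ ?_ ?_ ?_ ?_ ?_ ?_ <;> simp [q0Z] <;> linarith

theorem p0_mem_extremePoints : castV p0Z ∈ (corrPolytope beta1).extremePoints ℝ := by
  refine mem_extremePoints_of_commonFace p0_mem fun x hx h => eq_p0 hx ?_
  have hx' : x ∈ commonFace beta1 (castV p0Z) (castV p0Z) := ⟨hx, fun C t h1 _ => h C t h1⟩
  have r0 := row_eq_zero hx' 0 1 0 (by decide) (by decide)
  have r1 := row_eq_zero hx' 0 1 1 (by decide) (by decide)
  have r2 := row_eq_zero hx' 1 0 1 (by decide) (by decide)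
  have r3 := row_eq_zero hx' 1 1 0 (by decide) (by decide)
  have r4 := row_eq_zero hx' 1 1 1 (by decide) (by decide)
  have r5 := row_eq_zero hx' 2 0 0 (by decide) (by decide)
  have r6 := row_eq_zero hx' 2 0 1 (by decide) (by decide)
  have c0 := col_eq_zero hx' 0 0 1 (by decide) (by decide)
  have c1 := col_eq_zero hx' 0 1 0 (by decide) (by decide)
  have c2 := col_eq_zero hx' 0 1 1 (by decide) (by decide)
  have c3 := col_eq_zero hx' 1 0 1 (by decide) (by decide)
  have c4 := col_eq_zero hx' 1 1 1 (by decide) (by decide)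
  have c5 := col_eq_zero hx' 2 0 1 (by decide) (by decide)
  have c6 := col_eq_zero hx' 2 1 1 (by decide) (by decide)
  simp only [add_zero, zero_add, sgn_one_add_one_add_one, sgn_one_add_one, sgn_zero,
    sgn_one] at r0 r1 r2 r3 r4 r5 r6 c0 c1 c2 c3 c4 c5 c6
  refine forall_meas ?_ ?_ ?_ ?_ ?_ ?_ ?_ ?_ ?_ <;> simp [p0Z] <;> linarith

/-- The inequalities tight at both ends leave one free parameter. As in the two lemmas that follow,
it is a coordinate, up to sign, that runs from 0 to 1 along the edge. -/
theorem isExposed_segment_q0_p0 :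
    IsExposed ℝ (corrPolytope beta1) (segment ℝ (castV q0Z) (castV p0Z)) := by
  refine isExposed_segment q0_mem p0_mem fun x hx => ?_
  obtain ⟨-, hle⟩ := abs_le.1 (abs_le_one hx.1 (0, 2))
  obtain ⟨hle₁, hle₂⟩ := abs_le.1 (abs_le_one hx.1 (0, 0))
  have r0 := row_eq_zero hx 0 1 0 (by decide) (by decide)
  have r1 := row_eq_zero hx 1 0 1 (by decide) (by decide)
  have r2 := row_eq_zero hx 1 1 1 (by decide) (by decide)
  have r3 := row_eq_zero hx 2 0 0 (by decide) (by decide)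
  have r4 := row_eq_zero hx 2 0 1 (by decide) (by decide)
  have c0 := col_eq_zero hx 0 0 1 (by decide) (by decide)
  have c1 := col_eq_zero hx 0 1 0 (by decide) (by decide)
  have c2 := col_eq_zero hx 1 0 1 (by decide) (by decide)
  have c3 := col_eq_zero hx 1 1 1 (by decide) (by decide)
  have c4 := col_eq_zero hx 2 1 1 (by decide) (by decide)
  simp only [add_zero, zero_add, sgn_one_add_one_add_one, sgn_one_add_one, sgn_zero,
    sgn_one] at r0 r1 r2 r3 r4 c0 c1 c2 c3 c4
  -- On the common face `x (0, 2) = 1 - x (0, 0)`, so the bound `x (0, 2) ≤ 1` yields `0 ≤ x (0,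
  -- 0)`.
  refine ⟨1 - (x (0, 0)), x (0, 0), by linarith, by linarith, by ring, ?_⟩
  ext m
  revert m
  refine forall_meas ?_ ?_ ?_ ?_ ?_ ?_ ?_ ?_ ?_ <;> simp [castV, q0Z, p0Z] <;> linarith

theorem isExposed_segment_p0_p1 :
    IsExposed ℝ (corrPolytope beta1) (segment ℝ (castV p0Z) (castV p1Z)) := by
  refine isExposed_segment p0_mem p1_mem fun x hx => ?_
  obtain ⟨-, hle⟩ := abs_le.1 (abs_le_one hx.1 (1, 0))
  obtain ⟨hle₁, hle₂⟩ := abs_le.1 (abs_le_one hx.1 (2, 1))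
  have r0 := row_eq_zero hx 0 1 0 (by decide) (by decide)
  have r1 := row_eq_zero hx 0 1 1 (by decide) (by decide)
  have r2 := row_eq_zero hx 1 0 1 (by decide) (by decide)
  have r3 := row_eq_zero hx 1 1 1 (by decide) (by decide)
  have r4 := row_eq_zero hx 2 0 1 (by decide) (by decide)
  have c0 := col_eq_zero hx 0 1 0 (by decide) (by decide)
  have c1 := col_eq_zero hx 0 1 1 (by decide) (by decide)
  have c2 := col_eq_zero hx 1 0 1 (by decide) (by decide)
  have c3 := col_eq_zero hx 1 1 1 (by decide) (by decide)
  have c4 := col_eq_zero hx 2 0 1 (by decide) (by decide)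
  simp only [add_zero, zero_add, sgn_one_add_one_add_one, sgn_one_add_one, sgn_zero,
    sgn_one] at r0 r1 r2 r3 r4 c0 c1 c2 c3 c4
  refine ⟨1 - (x (2, 1)), x (2, 1), by linarith, by linarith, by ring, ?_⟩
  ext m
  revert m
  refine forall_meas ?_ ?_ ?_ ?_ ?_ ?_ ?_ ?_ ?_ <;> simp [castV, p0Z, p1Z] <;> linarith

theorem isExposed_segment_p0_p2 :
    IsExposed ℝ (corrPolytope beta1) (segment ℝ (castV p0Z) (castV p2Z)) := by
  refine isExposed_segment p0_mem p2_mem fun x hx => ?_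
  obtain ⟨-, hle⟩ := abs_le.1 (abs_le_one hx.1 (1, 1))
  obtain ⟨hle₁, hle₂⟩ := abs_le.1 (abs_le_one hx.1 (0, 1))
  have r0 := row_eq_zero hx 0 1 0 (by decide) (by decide)
  have r1 := row_eq_zero hx 0 1 1 (by decide) (by decide)
  have r2 := row_eq_zero hx 1 1 0 (by decide) (by decide)
  have r3 := row_eq_zero hx 1 1 1 (by decide) (by decide)
  have r4 := row_eq_zero hx 2 0 0 (by decide) (by decide)
  have r5 := row_eq_zero hx 2 0 1 (by decide) (by decide)
  have c0 := col_eq_zero hx 0 0 1 (by decide) (by decide)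
  have c1 := col_eq_zero hx 0 1 0 (by decide) (by decide)
  have c2 := col_eq_zero hx 0 1 1 (by decide) (by decide)
  have c3 := col_eq_zero hx 1 0 1 (by decide) (by decide)
  have c4 := col_eq_zero hx 2 0 1 (by decide) (by decide)
  simp only [add_zero, zero_add, sgn_one_add_one_add_one, sgn_one_add_one, sgn_zero,
    sgn_one] at r0 r1 r2 r3 r4 r5 c0 c1 c2 c3 c4
  refine ⟨1 - (-x (0, 1)), -x (0, 1), by linarith, by linarith, by ring, ?_⟩
  ext m
  revert m
  refine forall_meas ?_ ?_ ?_ ?_ ?_ ?_ ?_ ?_ ?_ <;> simp [castV, p0Z, p2Z] <;> linarith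

/-! ### The vertices of the odd polytope -/

/-- The integral vectors of the vertices of type 1. -/
def vtx1 (o : Bool) (k : Fin 3) (s : Fin 3 → ZMod 2) : Meas → ℤ := fun m =>
  if m.2 = (if o then k + m.1 else k - m.1) then sgnZ (s m.1) else 0

/-- The integral vectors of the vertices of type 2. -/
def vtx2 (i j : Fin 3) (c x y : ZMod 2) : Meas → ℤ := fun m =>
  if m.1 = i then
    if m.2 = j then sgnZ c else if m.2 = j + 1 then sgnZ x else sgnZ (c + x)
  else if m.2 = j then
    if m.1 = i + 1 then sgnZ y else sgnZ (c + y + 1)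
  else 0

section Finite

set_option synthInstance.maxHeartbeats 400000
set_option synthInstance.maxSize 2000

/-- A transversal consists of the products in which one qubit carries a fixed Pauli operator: `o'`
selects the qubit, `c` the operator, and the eight left rotations produce the sign patterns. The 48
codes of this form match the 48 vertices. -/
theorem exists_rot_vtx1 : ∀ o k s, ∃ o' d x y c, ∀ m,
    vtx1 o k s (SymCode.perm (o', (d, 0, x, y), (true, c, 0, 0)) m) =
      sgnZ (SymCode.sign (o', (d, 0, x, y), (true, c, 0, 0)) m) * q0Z m := by
  decide +kernel

/-- The shifts `a` and `b` move the center of the cross, the three signs set its outcomes: 72 codes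
for 72 vertices. -/
theorem exists_rot_vtx2 : ∀ i j c x y, ∃ a b x' y' z', ∀ m,
    vtx2 i j c x y (SymCode.perm (false, (true, a, x', y'), (true, b, z', 0)) m) =
      sgnZ (SymCode.sign (false, (true, a, x', y'), (true, b, z', 0)) m) * p0Z m := by
  decide +kernel

/-! ### Stabilizers, certificates against edges, and counts at `q₀` and `p₀`. -/

/-- Symmetries that fix `q₀`. -/
def stabQ0 : List SymCode :=
  [((true, 0, 0, 0) : Rot), (true, 1, 1, 1), (true, 2, 0, 1)].flatMap fun r =>
    [((true, 0, 0, 0) : Rot), (true, 0, 1, 0), (false, 2, 0, 0), (false, 2, 1, 0)].map fun r' =>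
      (false, r, r')

/-- Symmetries that fix `p₀`. -/
def stabP0 : List SymCode :=
  [false, true].flatMap fun o =>
    [((true, 0, 0, 0), (true, 0, 0, 0)), ((true, 0, 1, 0), (false, 1, 1, 1)),
      ((true, 0, 1, 1), (true, 0, 1, 1)), ((true, 0, 0, 1), (false, 1, 0, 0)),
      ((false, 1, 0, 0), (true, 0, 0, 1)), ((false, 1, 1, 0), (false, 1, 0, 1)),
      ((false, 1, 1, 1), (true, 0, 1, 0)), ((false, 1, 0, 1), (false, 1, 1, 0))].map fun r =>
        (o, r)

theorem stabQ0_fix : ∀ g ∈ stabQ0, ∀ m, q0Z (g.perm m) = sgnZ (g.sign m) * q0Z m := by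
  decide +kernel

theorem stabP0_fix : ∀ g ∈ stabP0, ∀ m, p0Z (g.perm m) = sgnZ (g.sign m) * p0Z m := by
  decide +kernel

/-- The twelve listed symmetries suffice to reach all type 2 vertices with scalar product 2, of
which there are twelve. -/
theorem exists_stabQ0 : ∀ i j c x y, dotZ q0Z (vtx2 i j c x y) = 2 →
    ∃ g ∈ stabQ0, ∀ m, vtx2 i j c x y (g.perm m) = sgnZ (g.sign m) * p0Z m := by
  decide +kernel

theorem exists_stabP0_p1 : ∀ i j c x y, dotZ p0Z (vtx2 i j c x y) = 2 →
    ∃ g ∈ stabP0, ∀ m, vtx2 i j c x y (g.perm m) = sgnZ (g.sign m) * p1Z m := by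
  decide +kernel

theorem exists_stabP0_p2 : ∀ i j c x y, dotZ p0Z (vtx2 i j c x y) = 3 →
    ∃ g ∈ stabP0, ∀ m, vtx2 i j c x y (g.perm m) = sgnZ (g.sign m) * p2Z m := by
  decide +kernel

/-- `z + w` can be written in another way as a sum of a vertex from the list `l` and of a lattice
point of the polytope. -/
def HasOtherSum (l : List (Meas → ℤ)) (z w : Meas → ℤ) : Prop :=
  ∃ u ∈ l, (∃ m, u m ≠ z m) ∧ (∃ m, u m ≠ w m) ∧
    (∀ i s t, 0 ≤ rowZ (fun m => z m + w m - u m) i s t) ∧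
    ∀ j s t, 0 ≤ colZ (fun m => z m + w m - u m) j s t

instance (l : List (Meas → ℤ)) (z w : Meas → ℤ) : Decidable (HasOtherSum l z w) := by
  unfold HasOtherSum; infer_instance

/-- Vertices whose sums with lattice points account for the sums of `q₀` with vertices that are
not neighbors of `q₀`. -/
def auxQ0 : List (Meas → ℤ) :=
  [vtx2 0 0 1 1 1, vtx2 0 1 1 0 0, vtx1 true 2 ![0, 1, 0], vtx2 1 0 1 0 1, vtx1 true 1 ![1, 1, 1],
    vtx1 true 2 ![0, 0, 0], vtx2 1 0 0 0 1, vtx2 1 2 0 0 1, vtx2 2 1 0 1 1, vtx2 2 2 1 1 0,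
    vtx1 true 0 ![0, 0, 1], vtx1 false 0 ![1, 0, 0], vtx2 1 2 1 1 0]

/-- Vertices whose sums with lattice points account for the sums of `p₀` with vertices that are
not neighbors of `p₀`. -/
def auxP0 : List (Meas → ℤ) :=
  [vtx1 true 1 ![1, 0, 1], vtx2 1 1 0 0 0, vtx1 false 0 ![0, 0, 0], vtx1 false 2 ![1, 0, 1],
    vtx2 0 0 0 1 0, vtx2 1 2 0 0 0, vtx1 true 0 ![0, 0, 0], vtx2 1 2 0 0 1, vtx1 true 0 ![0, 0, 1],
    vtx2 2 0 1 0 0, vtx1 false 1 ![1, 0, 0], vtx1 false 2 ![0, 0, 1]]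

theorem hasOtherSum_q0_vtx1 : ∀ o k s, (∀ m, vtx1 o k s m = q0Z m) ∨
    HasOtherSum auxQ0 q0Z (vtx1 o k s) := by
  decide +kernel

theorem hasOtherSum_q0_vtx2 : ∀ i j c x y, dotZ q0Z (vtx2 i j c x y) = 2 ∨
    HasOtherSum auxQ0 q0Z (vtx2 i j c x y) := by
  decide +kernel

theorem hasOtherSum_p0_vtx2 : ∀ i j c x y, (∀ m, vtx2 i j c x y m = p0Z m) ∨
    (dotZ p0Z (vtx2 i j c x y) = 2 ∨ dotZ p0Z (vtx2 i j c x y) = 3) ∨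
      HasOtherSum auxP0 p0Z (vtx2 i j c x y) := by
  decide +kernel

theorem card_dot_q0_vtx2 : (Finset.univ.filter fun a : Fin 3 × Fin 3 × ZMod 2 × ZMod 2 × ZMod 2 =>
    dotZ q0Z (vtx2 a.1 a.2.1 a.2.2.1 a.2.2.2.1 a.2.2.2.2) = 2).card = 12 := by
  decide +kernel

theorem card_dot_p0_vtx2_two :
    (Finset.univ.filter fun a : Fin 3 × Fin 3 × ZMod 2 × ZMod 2 × ZMod 2 =>
      dotZ p0Z (vtx2 a.1 a.2.1 a.2.2.1 a.2.2.2.1 a.2.2.2.2) = 2).card = 8 := by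
  decide +kernel

theorem card_dot_p0_vtx2_three :
    (Finset.univ.filter fun a : Fin 3 × Fin 3 × ZMod 2 × ZMod 2 × ZMod 2 =>
      dotZ p0Z (vtx2 a.1 a.2.1 a.2.2.1 a.2.2.2.1 a.2.2.2.2) = 3).card = 8 := by
  decide +kernel

theorem card_dot_p0_vtx1 : (Finset.univ.filter fun a : Bool × Fin 3 × (Fin 3 → ZMod 2) =>
    dotZ p0Z (vtx1 a.1 a.2.1 a.2.2) = 2).card = 8 := by
  decide +kernel

theorem vtx1_injective : ∀ a b : Bool × Fin 3 × (Fin 3 → ZMod 2),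
    (∀ m, vtx1 a.1 a.2.1 a.2.2 m = vtx1 b.1 b.2.1 b.2.2 m) → a = b := by
  decide +kernel

theorem vtx2_injective : ∀ a b : Fin 3 × Fin 3 × ZMod 2 × ZMod 2 × ZMod 2,
    (∀ m, vtx2 a.1 a.2.1 a.2.2.1 a.2.2.2.1 a.2.2.2.2 m =
      vtx2 b.1 b.2.1 b.2.2.1 b.2.2.2.1 b.2.2.2.2 m) → a = b := by
  decide +kernel

theorem q0Z_eq : ∀ m, q0Z m = vtx1 false 2 ![0, 0, 1] m := by decide

theorem q1Z_eq : ∀ m, q1Z m = vtx1 true 2 ![1, 0, 0] m := by decide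

theorem p0Z_eq : ∀ m, p0Z m = vtx2 1 0 0 0 1 m := by decide

theorem p1Z_eq : ∀ m, p1Z m = vtx2 0 1 1 1 0 m := by decide

theorem p2Z_eq : ∀ m, p2Z m = vtx2 0 0 0 1 0 m := by decide

end Finite

/-! ### The two families of vertices and their completeness. -/

/-- The vectors of expectation values of the vertices of type 1. -/
def corrType1 : Set Corr := {e | ∃ o k s, e = castV (vtx1 o k s)}

/-- The vectors of expectation values of the vertices of type 2. -/
def corrType2 : Set Corr := {e | ∃ i j c x y, e = castV (vtx2 i j c x y)}

theorem q0_mem_corrType1 : castV q0Z ∈ corrType1 := ⟨_, _, _, congrArg castV (funext q0Z_eq)⟩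

theorem q1_mem_corrType1 : castV q1Z ∈ corrType1 := ⟨_, _, _, congrArg castV (funext q1Z_eq)⟩

theorem p0_mem_corrType2 : castV p0Z ∈ corrType2 :=
  ⟨_, _, _, _, _, congrArg castV (funext p0Z_eq)⟩

theorem p1_mem_corrType2 : castV p1Z ∈ corrType2 :=
  ⟨_, _, _, _, _, congrArg castV (funext p1Z_eq)⟩

theorem p2_mem_corrType2 : castV p2Z ∈ corrType2 :=
  ⟨_, _, _, _, _, congrArg castV (funext p2Z_eq)⟩

theorem SymCode.toSym_castV {g : SymCode} {u w : Meas → ℤ}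
    (h : ∀ m, w (g.perm m) = sgnZ (g.sign m) * u m) : g.toSym (castV u) = castV w := by
  ext m
  obtain ⟨m, rfl⟩ := g.perm.surjective m
  rw [toSym, signedPerm_apply, castV, castV, h m, Int.cast_mul, cast_sgnZ]

theorem exists_toSym_q0 {v : Corr} (hv : v ∈ corrType1) :
    ∃ g : SymCode, g.toSym (castV q0Z) = v := by
  obtain ⟨o, k, s, rfl⟩ := hv
  obtain ⟨o', d, x, y, c, h⟩ := exists_rot_vtx1 o k s
  exact ⟨_, SymCode.toSym_castV h⟩

theorem exists_toSym_p0 {v : Corr} (hv : v ∈ corrType2) :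
    ∃ g : SymCode, g.toSym (castV p0Z) = v := by
  obtain ⟨i, j, c, x, y, rfl⟩ := hv
  obtain ⟨a, b, x', y', z', h⟩ := exists_rot_vtx2 i j c x y
  exact ⟨_, SymCode.toSym_castV h⟩

theorem inv_apply_apply (γ : Corr ≃ₗ[ℝ] Corr) (e : Corr) : γ⁻¹ (γ e) = e := by
  rw [← LinearEquiv.mul_apply, inv_mul_cancel]; rfl

theorem apply_inv_apply (γ : Corr ≃ₗ[ℝ] Corr) (e : Corr) : γ (γ⁻¹ e) = e := by
  rw [← LinearEquiv.mul_apply, mul_inv_cancel]; rfl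

/-- A symmetry moves equality on the support of a vector. -/
theorem eq_on_support_map {γ : Corr ≃ₗ[ℝ] Corr} (hγ : γ ∈ symGroup) {u x : Corr}
    (h : ∀ m, γ u m ≠ 0 → x m = γ u m) : ∀ m, u m ≠ 0 → (γ⁻¹ x) m = u m := by
  intro m hm
  obtain ⟨τ, ε, -, rfl⟩ := hγ
  have h1 := signedPerm_apply τ ε ((signedPerm τ ε)⁻¹ x) m
  have h2 := signedPerm_apply τ ε u m
  rw [apply_inv_apply] at h1
  have h3 := h (τ m) (by rw [h2]; exact mul_ne_zero (sgn_ne_zero _) hm)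
  rw [h1, h2] at h3
  exact mul_left_cancel₀ (sgn_ne_zero _) h3

/-- The deterministic outcomes of a vertex determine it within the polytope; transitivity reduces
this to the rigidity of `q₀` and `p₀`. -/
theorem eq_of_eq_on_support {v x : Corr} (hv : v ∈ corrType1 ∪ corrType2)
    (hx : x ∈ corrPolytope beta1) (h : ∀ m, v m ≠ 0 → x m = v m) : x = v := by
  rcases hv with hv | hv
  · obtain ⟨g, rfl⟩ := exists_toSym_q0 hv
    have h1 := eq_on_support_map g.toSym_mem h
    rw [← apply_inv_apply g.toSym x]
    congr 1
    exact eq_q0 (map_mem_corrPolytope (inv_mem g.toSym_mem) hx) fun m hm =>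
      h1 m (by simpa [castV] using hm)
  · obtain ⟨g, rfl⟩ := exists_toSym_p0 hv
    have h1 := eq_on_support_map g.toSym_mem h
    rw [← apply_inv_apply g.toSym x]
    congr 1
    exact eq_p0 (map_mem_corrPolytope (inv_mem g.toSym_mem) hx) fun m hm =>
      h1 m (by simpa [castV] using hm)

theorem corrType1_subset_extremePoints : corrType1 ⊆ (corrPolytope beta1).extremePoints ℝ := by
  intro v hv
  obtain ⟨g, rfl⟩ := exists_toSym_q0 hv
  exact map_mem_extremePoints g.toSym_mem q0_mem_extremePoints

theorem corrType2_subset_extremePoints : corrType2 ⊆ (corrPolytope beta1).extremePoints ℝ := by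
  intro v hv
  obtain ⟨g, rfl⟩ := exists_toSym_p0 hv
  exact map_mem_extremePoints g.toSym_mem p0_mem_extremePoints

theorem mem_transversal {o : Bool} {k : Fin 3} {m : Meas} :
    m ∈ transversal o k ↔ m.2 = if o then k + m.1 else k - m.1 := by
  simp [transversal]

theorem mem_cross {i j : Fin 3} {m : Meas} : m ∈ cross i j ↔ m.1 = i ∨ m.2 = j := by
  simp [cross]

theorem castV_vtx1_of_mem {o : Bool} {k : Fin 3} {s : Fin 3 → ZMod 2} {m : Meas}
    (h : m ∈ transversal o k) : castV (vtx1 o k s) m = sgn (s m.1) := by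
  rw [castV, vtx1, if_pos (mem_transversal.1 h), cast_sgnZ]

theorem castV_vtx1_of_notMem {o : Bool} {k : Fin 3} {s : Fin 3 → ZMod 2} {m : Meas}
    (h : m ∉ transversal o k) : castV (vtx1 o k s) m = 0 := by
  rw [castV, vtx1, if_neg (fun h' => h (mem_transversal.2 h')), Int.cast_zero]

theorem castV_vtx2_of_notMem {i j : Fin 3} {c x y : ZMod 2} {m : Meas}
    (h : m ∉ cross i j) : castV (vtx2 i j c x y) m = 0 := by
  rw [mem_cross, not_or] at h
  rw [castV, vtx2, if_neg h.1, if_neg h.2, Int.cast_zero]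

theorem fin3_cases : ∀ i a : Fin 3, a = i ∨ a = i + 1 ∨ a = i + 2 := by decide

theorem fin3_ne : ∀ i : Fin 3, i + 1 ≠ i ∧ i + 2 ≠ i ∧ i + 2 ≠ i + 1 := by decide

theorem triple_cross_row (i j : Fin 3) : Triple (Sum.inl i) (i, j) (i, j + 1) (i, j + 2) := by
  refine ⟨?_, ?_, ?_, ?_, ?_, ?_⟩ <;> simp [ctx]

theorem triple_cross_col (i j : Fin 3) : Triple (Sum.inr j) (i, j) (i + 1, j) (i + 2, j) := by
  refine ⟨?_, ?_, ?_, ?_, ?_, ?_⟩ <;> simp [ctx]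

/-- A vector with outcomes `c`, `x`, `y` on three measurements of the cross agrees with a vertex
of type 2 on the cross. -/
theorem eq_vtx2_on_cross {e : Corr} (he : e ∈ corrPolytope beta1) {i j : Fin 3} {c x y : ZMod 2}
    (hc : e (i, j) = sgn c) (hx : e (i, j + 1) = sgn x) (hy : e (i + 1, j) = sgn y) {m : Meas}
    (hm : m ∈ cross i j) : e m = castV (vtx2 i j c x y) m := by
  have h1 := (triple_cross_row i j).eq_sgn he hc hx
  have h2 := (triple_cross_col i j).eq_sgn he hc hy
  rw [show beta1 (Sum.inl i) + c + x = c + x by simp [beta1]] at h1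
  rw [show beta1 (Sum.inr j) + c + y = c + y + 1 by simp [beta1]; ring] at h2
  obtain ⟨a, b⟩ := m
  have hi := fin3_ne i
  have hj := fin3_ne j
  rcases mem_cross.1 hm with h | h
  · obtain rfl : a = i := h
    rcases fin3_cases j b with rfl | rfl | rfl
    · rw [hc]; simp [castV, vtx2, cast_sgnZ]
    · rw [hx]; simp [castV, vtx2, cast_sgnZ, hj]
    · rw [h1]; simp [castV, vtx2, cast_sgnZ, hj]
  · obtain rfl : b = j := h
    rcases fin3_cases i a with rfl | rfl | rfl
    · rw [hc]; simp [castV, vtx2, cast_sgnZ]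
    · rw [hy]; simp [castV, vtx2, cast_sgnZ, hi]
    · rw [h2]; simp [castV, vtx2, cast_sgnZ, hi]

/-- Mermin's parity argument: each measurement is counted once by the rows and once by the columns,
while `beta1` sums to 0 over the rows and to 1 over the columns. -/
theorem sum_rows_eq_sum_cols (t : Meas → ZMod 2) :
    ∑ i, ∑ m ∈ ctx (Sum.inl i), t m = ∑ j, ∑ m ∈ ctx (Sum.inr j), t m := by
  simp only [(triple_inl _).sum_eq, (triple_inr _).sum_eq, Fin.sum_univ_three]
  ring

/-- There is no global outcome assignment in the odd case. -/
theorem not_forall_sum_eq_beta1 (t : Meas → ZMod 2) : ¬ ∀ C, ∑ m ∈ ctx C, t m = beta1 C := by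
  intro h
  have := sum_rows_eq_sum_cols t
  simp only [h, beta1] at this
  exact absurd this (by decide)

theorem extremePoints_corrPolytope_beta1 :
    (corrPolytope beta1).extremePoints ℝ = corrType1 ∪ corrType2 := by
  refine Set.Subset.antisymm (fun e he => ?_)
    (Set.union_subset corrType1_subset_extremePoints corrType2_subset_extremePoints)
  rcases detSet_cases he with ⟨o, k, hZ⟩ | ⟨i, j, hZ⟩ | hZ
  · left
    have hs : ∀ i, ∃ a, ∀ m ∈ transversal o k, m.1 = i → e m = sgn a := by
      intro i
      have hmem : (i, if o then k + i else k - i) ∈ transversal o k := mem_transversal.2 rfl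
      obtain ⟨a, ha⟩ := exists_sgn_eq (mem_detSet.1 (hZ ▸ hmem))
      exact ⟨a, fun m hm hmi => by rw [eq_of_mem_transversal o k m hm _ hmem hmi, ha]⟩
    choose s hs using hs
    refine ⟨o, k, s, eq_of_eq_on_support (Or.inl ⟨o, k, s, rfl⟩) he.1 fun m hm => ?_⟩
    by_cases h : m ∈ transversal o k
    · rw [castV_vtx1_of_mem h, hs m.1 m h rfl]
    · exact absurd (castV_vtx1_of_notMem h) hm
  · right
    have hs : ∀ m ∈ cross i j, ∃ a, e m = sgn a := fun m hm =>
      exists_sgn_eq (mem_detSet.1 (hZ ▸ hm))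
    obtain ⟨c, hc⟩ := hs (i, j) (mem_cross.2 (Or.inl rfl))
    obtain ⟨x, hx⟩ := hs (i, j + 1) (mem_cross.2 (Or.inl rfl))
    obtain ⟨y, hy⟩ := hs (i + 1, j) (mem_cross.2 (Or.inr rfl))
    refine ⟨i, j, c, x, y, eq_of_eq_on_support (Or.inr ⟨i, j, c, x, y, rfl⟩) he.1 fun m hm => ?_⟩
    by_cases h : m ∈ cross i j
    · exact eq_vtx2_on_cross he.1 hc hx hy h
    · exact absurd (castV_vtx2_of_notMem h) hm
  · have hs : ∀ m, ∃ a, e m = sgn a := fun m =>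
      exists_sgn_eq (mem_detSet.1 (hZ ▸ Finset.mem_univ m))
    choose s hs using hs
    exact absurd (fun C => sum_eq_of_det he.1 fun m _ => hs m) (not_forall_sum_eq_beta1 s)

theorem dotProduct_self_corrType1 {v : Corr} (hv : v ∈ corrType1) : v ⬝ᵥ v = 3 := by
  obtain ⟨g, rfl⟩ := exists_toSym_q0 hv
  rw [dotProduct_map g.toSym_mem, castV_dotProduct, show dotZ q0Z q0Z = 3 by decide]
  norm_num

theorem dotProduct_self_corrType2 {v : Corr} (hv : v ∈ corrType2) : v ⬝ᵥ v = 5 := by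
  obtain ⟨g, rfl⟩ := exists_toSym_p0 hv
  rw [dotProduct_map g.toSym_mem, castV_dotProduct, show dotZ p0Z p0Z = 5 by decide]
  norm_num

theorem disjoint_corrType : Disjoint corrType1 corrType2 :=
  Set.disjoint_left.2 fun v h1 h2 => by
    have := (dotProduct_self_corrType1 h1).symm.trans (dotProduct_self_corrType2 h2)
    norm_num at this

/-- A symmetry preserves vertices and squared length, and the length tells the types apart: 3
against 5. -/
theorem map_mem_corrType1 {γ : Corr ≃ₗ[ℝ] Corr} (hγ : γ ∈ symGroup) {v : Corr}
    (hv : v ∈ corrType1) : γ v ∈ corrType1 := by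
  have h := map_mem_extremePoints hγ (corrType1_subset_extremePoints hv)
  rw [extremePoints_corrPolytope_beta1] at h
  refine h.resolve_right fun h2 => ?_
  have := dotProduct_self_corrType2 h2
  rw [dotProduct_map hγ, dotProduct_self_corrType1 hv] at this
  norm_num at this

theorem map_mem_corrType2 {γ : Corr ≃ₗ[ℝ] Corr} (hγ : γ ∈ symGroup) {v : Corr}
    (hv : v ∈ corrType2) : γ v ∈ corrType2 := by
  have h := map_mem_extremePoints hγ (corrType2_subset_extremePoints hv)
  rw [extremePoints_corrPolytope_beta1] at h
  refine h.resolve_left fun h2 => ?_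
  have := dotProduct_self_corrType1 h2
  rw [dotProduct_map hγ, dotProduct_self_corrType2 hv] at this
  norm_num at this

/-! ### Transitivity on pairs of vertices -/

/-- The group generated by the symmetries with codes. -/
def codeGroup : Subgroup (Corr ≃ₗ[ℝ] Corr) := Subgroup.closure (Set.range SymCode.toSym)

theorem codeGroup_le : codeGroup ≤ symGroup :=
  (Subgroup.closure_le _).2 (Set.range_subset_iff.2 SymCode.toSym_mem)

theorem SymCode.toSym_mem_codeGroup (g : SymCode) : g.toSym ∈ codeGroup :=
  Subgroup.subset_closure ⟨g, rfl⟩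

/-- Transitivity on pairs: move `v` back to `q₀`, then correct the image of `w` by a symmetry that
fixes `q₀`. -/
theorem exists_map_q0_p0 {v w : Corr} (hv : v ∈ corrType1) (hw : w ∈ corrType2)
    (h : v ⬝ᵥ w = 2) : ∃ γ ∈ codeGroup, γ (castV q0Z) = v ∧ γ (castV p0Z) = w := by
  obtain ⟨g, rfl⟩ := exists_toSym_q0 hv
  obtain ⟨i, j, c, x, y, hw'⟩ := map_mem_corrType2 (inv_mem g.toSym_mem) hw
  have hd : dotZ q0Z (vtx2 i j c x y) = 2 := by
    rw [← dotProduct_map (inv_mem g.toSym_mem), inv_apply_apply, hw', castV_dotProduct] at h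
    exact_mod_cast h
  obtain ⟨g', hg', hm⟩ := exists_stabQ0 i j c x y hd
  refine ⟨g.toSym * g'.toSym, mul_mem g.toSym_mem_codeGroup g'.toSym_mem_codeGroup, ?_, ?_⟩
  · rw [LinearEquiv.mul_apply, SymCode.toSym_castV (stabQ0_fix g' hg')]
  · rw [LinearEquiv.mul_apply, SymCode.toSym_castV hm, ← hw', apply_inv_apply]

theorem exists_map_p0 {u : Meas → ℤ} {k : ℤ}
    (hu : ∀ i j c x y, dotZ p0Z (vtx2 i j c x y) = k →
      ∃ g ∈ stabP0, ∀ m, vtx2 i j c x y (g.perm m) = sgnZ (g.sign m) * u m)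
    {v w : Corr} (hv : v ∈ corrType2) (hw : w ∈ corrType2) (h : v ⬝ᵥ w = k) :
    ∃ γ ∈ codeGroup, γ (castV p0Z) = v ∧ γ (castV u) = w := by
  obtain ⟨g, rfl⟩ := exists_toSym_p0 hv
  obtain ⟨i, j, c, x, y, hw'⟩ := map_mem_corrType2 (inv_mem g.toSym_mem) hw
  have hd : dotZ p0Z (vtx2 i j c x y) = k := by
    rw [← dotProduct_map (inv_mem g.toSym_mem), inv_apply_apply, hw', castV_dotProduct] at h
    exact_mod_cast h
  obtain ⟨g', hg', hm⟩ := hu i j c x y hd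
  refine ⟨g.toSym * g'.toSym, mul_mem g.toSym_mem_codeGroup g'.toSym_mem_codeGroup, ?_, ?_⟩
  · rw [LinearEquiv.mul_apply, SymCode.toSym_castV (stabP0_fix g' hg')]
  · rw [LinearEquiv.mul_apply, SymCode.toSym_castV hm, ← hw', apply_inv_apply]

theorem exists_map_p0_p1 {v w : Corr} (hv : v ∈ corrType2) (hw : w ∈ corrType2)
    (h : v ⬝ᵥ w = 2) : ∃ γ ∈ codeGroup, γ (castV p0Z) = v ∧ γ (castV p1Z) = w :=
  exists_map_p0 exists_stabP0_p1 hv hw (by exact_mod_cast h)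

theorem exists_map_p0_p2 {v w : Corr} (hv : v ∈ corrType2) (hw : w ∈ corrType2)
    (h : v ⬝ᵥ w = 3) : ∃ γ ∈ codeGroup, γ (castV p0Z) = v ∧ γ (castV p2Z) = w :=
  exists_map_p0 exists_stabP0_p2 hv hw (by exact_mod_cast h)

/-! ### The edges of the odd polytope -/

theorem isExtreme_segment_of_map {γ : Corr ≃ₗ[ℝ] Corr} (hγ : γ ∈ symGroup) {v w : Corr}
    (h : IsExtreme ℝ (corrPolytope beta1) (segment ℝ (γ v) (γ w))) :
    IsExtreme ℝ (corrPolytope beta1) (segment ℝ v w) := by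
  have h2 : (γ.toLinearMap.toAffineMap : Corr → Corr) = γ := rfl
  refine isExtreme_of_image γ.toLinearMap.toAffineMap γ.injective ?_
  rwa [image_segment, h2, image_corrPolytope hγ]

/-- The midpoint of `z` and `w` is also the midpoint of `u` and `z + w - u`. If the segment were a
face it would contain `u`, and a vertex on the segment is one of its ends. -/
theorem not_isExtreme_of_hasOtherSum {l : List (Meas → ℤ)} {z w : Meas → ℤ}
    (hl : ∀ u ∈ l, castV u ∈ (corrPolytope beta1).extremePoints ℝ)
    (hz : castV z ∈ corrPolytope beta1) (hw : castV w ∈ corrPolytope beta1)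
    (h : HasOtherSum l z w) :
    ¬ IsExtreme ℝ (corrPolytope beta1) (segment ℝ (castV z) (castV w)) := by
  intro hext
  obtain ⟨u, hu, ⟨m₁, hm₁⟩, ⟨m₂, hm₂⟩, hrow, hcol⟩ := h
  have hmid : (1 / 2 : ℝ) • castV z + (1 / 2 : ℝ) • castV w ∈ segment ℝ (castV z) (castV w) :=
    ⟨1 / 2, 1 / 2, by norm_num, by norm_num, by norm_num, rfl⟩
  have hopen : (1 / 2 : ℝ) • castV z + (1 / 2 : ℝ) • castV w ∈
      openSegment ℝ (castV u) (castV fun m => z m + w m - u m) := by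
    refine ⟨1 / 2, 1 / 2, by norm_num, by norm_num, by norm_num, ?_⟩
    ext m
    simp [castV]
    ring
  have hmem := hext.2 (hl u hu).1 (castV_mem_corrPolytope hrow hcol) hmid hopen
  rcases (mem_extremePoints_iff_forall_segment.1 (hl u hu)).2 _ hz _ hw hmem with h' | h'
  · exact hm₁ (congrFun (castV_injective h') m₁).symm
  · exact hm₂ (congrFun (castV_injective h') m₂).symm

theorem auxQ0_subset : ∀ u ∈ auxQ0, castV u ∈ (corrPolytope beta1).extremePoints ℝ := by
  intro u hu
  rw [extremePoints_corrPolytope_beta1]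
  simp only [auxQ0, List.mem_cons, List.not_mem_nil, or_false] at hu
  rcases hu with rfl | rfl | rfl | rfl | rfl | rfl | rfl | rfl | rfl | rfl | rfl | rfl | rfl <;>
    first
      | exact Or.inl ⟨_, _, _, rfl⟩
      | exact Or.inr ⟨_, _, _, _, _, rfl⟩

theorem auxP0_subset : ∀ u ∈ auxP0, castV u ∈ (corrPolytope beta1).extremePoints ℝ := by
  intro u hu
  rw [extremePoints_corrPolytope_beta1]
  simp only [auxP0, List.mem_cons, List.not_mem_nil, or_false] at hu
  rcases hu with rfl | rfl | rfl | rfl | rfl | rfl | rfl | rfl | rfl | rfl | rfl | rfl <;>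
    first
      | exact Or.inl ⟨_, _, _, rfl⟩
      | exact Or.inr ⟨_, _, _, _, _, rfl⟩

theorem not_isExtreme_type1_type1 {v w : Corr} (hv : v ∈ corrType1) (hw : w ∈ corrType1)
    (hne : v ≠ w) : ¬ IsExtreme ℝ (corrPolytope beta1) (segment ℝ v w) := by
  obtain ⟨g, rfl⟩ := exists_toSym_q0 hv
  intro h
  rw [← apply_inv_apply g.toSym w] at h
  have h1 := isExtreme_segment_of_map g.toSym_mem h
  have hw1 := map_mem_corrType1 (inv_mem g.toSym_mem) hw
  obtain ⟨o, k, s, hw'⟩ := map_mem_corrType1 (inv_mem g.toSym_mem) hw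
  rcases hasOtherSum_q0_vtx1 o k s with h2 | h2
  · apply hne
    rw [← apply_inv_apply g.toSym w, hw', funext h2]
  · rw [hw'] at h1 hw1
    exact not_isExtreme_of_hasOtherSum auxQ0_subset q0_mem
      (corrType1_subset_extremePoints hw1).1 h2 h1

theorem dotProduct_of_isExtreme_type1_type2 {v w : Corr} (hv : v ∈ corrType1)
    (hw : w ∈ corrType2) (h : IsExtreme ℝ (corrPolytope beta1) (segment ℝ v w)) :
    v ⬝ᵥ w = 2 := by
  obtain ⟨g, rfl⟩ := exists_toSym_q0 hv
  rw [← apply_inv_apply g.toSym w] at h ⊢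
  have h1 := isExtreme_segment_of_map g.toSym_mem h
  have hw1 := map_mem_corrType2 (inv_mem g.toSym_mem) hw
  obtain ⟨i, j, c, x, y, hw'⟩ := map_mem_corrType2 (inv_mem g.toSym_mem) hw
  rw [dotProduct_map g.toSym_mem]
  rw [hw'] at h1 hw1 ⊢
  rcases hasOtherSum_q0_vtx2 i j c x y with h2 | h2
  · rw [castV_dotProduct, h2]; norm_num
  · exact absurd h1 (not_isExtreme_of_hasOtherSum auxQ0_subset q0_mem
      (corrType2_subset_extremePoints hw1).1 h2)

theorem dotProduct_of_isExtreme_type2_type2 {v w : Corr} (hv : v ∈ corrType2)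
    (hw : w ∈ corrType2) (hne : v ≠ w)
    (h : IsExtreme ℝ (corrPolytope beta1) (segment ℝ v w)) : v ⬝ᵥ w = 2 ∨ v ⬝ᵥ w = 3 := by
  obtain ⟨g, rfl⟩ := exists_toSym_p0 hv
  rw [← apply_inv_apply g.toSym w] at h hne ⊢
  have h1 := isExtreme_segment_of_map g.toSym_mem h
  have hw1 := map_mem_corrType2 (inv_mem g.toSym_mem) hw
  obtain ⟨i, j, c, x, y, hw'⟩ := map_mem_corrType2 (inv_mem g.toSym_mem) hw
  rw [dotProduct_map g.toSym_mem]
  rw [hw'] at h1 hw1 hne ⊢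
  rw [castV_dotProduct]
  rcases hasOtherSum_p0_vtx2 i j c x y with h2 | h2 | h2
  · rw [funext h2] at hne
    exact absurd rfl hne
  · exact_mod_cast h2
  · exact absurd h1 (not_isExtreme_of_hasOtherSum auxP0_subset p0_mem
      (corrType2_subset_extremePoints hw1).1 h2)

theorem isExposed_type1_type2 {v w : Corr} (hv : v ∈ corrType1) (hw : w ∈ corrType2)
    (h : v ⬝ᵥ w = 2) : IsExposed ℝ (corrPolytope beta1) (segment ℝ v w) := by
  obtain ⟨γ, hγ, rfl, rfl⟩ := exists_map_q0_p0 hv hw h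
  exact map_isExposed_segment (codeGroup_le hγ) isExposed_segment_q0_p0

theorem isExposed_type2_type2 {v w : Corr} (hv : v ∈ corrType2) (hw : w ∈ corrType2)
    (h : v ⬝ᵥ w = 2 ∨ v ⬝ᵥ w = 3) : IsExposed ℝ (corrPolytope beta1) (segment ℝ v w) := by
  rcases h with h | h
  · obtain ⟨γ, hγ, rfl, rfl⟩ := exists_map_p0_p1 hv hw h
    exact map_isExposed_segment (codeGroup_le hγ) isExposed_segment_p0_p1
  · obtain ⟨γ, hγ, rfl, rfl⟩ := exists_map_p0_p2 hv hw h
    exact map_isExposed_segment (codeGroup_le hγ) isExposed_segment_p0_p2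

/-! ### Directions of edges -/

/-- Vectors with entries `±1` on a nonempty set that meets each context in an even number of
measurements, and `0` elsewhere. -/
def IsLoopVec (d : Corr) : Prop :=
  (∀ m, d m = 0 ∨ |d m| = 1) ∧ (∃ m, d m ≠ 0) ∧
    ∀ C, ∑ m ∈ ctx C, (if d m = 0 then (0 : ZMod 2) else 1) = 0

theorem IsLoopVec.map {γ : Corr ≃ₗ[ℝ] Corr} (hγ : γ ∈ symGroup) {d : Corr} (hd : IsLoopVec d) :
    IsLoopVec (γ d) := by
  obtain ⟨τ, ε, ⟨c, hc⟩, rfl⟩ := hγ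
  have hzero : ∀ m, signedPerm τ ε d (τ m) = 0 ↔ d m = 0 := fun m => by
    rw [signedPerm_apply, mul_eq_zero, or_iff_right (sgn_ne_zero _)]
  refine ⟨fun m => ?_, ?_, fun C => ?_⟩
  · obtain ⟨m, rfl⟩ := τ.surjective m
    refine (hd.1 m).imp (hzero m).2 fun h => ?_
    rw [signedPerm_apply, abs_mul, h]
    rcases sgn_eq_or (ε m) with ⟨-, h⟩ | ⟨-, h⟩ <;> simp [h]
  · obtain ⟨m, hm⟩ := hd.2.1
    exact ⟨τ m, fun h => hm ((hzero m).1 h)⟩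
  · obtain ⟨C, rfl⟩ := c.surjective C
    rw [sum_ctx_map (hc C).1]
    refine (Finset.sum_congr rfl fun m _ => ?_).trans (hd.2.2 C)
    simp only [hzero]

theorem IsLoopVec.neg {d : Corr} (hd : IsLoopVec d) : IsLoopVec (-d) := by
  simpa [IsLoopVec] using hd

theorem isLoopVec_castV_sub {u w : Meas → ℤ}
    (h : (∀ m, w m - u m = 0 ∨ w m - u m = 1 ∨ w m - u m = -1) ∧ (∃ m, w m - u m ≠ 0) ∧
      ∀ C, ∑ m ∈ ctx C, (if w m - u m = 0 then (0 : ZMod 2) else 1) = 0) :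
    IsLoopVec (castV w - castV u) := by
  have hcast : ∀ m, (castV w - castV u) m = ((w m - u m : ℤ) : ℝ) := fun m => by simp [castV]
  refine ⟨fun m => ?_, ?_, fun C => ?_⟩
  · rw [hcast]
    rcases h.1 m with h | h | h <;> rw [h] <;> simp
  · obtain ⟨m, hm⟩ := h.2.1
    exact ⟨m, by rw [hcast]; exact_mod_cast hm⟩
  · simp only [hcast, Int.cast_eq_zero]
    exact h.2.2 C

theorem isLoopVec_p0_sub_q0 : IsLoopVec (castV p0Z - castV q0Z) :=
  isLoopVec_castV_sub (by decide)

theorem isLoopVec_p1_sub_p0 : IsLoopVec (castV p1Z - castV p0Z) :=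
  isLoopVec_castV_sub (by decide)

theorem isLoopVec_p2_sub_p0 : IsLoopVec (castV p2Z - castV p0Z) :=
  isLoopVec_castV_sub (by decide)

theorem isLoopVec_q1_sub_p0 : IsLoopVec (castV q1Z - castV p0Z) :=
  isLoopVec_castV_sub (by decide)

theorem isLoopVec_sub_type1_type2 {v w : Corr} (hv : v ∈ corrType1) (hw : w ∈ corrType2)
    (h : v ⬝ᵥ w = 2) : IsLoopVec (w - v) := by
  obtain ⟨γ, hγ, rfl, rfl⟩ := exists_map_q0_p0 hv hw h
  rw [← map_sub]
  exact isLoopVec_p0_sub_q0.map (codeGroup_le hγ)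

/-- The difference of neighboring vertices is supported on an even set. -/
theorem isLoopVec_of_isExtreme {v w : Corr} (hv : v ∈ (corrPolytope beta1).extremePoints ℝ)
    (hw : w ∈ (corrPolytope beta1).extremePoints ℝ) (hne : v ≠ w)
    (h : IsExtreme ℝ (corrPolytope beta1) (segment ℝ v w)) : IsLoopVec (w - v) := by
  rw [extremePoints_corrPolytope_beta1] at hv hw
  rcases hv with hv | hv <;> rcases hw with hw | hw
  · exact absurd h (not_isExtreme_type1_type1 hv hw hne)
  · exact isLoopVec_sub_type1_type2 hv hw (dotProduct_of_isExtreme_type1_type2 hv hw h)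
  · rw [← neg_sub]
    rw [segment_symm] at h
    exact (isLoopVec_sub_type1_type2 hw hv (dotProduct_of_isExtreme_type1_type2 hw hv h)).neg
  · rcases dotProduct_of_isExtreme_type2_type2 hv hw hne h with h2 | h2
    · obtain ⟨γ, hγ, rfl, rfl⟩ := exists_map_p0_p1 hv hw h2
      rw [← map_sub]
      exact isLoopVec_p1_sub_p0.map (codeGroup_le hγ)
    · obtain ⟨γ, hγ, rfl, rfl⟩ := exists_map_p0_p2 hv hw h2
      rw [← map_sub]
      exact isLoopVec_p2_sub_p0.map (codeGroup_le hγ)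

/-! ### Loops -/

theorem completeBipartiteGraph_adj_inl_inr (i j : Fin 3) :
    (completeBipartiteGraph (Fin 3) (Fin 3)).Adj (Sum.inl i) (Sum.inr j) := by simp

theorem isLoop_square {i i' j j' : Fin 3} (hi : i ≠ i') (hj : j ≠ j') {L : Finset Meas}
    (hL : ∀ m, m ∈ L ↔ m = (i, j) ∨ m = (i', j) ∨ m = (i', j') ∨ m = (i, j')) : IsLoop L := by
  let w : (completeBipartiteGraph (Fin 3) (Fin 3)).Walk (Sum.inl i) (Sum.inl i) :=
    .cons (completeBipartiteGraph_adj_inl_inr i j)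
      (.cons (completeBipartiteGraph_adj_inl_inr i' j).symm
        (.cons (completeBipartiteGraph_adj_inl_inr i' j')
          (.cons (completeBipartiteGraph_adj_inl_inr i j').symm .nil)))
  refine ⟨_, w, ?_, fun m => ?_⟩
  · rw [SimpleGraph.Walk.isCycle_def, SimpleGraph.Walk.isTrail_def]
    simp [w, hi, hj, hi.symm]
  · rw [hL]
    simp [w, Prod.ext_iff]

theorem isLoop_hexagon {a b c : Fin 3} (hab : a ≠ b) (hac : a ≠ c) (hbc : b ≠ c)
    {L : Finset Meas} (hL : ∀ m, m ∈ L ↔ m = (0, a) ∨ m = (1, a) ∨ m = (1, b) ∨ m = (2, b) ∨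
      m = (2, c) ∨ m = (0, c)) : IsLoop L := by
  let w : (completeBipartiteGraph (Fin 3) (Fin 3)).Walk (Sum.inl 0) (Sum.inl 0) :=
    .cons (completeBipartiteGraph_adj_inl_inr 0 a)
      (.cons (completeBipartiteGraph_adj_inl_inr 1 a).symm
        (.cons (completeBipartiteGraph_adj_inl_inr 1 b)
          (.cons (completeBipartiteGraph_adj_inl_inr 2 b).symm
            (.cons (completeBipartiteGraph_adj_inl_inr 2 c)
              (.cons (completeBipartiteGraph_adj_inl_inr 0 c).symm .nil)))))
  refine ⟨_, w, ?_, fun m => ?_⟩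
  · rw [SimpleGraph.Walk.isCycle_def, SimpleGraph.Walk.isTrail_def]
    simp [w, hab, hac, hbc]
  · rw [hL]
    simp [w, Prod.ext_iff]

section Finite

set_option synthInstance.maxHeartbeats 400000
set_option synthInstance.maxSize 2000

/-- An even set of edges of `K_{3,3}` has degree 0 or 2 everywhere, so it is a union of
vertex-disjoint cycles. Two of them would need eight vertices, so there is one, of length 4 or 6. -/
theorem even_support_cases : ∀ u : Meas → ZMod 2, (∀ C, ∑ m ∈ ctx C, u m = 0) →
    (∃ m, u m ≠ 0) →
      (∃ i i' j j', i ≠ i' ∧ j ≠ j' ∧ ∀ m, u m = 1 ↔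
        m = (i, j) ∨ m = (i', j) ∨ m = (i', j') ∨ m = (i, j')) ∨
      ∃ a b c, a ≠ b ∧ a ≠ c ∧ b ≠ c ∧ ∀ m, u m = 1 ↔ m = (0, a) ∨ m = (1, a) ∨ m = (1, b) ∨
        m = (2, b) ∨ m = (2, c) ∨ m = (0, c) := by
  decide +kernel

theorem isClosedSet_transversal : ∀ o k, IsClosedSet (transversal o k) := by decide +kernel

theorem isClosedSet_cross : ∀ i j, IsClosedSet (cross i j) := by decide +kernel

theorem not_ctx_subset_transversal : ∀ o k C, ¬ ctx C ⊆ transversal o k := by decide +kernel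

theorem transversal_spec : ∀ o k, (transversal o k).card = 3 ∧ ∀ a ∈ transversal o k,
    ∀ b ∈ transversal o k, a ≠ b → ¬ ∃ C, a ∈ ctx C ∧ b ∈ ctx C := by
  decide +kernel

theorem exists_eq_cross : ∀ C C' : Ctx, C ≠ C' → (ctx C ∩ ctx C').card = 1 →
    ∃ i j, ctx C ∪ ctx C' = cross i j := by
  decide +kernel

theorem cross_spec : ∀ i j, (ctx (Sum.inl i) ∩ ctx (Sum.inr j)).card = 1 ∧
    cross i j = ctx (Sum.inl i) ∪ ctx (Sum.inr j) := by
  decide +kernel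

end Finite

/-- The support of a vector. -/
def suppSet (d : Corr) : Finset Meas := Finset.univ.filter fun m => d m ≠ 0

theorem mem_suppSet {d : Corr} {m : Meas} : m ∈ suppSet d ↔ d m ≠ 0 := by simp [suppSet]

theorem IsLoopVec.isLoop {d : Corr} (hd : IsLoopVec d) : IsLoop (suppSet d) := by
  have hu : ∀ m, (if d m = 0 then (0 : ZMod 2) else 1) = 1 ↔ m ∈ suppSet d := fun m => by
    rw [mem_suppSet]; split_ifs with h <;> simp [h]
  have hne : ∃ m, (if d m = 0 then (0 : ZMod 2) else 1) ≠ 0 := by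
    obtain ⟨m, hm⟩ := hd.2.1
    exact ⟨m, by rw [if_neg hm]; decide⟩
  rcases even_support_cases _ hd.2.2 hne with ⟨i, i', j, j', hi, hj, h⟩ | ⟨a, b, c, h1, h2, h3, h⟩
  · exact isLoop_square hi hj fun m => by rw [← hu, h]
  · exact isLoop_hexagon h1 h2 h3 fun m => by rw [← hu, h]

/-- The signs of a vector with entries `0` and `±1`. -/
def signUnit (d : Corr) (m : {m : Meas // m ∈ suppSet d}) : ℤˣ := if d m = 1 then 1 else -1

/-- The direction carries the factor 1/2 and `distOf` the factor 1/4, so a step by `d` in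
expectation values is half a step along the loop. -/
theorem IsLoopVec.half_smul_loopDir {d : Corr} (hd : IsLoopVec d) :
    (1 / 2 : ℝ) • loopDir (suppSet d) (signUnit d) = distOfLin beta1 d := by
  have hval : ∀ m : Meas, (if h : m ∈ suppSet d then
      (((signUnit d ⟨m, h⟩ : ℤˣ) : ℤ) : ℝ) else 0) = d m := by
    intro m
    split_ifs with h
    · rcases eq_or_eq_neg_of_abs_eq ((hd.1 m).resolve_left (mem_suppSet.1 h)) with h1 | h1
      · simp [signUnit, h1]
      · have : ¬ (-1 : ℝ) = 1 := by norm_num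
        simp [signUnit, h1, this]
    · rw [mem_suppSet, not_not] at h
      exact h.symm
  ext C s
  simp only [Pi.smul_apply, smul_eq_mul, loopDir, hval, distOfLin, LinearMap.coe_mk,
    AddHom.coe_mk]
  split_ifs
  · ring
  · simp

theorem distOf_add_half_smul_loopDir {v w : Corr} (h : IsLoopVec (w - v)) :
    distOf beta1 v + (1 / 2 : ℝ) • loopDir (suppSet (w - v)) (signUnit (w - v)) =
      distOf beta1 w := by
  rw [h.half_smul_loopDir, ← distOf_add, add_sub_cancel]

theorem segment_eq_image_of_add_half_smul {E : Type*} [AddCommGroup E] [Module ℝ E] {x y d : E}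
    (h : x + (1 / 2 : ℝ) • d = y) :
    segment ℝ x y = (fun α : ℝ => x + α • d) '' Set.Icc 0 (1 / 2) := by
  rw [segment_eq_image', ← h]
  ext z
  constructor
  · rintro ⟨θ, ⟨h0, h1⟩, rfl⟩
    exact ⟨θ / 2, ⟨by linarith, by linarith⟩, by module⟩
  · rintro ⟨α, ⟨h0, h1⟩, rfl⟩
    exact ⟨2 * α, ⟨by linarith, by linarith⟩, by module⟩

/-! ### The vertices of `MP_1` and their types -/

theorem distOf_expect_vertex (p : Vertex) : distOf beta1 (expect p.1) = p.1 :=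
  distOf_expect p.2.1

theorem expect_mem_extremePoints (p : Vertex) :
    expect p.1 ∈ (corrPolytope beta1).extremePoints ℝ := by
  obtain ⟨e, he, h⟩ := (extremePoints_MP beta1).subset p.2
  rwa [← h, expect_distOf]

theorem expect_vertex_injective : Function.Injective fun p : Vertex => expect p.1 := by
  intro p q h
  have h' : expect p.1 = expect q.1 := h
  exact Subtype.ext (by rw [← distOf_expect_vertex p, ← distOf_expect_vertex q, h'])

theorem exists_vertex {e : Corr} (he : e ∈ (corrPolytope beta1).extremePoints ℝ) :
    ∃ p : Vertex, p.1 = distOf beta1 e ∧ expect p.1 = e :=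
  ⟨⟨distOf beta1 e, by rw [extremePoints_MP]; exact ⟨e, he, rfl⟩⟩, rfl, expect_distOf _ _⟩

theorem hasMarginals_iff {e : Corr} {Ω : Finset Meas} {s : Assign Ω} :
    HasMarginals (distOf beta1 e) Ω s ↔
      (∀ m (h : m ∈ Ω), e m = sgn (s ⟨m, h⟩)) ∧ ∀ m ∉ Ω, e m = 0 := by
  simp only [HasMarginals, prob_distOf, sgn_zero, one_mul]
  constructor
  · intro h
    refine ⟨fun m hm => ?_, fun m hm => ?_⟩
    · have := (h (Sum.inl m.1) ⟨m, mem_ctx_inl m⟩).1 hm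
      linarith
    · have := (h (Sum.inl m.1) ⟨m, mem_ctx_inl m⟩).2 hm
      linarith
  · rintro ⟨h1, h2⟩ C ⟨m, hm⟩
    exact ⟨fun h => by rw [h1 m h], fun h => by rw [h2 m h, add_zero]⟩

theorem isOutcome_of_mem {e : Corr} (he : e ∈ corrPolytope beta1) {Ω : Finset Meas}
    {s : Assign Ω} (h : ∀ m (h : m ∈ Ω), e m = sgn (s ⟨m, h⟩)) : IsOutcome beta1 Ω s := by
  intro C hC
  have h1 : ∑ m ∈ ctx C, (fun m => if h : m ∈ Ω then s ⟨m, h⟩ else 0) m = beta1 C :=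
    sum_eq_of_det he fun m hm => by rw [h m (hC hm), dif_pos (hC hm)]
  rw [← h1, ← Finset.sum_coe_sort (ctx C)]
  exact Finset.sum_congr rfl fun m _ => by simp only [dif_pos (hC m.2)]; rfl

theorem not_isCNC_univ : ¬ IsCNC beta1 Finset.univ := by
  rintro ⟨-, s, hs⟩
  refine not_forall_sum_eq_beta1 (fun m => s ⟨m, Finset.mem_univ m⟩) fun C => ?_
  rw [← hs C (Finset.subset_univ _), ← Finset.sum_coe_sort (ctx C)]
  rfl

/-- No context lies inside, so every assignment is an outcome assignment; the only larger closed set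
is `M`, which admits none. -/
theorem isType1Set_transversal (o : Bool) (k : Fin 3) : IsType1Set (transversal o k) := by
  refine ⟨⟨⟨isClosedSet_transversal o k, 0, fun C hC =>
    absurd hC (not_ctx_subset_transversal o k C)⟩, fun Ω hΩ hle => ?_⟩, transversal_spec o k⟩
  rcases transversal_ssubset Ω o k hle hΩ.1 with h | h
  · exact h.le
  · exact absurd (h ▸ hΩ) not_isCNC_univ

theorem exists_assign_cross {e : Corr} {i j : Fin 3} {c x y : ZMod 2}
    (he : e = castV (vtx2 i j c x y)) :
    ∃ s : Assign (cross i j), ∀ m (h : m ∈ cross i j), e m = sgn (s ⟨m, h⟩) := by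
  have h : ∀ m : {m // m ∈ cross i j}, ∃ a, e m = sgn a := by
    rintro ⟨m, hm⟩
    simp only [he, castV, vtx2]
    rcases mem_cross.1 hm with h | h
    · simp only [h, if_true]
      split_ifs <;> exact ⟨_, cast_sgnZ _⟩
    · simp only [h, if_true]
      split_ifs <;> exact ⟨_, cast_sgnZ _⟩
  choose s hs using h
  exact ⟨s, fun m hm => hs ⟨m, hm⟩⟩

theorem isType2Set_cross (i j : Fin 3) : IsType2Set (cross i j) := by
  -- Any vertex on this cross supplies an outcome assignment; the choice of zeros is arbitrary.
  obtain ⟨s, hs⟩ := exists_assign_cross (e := castV (vtx2 i j 0 0 0)) rfl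
  have hout := isOutcome_of_mem
    (corrType2_subset_extremePoints ⟨i, j, 0, 0, 0, rfl⟩).1 hs
  refine ⟨⟨⟨isClosedSet_cross i j, s, hout⟩, fun Ω hΩ hle => ?_⟩,
    Sum.inl i, Sum.inr j, by simp, cross_spec i j⟩
  rcases cross_ssubset Ω i j hle hΩ.1 with h | h
  · exact h.le
  · exact absurd (h ▸ hΩ) not_isCNC_univ

theorem mem_Type1_iff {p : Vertex} : p ∈ Type1 ↔ expect p.1 ∈ corrType1 := by
  constructor
  · rintro ⟨Ω, s, hΩ, -, hm⟩
    obtain ⟨o, k, rfl⟩ := eq_transversal Ω hΩ.2.1 hΩ.2.2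
    rw [← distOf_expect_vertex p, hasMarginals_iff] at hm
    refine ⟨o, k, fun i => s ⟨(i, if o then k + i else k - i), mem_transversal.2 rfl⟩, ?_⟩
    ext m
    by_cases h : m ∈ transversal o k
    · rw [castV_vtx1_of_mem h, hm.1 m h]
      congr 2
      exact Subtype.ext (Prod.ext rfl (mem_transversal.1 h))
    · rw [castV_vtx1_of_notMem h, hm.2 m h]
  · rintro ⟨o, k, s, he⟩
    have h1 : ∀ m (h : m ∈ transversal o k), expect p.1 m = sgn (s m.1) := fun m h => by
      rw [he, castV_vtx1_of_mem h]
    refine ⟨transversal o k, fun m => s m.1.1, isType1Set_transversal o k,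
      isOutcome_of_mem (expect_mem_extremePoints p).1 h1, ?_⟩
    rw [← distOf_expect_vertex p, hasMarginals_iff]
    exact ⟨h1, fun m hm => by rw [he, castV_vtx1_of_notMem hm]⟩

theorem mem_Type2_iff {p : Vertex} : p ∈ Type2 ↔ expect p.1 ∈ corrType2 := by
  constructor
  · rintro ⟨Ω, s, ⟨-, C, C', hne, hcard, rfl⟩, -, hm⟩
    obtain ⟨i, j, hij⟩ := exists_eq_cross C C' hne hcard
    rw [← distOf_expect_vertex p, hasMarginals_iff] at hm
    have hmem : ∀ {m}, m ∈ cross i j → m ∈ ctx C ∪ ctx C' := fun h => hij ▸ h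
    refine ⟨i, j, s ⟨(i, j), hmem (mem_cross.2 (Or.inl rfl))⟩,
      s ⟨(i, j + 1), hmem (mem_cross.2 (Or.inl rfl))⟩,
      s ⟨(i + 1, j), hmem (mem_cross.2 (Or.inr rfl))⟩, ?_⟩
    ext m
    by_cases h : m ∈ cross i j
    · exact eq_vtx2_on_cross (expect_mem_extremePoints p).1 (hm.1 _ _) (hm.1 _ _) (hm.1 _ _) h
    · rw [castV_vtx2_of_notMem h, hm.2 m (hij ▸ h)]
  · rintro ⟨i, j, c, x, y, he⟩
    obtain ⟨s, hs⟩ := exists_assign_cross he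
    refine ⟨cross i j, s, isType2Set_cross i j,
      isOutcome_of_mem (expect_mem_extremePoints p).1 hs, ?_⟩
    rw [← distOf_expect_vertex p, hasMarginals_iff]
    exact ⟨hs, fun m hm => by rw [he, castV_vtx2_of_notMem hm]⟩

/-! ### Counting -/

theorem ncard_vertex {S : Set Vertex} {A : Set Corr} (h : ∀ p : Vertex, p ∈ S ↔ expect p.1 ∈ A)
    (hA : A ⊆ (corrPolytope beta1).extremePoints ℝ) : S.ncard = A.ncard := by
  rw [← Set.ncard_image_of_injective S expect_vertex_injective]
  congr 1
  ext e
  constructor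
  · rintro ⟨p, hp, rfl⟩
    exact (h p).1 hp
  · intro he
    obtain ⟨p, -, hp⟩ := exists_vertex (hA he)
    exact ⟨p, (h p).2 (hp ▸ he), hp⟩

theorem ncard_corrType1_filter (P : Corr → Prop) (P' : (Meas → ℤ) → Prop) [DecidablePred P']
    (hP : ∀ u, P (castV u) ↔ P' u) : {e ∈ corrType1 | P e}.ncard =
      (Finset.univ.filter fun a : Bool × Fin 3 × (Fin 3 → ZMod 2) =>
        P' (vtx1 a.1 a.2.1 a.2.2)).card := by
  have hinj : Function.Injective fun a : Bool × Fin 3 × (Fin 3 → ZMod 2) =>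
      castV (vtx1 a.1 a.2.1 a.2.2) := fun a b h =>
    vtx1_injective a b fun m => congrFun (castV_injective h) m
  rw [← Set.ncard_coe_finset, ← Set.ncard_image_of_injective _ hinj]
  congr 1
  ext e
  constructor
  · rintro ⟨⟨o, k, s, rfl⟩, h⟩
    exact ⟨(o, k, s), by simpa using (hP _).1 h, rfl⟩
  · rintro ⟨a, ha, rfl⟩
    exact ⟨⟨_, _, _, rfl⟩, (hP _).2 (by simpa using ha)⟩

theorem ncard_corrType2_filter (P : Corr → Prop) (P' : (Meas → ℤ) → Prop) [DecidablePred P']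
    (hP : ∀ u, P (castV u) ↔ P' u) : {e ∈ corrType2 | P e}.ncard =
      (Finset.univ.filter fun a : Fin 3 × Fin 3 × ZMod 2 × ZMod 2 × ZMod 2 =>
        P' (vtx2 a.1 a.2.1 a.2.2.1 a.2.2.2.1 a.2.2.2.2)).card := by
  have hinj : Function.Injective fun a : Fin 3 × Fin 3 × ZMod 2 × ZMod 2 × ZMod 2 =>
      castV (vtx2 a.1 a.2.1 a.2.2.1 a.2.2.2.1 a.2.2.2.2) := fun a b h =>
    vtx2_injective a b fun m => congrFun (castV_injective h) m
  rw [← Set.ncard_coe_finset, ← Set.ncard_image_of_injective _ hinj]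
  congr 1
  ext e
  constructor
  · rintro ⟨⟨i, j, c, x, y, rfl⟩, h⟩
    exact ⟨(i, j, c, x, y), by simpa using (hP _).1 h, rfl⟩
  · rintro ⟨a, ha, rfl⟩
    exact ⟨⟨_, _, _, _, _, rfl⟩, (hP _).2 (by simpa using ha)⟩

theorem ncard_corrType1 : corrType1.ncard = 48 := by
  have := ncard_corrType1_filter (fun _ => True) (fun _ => True) fun _ => Iff.rfl
  simpa using this

theorem ncard_corrType2 : corrType2.ncard = 72 := by
  have := ncard_corrType2_filter (fun _ => True) (fun _ => True) fun _ => Iff.rfl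
  simpa using this

theorem ncard_Type1 : Type1.ncard = 48 := by
  rw [ncard_vertex (fun _ => mem_Type1_iff) corrType1_subset_extremePoints, ncard_corrType1]

theorem ncard_Type2 : Type2.ncard = 72 := by
  rw [ncard_vertex (fun _ => mem_Type2_iff) corrType2_subset_extremePoints, ncard_corrType2]

theorem disjoint_Type1_Type2 : Disjoint Type1 Type2 :=
  Set.disjoint_left.2 fun _ h1 h2 =>
    Set.disjoint_left.1 disjoint_corrType (mem_Type1_iff.1 h1) (mem_Type2_iff.1 h2)

theorem Type1_union_Type2 : Type1 ∪ Type2 = Set.univ := by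
  refine Set.eq_univ_of_forall fun p => ?_
  have h := expect_mem_extremePoints p
  rw [extremePoints_corrPolytope_beta1] at h
  exact h.imp mem_Type1_iff.2 mem_Type2_iff.2

theorem card_vertex : Nat.card Vertex = 120 := by
  rw [← Set.ncard_univ, ← Type1_union_Type2, Set.ncard_union_eq disjoint_Type1_Type2
    (Set.finite_of_ncard_ne_zero (by rw [ncard_Type1]; norm_num))
    (Set.finite_of_ncard_ne_zero (by rw [ncard_Type2]; norm_num)), ncard_Type1, ncard_Type2]

/-! ### The neighbors of a vertex -/

theorem isExtreme_of_mem_N {p r : Vertex} (h : r ∈ N p) :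
    IsExtreme ℝ (corrPolytope beta1) (segment ℝ (expect p.1) (expect r.1)) := by
  have h1 := h.2
  rw [← distOf_expect_vertex p, ← distOf_expect_vertex r] at h1
  exact isExtreme_corrPolytope_segment h1

theorem expect_ne_of_mem_N {p r : Vertex} (h : r ∈ N p) : expect p.1 ≠ expect r.1 := fun h' =>
  h.1 (expect_vertex_injective h')

theorem mem_N_of_isExposed {p r : Vertex} (hne : expect p.1 ≠ expect r.1)
    (h : IsExposed ℝ (corrPolytope beta1) (segment ℝ (expect p.1) (expect r.1))) : r ∈ N p := by
  refine ⟨fun h' => hne (h' ▸ rfl), ?_⟩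
  have h1 := isExposed_MP_segment h
  rwa [distOf_expect_vertex, distOf_expect_vertex] at h1

theorem mem_N_iff_of_mem_Type1 {q r : Vertex} (hq : q ∈ Type1) :
    r ∈ N q ↔ expect r.1 ∈ corrType2 ∧ expect q.1 ⬝ᵥ expect r.1 = 2 := by
  have hq' := mem_Type1_iff.1 hq
  constructor
  · intro h
    have hr := expect_mem_extremePoints r
    rw [extremePoints_corrPolytope_beta1] at hr
    rcases hr with hr | hr
    · exact absurd (isExtreme_of_mem_N h)
        (not_isExtreme_type1_type1 hq' hr (expect_ne_of_mem_N h))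
    · exact ⟨hr, dotProduct_of_isExtreme_type1_type2 hq' hr (isExtreme_of_mem_N h)⟩
  · rintro ⟨hr, h⟩
    exact mem_N_of_isExposed (fun h' => Set.disjoint_left.1 disjoint_corrType hq' (h' ▸ hr))
      (isExposed_type1_type2 hq' hr h)

theorem mem_N_inter_Type1_iff {p r : Vertex} (hp : p ∈ Type2) :
    r ∈ N p ∩ Type1 ↔ expect r.1 ∈ corrType1 ∧ expect p.1 ⬝ᵥ expect r.1 = 2 := by
  rw [Set.mem_inter_iff, and_comm, mem_Type1_iff]
  refine and_congr_right fun hr => ?_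
  rw [show r ∈ N p ↔ p ∈ N r from (polytopeGraph (MP beta1)).adj_comm p r,
    mem_N_iff_of_mem_Type1 (mem_Type1_iff.2 hr), dotProduct_comm,
    and_iff_right (mem_Type2_iff.1 hp)]

theorem mem_N_inter_Type2_iff {p r : Vertex} (hp : p ∈ Type2) :
    r ∈ N p ∩ Type2 ↔ expect r.1 ∈ corrType2 ∧
      (expect p.1 ⬝ᵥ expect r.1 = 2 ∨ expect p.1 ⬝ᵥ expect r.1 = 3) := by
  have hp' := mem_Type2_iff.1 hp
  rw [Set.mem_inter_iff, and_comm, mem_Type2_iff]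
  refine and_congr_right fun hr => ⟨fun h => ?_, fun h => ?_⟩
  · exact dotProduct_of_isExtreme_type2_type2 hp' hr (expect_ne_of_mem_N h) (isExtreme_of_mem_N h)
  · refine mem_N_of_isExposed (fun h' => ?_) (isExposed_type2_type2 hp' hr h)
    rw [← h', dotProduct_self_corrType2 hp'] at h
    norm_num at h

theorem exists_loop_of_mem_N {q₁ q₂ : Vertex} (h : q₂ ∈ N q₁) :
    ∃ (L : Finset Meas) (φ : {m : Meas // m ∈ L} → ℤˣ), IsLoop L ∧
      segment ℝ (q₁ : Dist) (q₂ : Dist) =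
        (fun α : ℝ => (q₁ : Dist) + α • loopDir L φ) '' Set.Icc 0 (1 / 2) ∧
      (q₁ : Dist) + (1 / 2 : ℝ) • loopDir L φ = (q₂ : Dist) := by
  have hl := isLoopVec_of_isExtreme (expect_mem_extremePoints q₁) (expect_mem_extremePoints q₂)
    (expect_ne_of_mem_N h) (isExtreme_of_mem_N h)
  have h1 := distOf_add_half_smul_loopDir hl
  rw [distOf_expect_vertex, distOf_expect_vertex] at h1
  exact ⟨_, _, hl.isLoop, segment_eq_image_of_add_half_smul h1, h1⟩

/-! ### Pauli operators -/

/-- The Pauli matrices. -/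
def pauli : Fin 3 → Op1 := ![X, Y, Z]

theorem pauli_mul_self (a : Fin 3) : pauli a * pauli a = 1 := by
  fin_cases a <;> ext i j <;> fin_cases i <;> fin_cases j <;>
    simp [pauli, X, Y, Z, Matrix.mul_apply, Fin.sum_univ_two]

theorem trace_pauli (a : Fin 3) : (pauli a).trace = 0 := by
  fin_cases a <;> simp [pauli, X, Y, Z, Matrix.trace, Fin.sum_univ_two]

theorem trace_pauli_mul_pauli (a b : Fin 3) :
    (pauli a * pauli b).trace = if a = b then 2 else 0 := by
  fin_cases a <;> fin_cases b <;>
    simp [pauli, X, Y, Z, Matrix.trace, Fin.sum_univ_two] <;> norm_num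

theorem pauli_mul_pauli_mul_pauli (c : Fin 3) :
    pauli c * pauli (c + 1) * pauli (c + 2) = Complex.I • (1 : Op1) := by
  fin_cases c <;> ext i j <;> fin_cases i <;> fin_cases j <;>
    simp [pauli, X, Y, Z, Matrix.mul_apply, Fin.sum_univ_two]

theorem pauli_mul_pauli_mul_pauli_neg (c : Fin 3) :
    pauli c * pauli (c - 1) * pauli (c - 2) = -(Complex.I • (1 : Op1)) := by
  fin_cases c <;> ext i j <;> fin_cases i <;> fin_cases j <;>
    simp [pauli, X, Y, Z, Matrix.mul_apply, Fin.sum_univ_two]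

theorem pauliSquare_eq (m : Meas) :
    pauliSquare m.1 m.2 = pauli (pauliIdx m).1 ⊗ₖ pauli (pauliIdx m).2 := by
  revert m
  refine forall_meas ?_ ?_ ?_ ?_ ?_ ?_ ?_ ?_ ?_ <;> rfl

/-- Trace orthogonality lets expectation values be read off from the operator. -/
theorem trace_pauliSquare_mul (m n : Meas) :
    (pauliSquare m.1 m.2 * pauliSquare n.1 n.2).trace = if m = n then 4 else 0 := by
  rw [pauliSquare_eq, pauliSquare_eq, ← Matrix.mul_kronecker_mul, Matrix.trace_kronecker,
    trace_pauli_mul_pauli, trace_pauli_mul_pauli]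
  by_cases h : m = n
  · subst h; norm_num
  · have h' : pauliIdx m ≠ pauliIdx n := fun h' => h (pauliIdx.injective h')
    rw [Ne, Prod.ext_iff, not_and_or] at h'
    rcases h' with h' | h' <;> simp [h, h']

/-- The operator with given expectation values. -/
def opOf (e : Corr) : Op2 := (1 / 4 : ℂ) • (1 + ∑ m : Meas, (e m : ℂ) • pauliSquare m.1 m.2)

theorem toOp_eq (p : Dist) : toOp p = opOf (expect p) := rfl

theorem trace_opOf_mul (e : Corr) (n : Meas) :
    (opOf e * pauliSquare n.1 n.2).trace = e n := by
  have h1 : (pauliSquare n.1 n.2).trace = 0 := by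
    rw [pauliSquare_eq, Matrix.trace_kronecker, trace_pauli, zero_mul]
  simp only [opOf, Matrix.smul_mul, Matrix.trace_smul, add_mul, one_mul, Matrix.trace_add, h1,
    Finset.sum_mul, Matrix.trace_sum, trace_pauliSquare_mul, smul_eq_mul, zero_add]
  simp
  ring

theorem opOf_injective : Function.Injective opOf := fun e e' h => by
  ext n
  have := trace_opOf_mul e n
  rw [h, trace_opOf_mul] at this
  exact_mod_cast this.symm

/-! ### One-qubit Clifford unitaries as rotations -/

/-- The complex sign `(-1)^a`. -/
def sgnC (a : ZMod 2) : ℂ := ((sgn a : ℝ) : ℂ)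

theorem sgnC_zero : sgnC 0 = 1 := by simp [sgnC, sgn_zero]

theorem sgnC_one : sgnC 1 = -1 := by simp [sgnC, sgn_one]

theorem sgnC_add (a b : ZMod 2) : sgnC (a + b) = sgnC a * sgnC b := by simp [sgnC, sgn_add]

theorem sgnC_eq_I_pow (a : ZMod 2) : sgnC a = Complex.I ^ (2 * a.val) := by
  rw [pow_mul, Complex.I_sq, sgnC, sgn]; push_cast; rfl

theorem sgnC_injective : Function.Injective sgnC := fun _ _ h =>
  sgn_injective (Complex.ofReal_injective h)

/-- Conjugation by `U` acts on the Pauli matrices as the rotation `r`. -/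
def ActsAs (U : Op1) (r : Rot) : Prop :=
  ∀ a, U * pauli a * star U = sgnC (r.sign a) • pauli (r.perm a)

theorem star_mul_self_of_mem {U : Op1} (hU : U ∈ Matrix.unitaryGroup (Fin 2) ℂ) :
    star U * U = 1 := Unitary.star_mul_self_of_mem hU

theorem mul_star_self_of_mem {U : Op1} (hU : U ∈ Matrix.unitaryGroup (Fin 2) ℂ) :
    U * star U = 1 := Unitary.mul_star_self_of_mem hU

theorem conj_mul_conj {U : Op1} (hU : U ∈ Matrix.unitaryGroup (Fin 2) ℂ) (A B : Op1) :
    U * A * star U * (U * B * star U) = U * (A * B) * star U := by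
  calc U * A * star U * (U * B * star U) = U * A * (star U * U) * B * star U := by noncomm_ring
    _ = U * (A * B) * star U := by rw [star_mul_self_of_mem hU]; noncomm_ring

theorem trace_conj {U : Op1} (hU : U ∈ Matrix.unitaryGroup (Fin 2) ℂ) (A : Op1) :
    (U * A * star U).trace = A.trace := by
  rw [Matrix.trace_mul_comm, ← mul_assoc, star_mul_self_of_mem hU, one_mul]

/-- The image of a Pauli matrix is some `i^k B`. Vanishing trace excludes `B = 1`, and squaring to
the identity forces `i^k = ±1`. -/
theorem IsClifford.exists_sign {U : Op1} (hU : IsClifford U) (a : Fin 3) :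
    ∃ b s, U * pauli a * star U = sgnC s • pauli b := by
  have hmem : pauli a ∈ pauliGroup :=
    ⟨0, pauli a, by fin_cases a <;> simp [pauli], by simp⟩
  obtain ⟨k, B, hB, h⟩ := hU.2 _ hmem
  have htr : (Complex.I ^ k • B).trace = 0 := by rw [← h, trace_conj hU.1, trace_pauli]
  have hI : Complex.I ^ k ≠ 0 := pow_ne_zero _ Complex.I_ne_zero
  have hne : B ≠ 1 := by
    rintro rfl
    simp [Matrix.trace_smul] at htr
  obtain ⟨b, rfl⟩ : ∃ b, B = pauli b := by
    rcases hB with rfl | rfl | rfl | rfl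
    · exact absurd rfl hne
    · exact ⟨0, rfl⟩
    · exact ⟨1, rfl⟩
    · exact ⟨2, rfl⟩
  have hsq : (Complex.I ^ k) ^ 2 = 1 := by
    have h1 := conj_mul_conj hU.1 (pauli a) (pauli a)
    rw [pauli_mul_self, mul_one, mul_star_self_of_mem hU.1, h, Matrix.smul_mul, Matrix.mul_smul,
      pauli_mul_self, smul_smul] at h1
    have h2 := congrFun (congrFun h1 0) 0
    simpa [sq] using h2
  rcases mul_self_eq_one_iff.1 ((sq _).symm.trans hsq) with h1 | h1
  · exact ⟨b, 0, by rw [h, h1, sgnC_zero]⟩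
  · exact ⟨b, 1, by rw [h, h1, sgnC_one]⟩

theorem exists_affine_of_injective : ∀ f : Fin 3 → Fin 3, Function.Injective f →
    ∃ (d : Bool) (c : Fin 3), ∀ x, f x = if d then c + x else c - x := by
  decide +kernel

/-- Orthogonality under the trace makes the map of axes injective, hence of the form `c ± x`.
Conjugation fixes the scalar `XYZ = i`, while the product of the permuted matrices is `i` or `-i`
according to the parity of the permutation; this determines the third sign. -/
theorem IsClifford.exists_actsAs {U : Op1} (hU : IsClifford U) : ∃ r, ActsAs U r := by
  choose f s h using hU.exists_sign
  have hinj : Function.Injective f := by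
    intro a b hab
    by_contra hne
    have h1 := conj_mul_conj hU.1 (pauli a) (pauli b)
    rw [h, h, hab, Matrix.smul_mul, Matrix.mul_smul, pauli_mul_self, smul_smul] at h1
    have h2 := congrArg Matrix.trace h1
    rw [trace_conj hU.1, trace_pauli_mul_pauli, if_neg hne, Matrix.trace_smul, ← sgnC_add] at h2
    rcases zmod2_eq_zero_or_one (s a + s b) with h3 | h3 <;>
      simp [h3, sgnC_zero, sgnC_one] at h2
  obtain ⟨d, c, hf⟩ := exists_affine_of_injective f hinj
  have hprod : sgnC (s 0 + s 1 + s 2) • (pauli (f 0) * pauli (f 1) * pauli (f 2)) =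
      Complex.I • (1 : Op1) := by
    have h1 := pauli_mul_pauli_mul_pauli 0
    have h2 : U * (pauli 0 * pauli 1 * pauli 2) * star U = Complex.I • (1 : Op1) := by
      rw [show pauli 0 * pauli 1 * pauli 2 = Complex.I • (1 : Op1) from h1, Matrix.mul_smul,
        Matrix.smul_mul, mul_one, mul_star_self_of_mem hU.1]
    rw [← h2, ← conj_mul_conj hU.1, ← conj_mul_conj hU.1, h, h, h, sgnC_add, sgnC_add]
    simp only [Matrix.smul_mul, Matrix.mul_smul, smul_smul]
    congr 1
    ring
  have hs : s 2 = s 0 + s 1 + if d then 0 else 1 := by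
    have key : ∀ {x y : ℂ}, x • (y • (1 : Op1)) = Complex.I • (1 : Op1) → x * y = Complex.I := by
      intro x y hxy
      simpa using congrFun (congrFun hxy 0) 0
    cases d
    · rw [hf, hf, hf] at hprod
      simp only [Bool.false_eq_true, if_false, sub_zero] at hprod ⊢
      rw [pauli_mul_pauli_mul_pauli_neg, ← neg_smul] at hprod
      have h1 : sgnC (s 0 + s 1 + s 2) = sgnC 1 := by
        rw [sgnC_one]
        exact mul_right_cancel₀ (neg_ne_zero.2 Complex.I_ne_zero) (by rw [key hprod]; ring)
      have h2 := sgnC_injective h1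
      linear_combination h2 - (s 0 + s 1) * CharTwo.two_eq_zero (R := ZMod 2)
    · rw [hf, hf, hf] at hprod
      simp only [if_true, add_zero] at hprod ⊢
      rw [pauli_mul_pauli_mul_pauli] at hprod
      have h1 : sgnC (s 0 + s 1 + s 2) = sgnC 0 := by
        rw [sgnC_zero]
        exact mul_right_cancel₀ Complex.I_ne_zero (by rw [key hprod]; ring)
      have h2 := sgnC_injective h1
      linear_combination h2 - (s 0 + s 1) * CharTwo.two_eq_zero (R := ZMod 2)
  refine ⟨(d, c, s 0, s 1), fun a => ?_⟩
  have hsign : Rot.sign (d, c, s 0, s 1) a = s a := by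
    fin_cases a
    · rfl
    · rfl
    · exact hs.symm
  rw [h, hsign, hf]
  rfl

theorem ActsAs.isClifford {U : Op1} (hU : U ∈ Matrix.unitaryGroup (Fin 2) ℂ) {r : Rot}
    (h : ActsAs U r) : IsClifford U := by
  refine ⟨hU, ?_⟩
  rintro _ ⟨k, B, hB, rfl⟩
  have hp : ∀ b, pauli b ∈ ({1, X, Y, Z} : Set Op1) := fun b => by
    fin_cases b <;> simp [pauli]
  have key : ∀ a, U * (Complex.I ^ k • pauli a) * star U ∈ pauliGroup := fun a => by
    refine ⟨k + 2 * (r.sign a).val, pauli (r.perm a), hp _, ?_⟩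
    rw [Matrix.mul_smul, Matrix.smul_mul, h a, smul_smul, sgnC_eq_I_pow, pow_add]
  rcases hB with rfl | rfl | rfl | rfl
  · exact ⟨k, 1, by simp, by
      rw [Matrix.mul_smul, Matrix.smul_mul, mul_one, mul_star_self_of_mem hU]⟩
  · exact key 0
  · exact key 1
  · exact key 2

/-- Composition of rotations. -/
def Rot.comp (r r' : Rot) : Rot :=
  (r.1 == r'.1, r.perm (r'.perm 0), r'.sign 0 + r.sign (r'.perm 0),
    r'.sign 1 + r.sign (r'.perm 1))

theorem Rot.comp_spec : ∀ (r r' : Rot) (a : Fin 3), (r.comp r').perm a = r.perm (r'.perm a) ∧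
    (r.comp r').sign a = r'.sign a + r.sign (r'.perm a) := by
  decide +kernel

theorem ActsAs.mul {U V : Op1} {r r' : Rot} (h : ActsAs U r) (h' : ActsAs V r') :
    ActsAs (U * V) (r.comp r') := by
  intro a
  have h1 : U * V * pauli a * star (U * V) = U * (V * pauli a * star V) * star U := by
    rw [star_mul]; noncomm_ring
  rw [h1, h' a, Matrix.mul_smul, Matrix.smul_mul, h, smul_smul, (Rot.comp_spec r r' a).1,
    (Rot.comp_spec r r' a).2, sgnC_add]

/-- The phase gate. -/
def phaseGate : Op1 := !![1, 0; 0, Complex.I]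

/-- The unitary that permutes the Pauli matrices cyclically. -/
def cycleGate : Op1 :=
  !![(1 - Complex.I) / 2, (-1 - Complex.I) / 2; (1 - Complex.I) / 2, (1 + Complex.I) / 2]

/-- The rotation of the phase gate. -/
def phaseRot : Rot := (false, 1, 0, 1)

/-- The cyclic rotation. -/
def cycleRot : Rot := (true, 1, 0, 0)

theorem phaseGate_mem : phaseGate ∈ Matrix.unitaryGroup (Fin 2) ℂ := by
  rw [Matrix.mem_unitaryGroup_iff]
  ext i j
  fin_cases i <;> fin_cases j <;>
    simp [phaseGate, Matrix.mul_apply, Fin.sum_univ_two, Matrix.star_apply]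

theorem star_cycleGate : star cycleGate =
    !![(1 + Complex.I) / 2, (1 + Complex.I) / 2; (-1 + Complex.I) / 2, (1 - Complex.I) / 2] := by
  ext i j
  fin_cases i <;> fin_cases j <;>
    simp [cycleGate, Matrix.star_apply, sub_eq_add_neg]

theorem cycleGate_mem : cycleGate ∈ Matrix.unitaryGroup (Fin 2) ℂ := by
  have hI := Complex.I_sq
  rw [Matrix.mem_unitaryGroup_iff, star_cycleGate]
  ext i j
  fin_cases i <;> fin_cases j <;>
    simp [cycleGate, Matrix.mul_apply, Fin.sum_univ_two] <;> grind

theorem actsAs_phaseGate : ActsAs phaseGate phaseRot := by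
  intro a
  fin_cases a <;> ext i j <;> fin_cases i <;> fin_cases j <;>
    simp [phaseGate, phaseRot, Rot.sign, Rot.perm, pauli, X, Y, Z, Matrix.mul_apply,
      Fin.sum_univ_two, Matrix.star_apply, sgnC_zero, sgnC_one, CharTwo.add_self_eq_zero]

theorem actsAs_cycleGate : ActsAs cycleGate cycleRot := by
  have hI := Complex.I_sq
  intro a
  rw [star_cycleGate]
  fin_cases a <;> ext i j <;> fin_cases i <;> fin_cases j <;>
    simp [cycleGate, cycleRot, Rot.sign, Rot.perm, pauli, X, Y, Z, Matrix.mul_apply,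
      Fin.sum_univ_two, sgnC_zero] <;> grind

/-! ### All rotations come from Clifford unitaries -/

/-- Words in the phase gate (`true`) and the cyclic gate (`false`). -/
def Rot.ofWord (l : List Bool) : Rot :=
  l.foldr (fun b r => (if b then phaseRot else cycleRot).comp r) Rot.id

theorem exists_actsAs_ofWord (l : List Bool) :
    ∃ U ∈ Matrix.unitaryGroup (Fin 2) ℂ, ActsAs U (Rot.ofWord l) := by
  induction l with
  | nil =>
    refine ⟨1, one_mem _, fun a => ?_⟩
    have h : Rot.id.sign a = 0 ∧ Rot.id.perm a = a := by revert a; decide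
    rw [show Rot.ofWord [] = Rot.id from rfl, h.1, h.2, sgnC_zero]
    simp
  | cons b l ih =>
    obtain ⟨U, hU, h⟩ := ih
    cases b
    · exact ⟨cycleGate * U, mul_mem cycleGate_mem hU, actsAs_cycleGate.mul h⟩
    · exact ⟨phaseGate * U, mul_mem phaseGate_mem hU, actsAs_phaseGate.mul h⟩

/-- With `C` the cyclic rotation and `S` the rotation of the phase gate, every rotation is `C^a S^b
C^c S^d`, with exponents below the orders 3 and 4. -/
theorem exists_ofWord_eq : ∀ r : Rot, ∃ a c : Fin 3, ∃ b d : Fin 4, Rot.ofWord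
    (List.replicate a false ++ List.replicate b true ++ List.replicate c false ++
      List.replicate d true) = r := by
  decide +kernel

theorem exists_isClifford_actsAs (r : Rot) : ∃ U, IsClifford U ∧ ActsAs U r := by
  obtain ⟨a, c, b, d, h⟩ := exists_ofWord_eq r
  obtain ⟨U, hU, hUr⟩ := exists_actsAs_ofWord (List.replicate a false ++ List.replicate b true ++
    List.replicate c false ++ List.replicate d true)
  rw [h] at hUr
  exact ⟨U, hUr.isClifford hU, hUr⟩

/-! ### The group `G_1` and the symmetries of the odd polytope -/

/-- The algebra automorphism `g` acts on the operators of correlation vectors as `γ`. -/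
def Implements (g : Op2 ≃ₐ[ℂ] Op2) (γ : Corr ≃ₗ[ℝ] Corr) : Prop := ∀ e, g (opOf e) = opOf (γ e)

theorem Implements.mul {g g' : Op2 ≃ₐ[ℂ] Op2} {γ γ' : Corr ≃ₗ[ℝ] Corr} (h : Implements g γ)
    (h' : Implements g' γ') : Implements (g * g') (γ * γ') := fun e => by
  rw [AlgEquiv.mul_apply, h', h]; rfl

theorem Implements.inv {g : Op2 ≃ₐ[ℂ] Op2} {γ : Corr ≃ₗ[ℝ] Corr} (h : Implements g γ) :
    Implements g⁻¹ γ⁻¹ := fun e => by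
  have h1 : g (opOf (γ⁻¹ e)) = opOf e := by rw [h, apply_inv_apply]
  rw [← h1, ← AlgEquiv.mul_apply, inv_mul_cancel]; rfl

theorem implements_signedPerm {g : Op2 ≃ₐ[ℂ] Op2} {τ : Equiv.Perm Meas} {ε : Meas → ZMod 2}
    (h : ∀ m : Meas, g (pauliSquare m.1 m.2) = sgnC (ε m) • pauliSquare (τ m).1 (τ m).2) :
    Implements g (signedPerm τ ε) := by
  intro e
  rw [opOf, opOf, map_smul, map_add, map_one, map_sum]
  congr 2
  rw [← Equiv.sum_comp τ fun m => ((signedPerm τ ε e m : ℝ) : ℂ) • pauliSquare m.1 m.2]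
  refine Finset.sum_congr rfl fun m _ => ?_
  rw [map_smul, h, smul_smul, signedPerm_apply, sgnC]
  push_cast
  rw [mul_comm]

theorem conj_apply (U : Matrix.unitaryGroup (Fin 2 × Fin 2) ℂ) (A : Op2) :
    conj U A = U * A * star (U : Op2) := rfl

theorem implements_kronecker {g : Matrix.unitaryGroup (Fin 2 × Fin 2) ℂ} {U V : Op1} {r r' : Rot}
    (hU : ActsAs U r) (hV : ActsAs V r') (hg : (g : Op2) = U ⊗ₖ V) :
    Implements (conj g) (signedPerm (rotPerm r r') (rotSign r r')) := by
  refine implements_signedPerm fun m => ?_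
  have h1 : pauliIdx (rotPerm r r' m) = (r.perm (pauliIdx m).1, r'.perm (pauliIdx m).2) := by
    simp [rotPerm, Prod.map]
  have h2 : star (U ⊗ₖ V) = star U ⊗ₖ star V := Matrix.conjTranspose_kronecker U V
  rw [conj_apply, hg, pauliSquare_eq, pauliSquare_eq, h1, h2, ← Matrix.mul_kronecker_mul,
    ← Matrix.mul_kronecker_mul, hU, hV, Matrix.smul_kronecker, Matrix.kronecker_smul, smul_smul,
    rotSign, sgnC_add]

theorem swapOp_mul_kronecker_mul (A B : Op1) :
    swapOp * (A ⊗ₖ B) * star swapOp = B ⊗ₖ A := by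
  ext ⟨i, j⟩ ⟨k, l⟩
  simp only [Matrix.mul_apply, swapOp, Matrix.star_apply, Matrix.of_apply, Fintype.sum_prod_type,
    Fin.sum_univ_two, Matrix.kroneckerMap_apply, Prod.swap_prod_mk]
  fin_cases i <;> fin_cases j <;> fin_cases k <;> fin_cases l <;> simp [mul_comm]

theorem implements_swap {g : Matrix.unitaryGroup (Fin 2 × Fin 2) ℂ} (hg : (g : Op2) = swapOp) :
    Implements (conj g) (signedPerm swapPerm 0) := by
  refine implements_signedPerm fun m => ?_
  have h1 : pauliIdx (swapPerm m) = ((pauliIdx m).2, (pauliIdx m).1) := by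
    simp [swapPerm, Prod.swap]
  rw [conj_apply, hg, pauliSquare_eq, pauliSquare_eq, h1, swapOp_mul_kronecker_mul,
    Pi.zero_apply, sgnC_zero, one_smul]

/-- This bounds `G_1` from above: its action preserves the polytope, the types and the scalar
product. -/
theorem exists_implements_of_mem_G1 {g : Op2 ≃ₐ[ℂ] Op2} (hg : g ∈ G1) :
    ∃ γ ∈ symGroup, Implements g γ := by
  obtain ⟨U, hU, rfl⟩ := hg
  induction hU using Subgroup.closure_induction with
  | mem g h =>
    rcases h with ⟨U, V, hU, hV, hg⟩ | hg
    · obtain ⟨r, hr⟩ := hU.exists_actsAs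
      obtain ⟨r', hr'⟩ := hV.exists_actsAs
      exact ⟨_, ⟨_, _, isSym_rot r r', rfl⟩, implements_kronecker hr hr' hg⟩
    · exact ⟨_, ⟨_, _, isSym_swap, rfl⟩, implements_swap hg⟩
  | one => exact ⟨1, one_mem _, fun e => by rw [map_one]; rfl⟩
  | mul g h _ _ ihg ihh =>
    obtain ⟨γ, hγ, h1⟩ := ihg
    obtain ⟨γ', hγ', h2⟩ := ihh
    exact ⟨γ * γ', mul_mem hγ hγ', by rw [map_mul]; exact h1.mul h2⟩
  | inv g _ ih =>
    obtain ⟨γ, hγ, h⟩ := ih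
    exact ⟨γ⁻¹, inv_mem hγ, by rw [map_inv]; exact h.inv⟩

/-- The symmetries of the odd polytope that are implemented by elements of `G_1`. -/
def implGroup : Subgroup (Corr ≃ₗ[ℝ] Corr) where
  carrier := {γ | γ ∈ symGroup ∧ ∃ g ∈ G1, Implements g γ}
  one_mem' := ⟨one_mem _, 1, one_mem _, fun _ => rfl⟩
  mul_mem' := by
    rintro _ _ ⟨h, g, hg, hi⟩ ⟨h', g', hg', hi'⟩
    exact ⟨mul_mem h h', g * g', mul_mem hg hg', hi.mul hi'⟩
  inv_mem' := by
    rintro _ ⟨h, g, hg, hi⟩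
    exact ⟨inv_mem h, g⁻¹, inv_mem hg, hi.inv⟩

theorem kronecker_mem_unitaryGroup {U V : Op1} (hU : IsClifford U) (hV : IsClifford V) :
    U ⊗ₖ V ∈ Matrix.unitaryGroup (Fin 2 × Fin 2) ℂ := by
  rw [Matrix.mem_unitaryGroup_iff, show star (U ⊗ₖ V) = star U ⊗ₖ star V from
    Matrix.conjTranspose_kronecker U V, ← Matrix.mul_kronecker_mul, mul_star_self_of_mem hU.1,
    mul_star_self_of_mem hV.1, Matrix.one_kronecker_one]

theorem swapOp_mem_unitaryGroup : swapOp ∈ Matrix.unitaryGroup (Fin 2 × Fin 2) ℂ := by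
  rw [Matrix.mem_unitaryGroup_iff]
  have := swapOp_mul_kronecker_mul 1 1
  rwa [Matrix.one_kronecker_one, mul_one] at this

theorem signedPerm_rot_mem_implGroup (r r' : Rot) :
    signedPerm (rotPerm r r') (rotSign r r') ∈ implGroup := by
  obtain ⟨U, hU, hr⟩ := exists_isClifford_actsAs r
  obtain ⟨V, hV, hr'⟩ := exists_isClifford_actsAs r'
  exact ⟨⟨_, _, isSym_rot r r', rfl⟩, conj ⟨_, kronecker_mem_unitaryGroup hU hV⟩,
    ⟨_, Subgroup.subset_closure (Or.inl ⟨U, V, hU, hV, rfl⟩), rfl⟩,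
    implements_kronecker hr hr' rfl⟩

theorem signedPerm_swap_mem_implGroup : signedPerm swapPerm 0 ∈ implGroup :=
  ⟨⟨_, _, isSym_swap, rfl⟩, conj ⟨_, swapOp_mem_unitaryGroup⟩,
    ⟨_, Subgroup.subset_closure (Or.inr rfl), rfl⟩, implements_swap rfl⟩

/-- This bounds `G_1` from below: all symmetries used for transitivity are realized by unitaries. -/
theorem codeGroup_le_implGroup : codeGroup ≤ implGroup := by
  refine (Subgroup.closure_le _).2 (Set.range_subset_iff.2 fun g => ?_)
  rw [SymCode.toSym_eq]
  split_ifs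
  · exact mul_mem signedPerm_swap_mem_implGroup (signedPerm_rot_mem_implGroup _ _)
  · exact signedPerm_rot_mem_implGroup _ _

/-! ### Operators and orbits -/

theorem injOn_toOp : Set.InjOn toOp (MP beta1) := fun p hp q hq h => by
  rw [toOp_eq, toOp_eq] at h
  rw [← distOf_expect hp, ← distOf_expect hq, opOf_injective h]

theorem image_toOp : toOp '' MP beta1 = opOf '' corrPolytope beta1 := by
  rw [MP_eq_image, Set.image_image]
  exact Set.image_congr fun e _ => by rw [toOp_eq, expect_distOf]

theorem G1_image_toOp {g : Op2 ≃ₐ[ℂ] Op2} (hg : g ∈ G1) :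
    g '' (toOp '' MP beta1) = toOp '' MP beta1 := by
  obtain ⟨γ, hγ, h⟩ := exists_implements_of_mem_G1 hg
  rw [image_toOp, Set.image_image]
  conv_rhs => rw [← image_corrPolytope hγ, Set.image_image]
  exact Set.image_congr fun e _ => h e

theorem stabOrbit_eq_image (p r : Vertex) : stabOrbit p r =
    opOf '' {x | ∃ γ ∈ implGroup, γ (expect p.1) = expect p.1 ∧ γ (expect r.1) = x} := by
  ext A
  constructor
  · rintro ⟨⟨⟨g, hg⟩, hstab⟩, rfl⟩
    obtain ⟨γ, hγ, h⟩ := exists_implements_of_mem_G1 hg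
    have hfix : g (toOp p.1) = toOp p.1 := hstab
    rw [toOp_eq, h] at hfix
    exact ⟨_, ⟨γ, ⟨hγ, g, hg, h⟩, opOf_injective hfix, rfl⟩, (h _).symm⟩
  · rintro ⟨_, ⟨γ, ⟨-, g, hg, h⟩, hfix, rfl⟩, rfl⟩
    refine ⟨⟨⟨g, hg⟩, ?_⟩, h _⟩
    change g (toOp p.1) = toOp p.1
    rw [toOp_eq, h, hfix]

/-- The stabilizer orbit of a vertex, if the symmetry group is transitive on the pairs of vertices
with the given types and the given scalar product. -/
theorem stabOrbit_eq {p r : Vertex} {B : Set Corr} {k : ℝ} {v₀ w₀ : Corr}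
    (hB : ∀ γ ∈ symGroup, ∀ x ∈ B, γ x ∈ B)
    (htrans : ∀ w ∈ B, expect p.1 ⬝ᵥ w = k → ∃ γ ∈ codeGroup, γ v₀ = expect p.1 ∧ γ w₀ = w)
    (hr : expect r.1 ∈ B) (hk : expect p.1 ⬝ᵥ expect r.1 = k) :
    stabOrbit p r = opOf '' {x ∈ B | expect p.1 ⬝ᵥ x = k} := by
  rw [stabOrbit_eq_image]
  congr 1
  ext x
  constructor
  · rintro ⟨γ, hγ, hfix, rfl⟩
    refine ⟨hB γ hγ.1 _ hr, ?_⟩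
    have h := dotProduct_map hγ.1 (expect p.1) (expect r.1)
    rw [hfix] at h
    exact h.trans hk
  · rintro ⟨hx, hxk⟩
    obtain ⟨γ, hγ, h1, h2⟩ := htrans _ hr hk
    obtain ⟨γ', hγ', h1', h2'⟩ := htrans x hx hxk
    -- Both `γ` and `γ'` send `v₀` to the point of `p`, so the quotient fixes it and carries the
    -- point of `r` to `x`.
    refine ⟨γ' * γ⁻¹, codeGroup_le_implGroup (mul_mem hγ' (inv_mem hγ)), ?_, ?_⟩
    · rw [LinearEquiv.mul_apply, ← h1, inv_apply_apply, h1', h1]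
    · rw [LinearEquiv.mul_apply, ← h2, inv_apply_apply, h2']

theorem toOps_eq {S : Set Vertex} {A : Set Corr} (h : ∀ p : Vertex, p ∈ S ↔ expect p.1 ∈ A)
    (hA : A ⊆ (corrPolytope beta1).extremePoints ℝ) : toOps S = opOf '' A := by
  ext T
  constructor
  · rintro ⟨p, hp, rfl⟩
    exact ⟨_, (h p).1 hp, rfl⟩
  · rintro ⟨e, he, rfl⟩
    obtain ⟨p, -, hp⟩ := exists_vertex (hA he)
    exact ⟨p, (h p).2 (hp ▸ he), by simp only [toOp_eq, hp]⟩

theorem stabOrbit_type1_type2 {q r : Vertex} (hq : q ∈ Type1) (hr : expect r.1 ∈ corrType2)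
    (hk : expect q.1 ⬝ᵥ expect r.1 = 2) :
    stabOrbit q r = opOf '' {x ∈ corrType2 | expect q.1 ⬝ᵥ x = 2} :=
  stabOrbit_eq (fun _ hγ _ hx => map_mem_corrType2 hγ hx)
    (fun _ hw h => exists_map_q0_p0 (mem_Type1_iff.1 hq) hw h) hr hk

theorem stabOrbit_type2_type1 {p r : Vertex} (hp : p ∈ Type2) (hr : expect r.1 ∈ corrType1)
    (hk : expect p.1 ⬝ᵥ expect r.1 = 2) :
    stabOrbit p r = opOf '' {x ∈ corrType1 | expect p.1 ⬝ᵥ x = 2} := by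
  refine stabOrbit_eq (v₀ := castV p0Z) (w₀ := castV q0Z)
    (fun _ hγ _ hx => map_mem_corrType1 hγ hx) (fun w hw h => ?_) hr hk
  rw [dotProduct_comm] at h
  obtain ⟨γ, hγ, h1, h2⟩ := exists_map_q0_p0 hw (mem_Type2_iff.1 hp) h
  exact ⟨γ, hγ, h2, h1⟩

theorem stabOrbit_type2_type2_two {p r : Vertex} (hp : p ∈ Type2) (hr : expect r.1 ∈ corrType2)
    (hk : expect p.1 ⬝ᵥ expect r.1 = 2) :
    stabOrbit p r = opOf '' {x ∈ corrType2 | expect p.1 ⬝ᵥ x = 2} :=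
  stabOrbit_eq (fun _ hγ _ hx => map_mem_corrType2 hγ hx)
    (fun _ hw h => exists_map_p0_p1 (mem_Type2_iff.1 hp) hw h) hr hk

theorem stabOrbit_type2_type2_three {p r : Vertex} (hp : p ∈ Type2) (hr : expect r.1 ∈ corrType2)
    (hk : expect p.1 ⬝ᵥ expect r.1 = 3) :
    stabOrbit p r = opOf '' {x ∈ corrType2 | expect p.1 ⬝ᵥ x = 3} :=
  stabOrbit_eq (fun _ hγ _ hx => map_mem_corrType2 hγ hx)
    (fun _ hw h => exists_map_p0_p2 (mem_Type2_iff.1 hp) hw h) hr hk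

/-! ### The size of the orbits -/

/-- Reduces the counts at an arbitrary vertex to those at `q₀` or `p₀`. -/
theorem ncard_dot_map {γ : Corr ≃ₗ[ℝ] Corr} (hγ : γ ∈ symGroup) {B : Set Corr}
    (hB : ∀ γ ∈ symGroup, ∀ x ∈ B, γ x ∈ B) (v : Corr) (k : ℝ) :
    {x ∈ B | γ v ⬝ᵥ x = k}.ncard = {x ∈ B | v ⬝ᵥ x = k}.ncard := by
  rw [← Set.ncard_image_of_injective {x ∈ B | v ⬝ᵥ x = k} γ.injective]
  congr 1
  ext x
  constructor
  · rintro ⟨hx, h⟩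
    refine ⟨γ⁻¹ x, ⟨hB _ (inv_mem hγ) x hx, ?_⟩, apply_inv_apply γ x⟩
    rw [← h, ← dotProduct_map hγ v, apply_inv_apply]
  · rintro ⟨y, ⟨hy, h⟩, rfl⟩
    exact ⟨hB γ hγ y hy, by rw [dotProduct_map hγ, h]⟩

theorem castV_dotProduct_eq_iff (u w : Meas → ℤ) (k : ℤ) :
    castV u ⬝ᵥ castV w = (k : ℝ) ↔ dotZ u w = k := by
  rw [castV_dotProduct]; exact_mod_cast Iff.rfl

theorem ncard_dot_type1_type2 {v : Corr} (hv : v ∈ corrType1) :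
    {x ∈ corrType2 | v ⬝ᵥ x = 2}.ncard = 12 := by
  obtain ⟨g, rfl⟩ := exists_toSym_q0 hv
  rw [ncard_dot_map g.toSym_mem fun _ hγ _ hx => map_mem_corrType2 hγ hx,
    ncard_corrType2_filter _ (fun u => dotZ q0Z u = 2) fun u => by
      exact_mod_cast castV_dotProduct_eq_iff q0Z u 2]
  exact card_dot_q0_vtx2

theorem ncard_dot_type2_type1 {v : Corr} (hv : v ∈ corrType2) :
    {x ∈ corrType1 | v ⬝ᵥ x = 2}.ncard = 8 := by
  obtain ⟨g, rfl⟩ := exists_toSym_p0 hv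
  rw [ncard_dot_map g.toSym_mem fun _ hγ _ hx => map_mem_corrType1 hγ hx,
    ncard_corrType1_filter _ (fun u => dotZ p0Z u = 2) fun u => by
      exact_mod_cast castV_dotProduct_eq_iff p0Z u 2]
  exact card_dot_p0_vtx1

theorem ncard_dot_type2_type2_two {v : Corr} (hv : v ∈ corrType2) :
    {x ∈ corrType2 | v ⬝ᵥ x = 2}.ncard = 8 := by
  obtain ⟨g, rfl⟩ := exists_toSym_p0 hv
  rw [ncard_dot_map g.toSym_mem fun _ hγ _ hx => map_mem_corrType2 hγ hx,
    ncard_corrType2_filter _ (fun u => dotZ p0Z u = 2) fun u => by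
      exact_mod_cast castV_dotProduct_eq_iff p0Z u 2]
  exact card_dot_p0_vtx2_two

theorem ncard_dot_type2_type2_three {v : Corr} (hv : v ∈ corrType2) :
    {x ∈ corrType2 | v ⬝ᵥ x = 3}.ncard = 8 := by
  obtain ⟨g, rfl⟩ := exists_toSym_p0 hv
  rw [ncard_dot_map g.toSym_mem fun _ hγ _ hx => map_mem_corrType2 hγ hx,
    ncard_corrType2_filter _ (fun u => dotZ p0Z u = 3) fun u => by
      exact_mod_cast castV_dotProduct_eq_iff p0Z u 3]
  exact card_dot_p0_vtx2_three

theorem disjoint_dot (B : Set Corr) (v : Corr) :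
    Disjoint {x ∈ B | v ⬝ᵥ x = 2} {x ∈ B | v ⬝ᵥ x = 3} :=
  Set.disjoint_left.2 fun x h1 h2 => by
    have := h1.2.symm.trans h2.2
    norm_num at this

theorem setOf_dot_or (B : Set Corr) (v : Corr) :
    {x ∈ B | v ⬝ᵥ x = 2 ∨ v ⬝ᵥ x = 3} = {x ∈ B | v ⬝ᵥ x = 2} ∪ {x ∈ B | v ⬝ᵥ x = 3} := by
  ext x
  simp only [Set.mem_union, Set.mem_ofPred_eq]
  tauto

/-! ### The local structure of the graph of `MP_1` -/

theorem local_structure_type1 {q : Vertex} (hq : q ∈ Type1) :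
    (N q).ncard = 12 ∧ N q ⊆ Type2 ∧ toOps (N q) =
      opOf '' {x ∈ corrType2 | expect q.1 ⬝ᵥ x = 2} := by
  have hsub : {x ∈ corrType2 | expect q.1 ⬝ᵥ x = 2} ⊆ (corrPolytope beta1).extremePoints ℝ :=
    fun x hx => corrType2_subset_extremePoints hx.1
  refine ⟨?_, fun r hr => mem_Type2_iff.2 ((mem_N_iff_of_mem_Type1 hq).1 hr).1,
    toOps_eq (fun r => mem_N_iff_of_mem_Type1 hq) hsub⟩
  rw [ncard_vertex (fun r => mem_N_iff_of_mem_Type1 hq) hsub,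
    ncard_dot_type1_type2 (mem_Type1_iff.1 hq)]

theorem toOps_N_inter_Type1 {p : Vertex} (hp : p ∈ Type2) : toOps (N p ∩ Type1) =
    opOf '' {x ∈ corrType1 | expect p.1 ⬝ᵥ x = 2} :=
  toOps_eq (fun _ => mem_N_inter_Type1_iff hp) fun _ hx => corrType1_subset_extremePoints hx.1

theorem toOps_N_inter_Type2 {p : Vertex} (hp : p ∈ Type2) : toOps (N p ∩ Type2) =
    opOf '' {x ∈ corrType2 | expect p.1 ⬝ᵥ x = 2} ∪
      opOf '' {x ∈ corrType2 | expect p.1 ⬝ᵥ x = 3} := by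
  rw [← Set.image_union, ← setOf_dot_or]
  exact toOps_eq (fun _ => mem_N_inter_Type2_iff hp) fun _ hx =>
    corrType2_subset_extremePoints hx.1

theorem ncard_N_inter_Type1 {p : Vertex} (hp : p ∈ Type2) : (N p ∩ Type1).ncard = 8 := by
  rw [ncard_vertex (A := {x ∈ corrType1 | expect p.1 ⬝ᵥ x = 2})
    (fun _ => mem_N_inter_Type1_iff hp) fun _ hx => corrType1_subset_extremePoints hx.1]
  exact ncard_dot_type2_type1 (mem_Type2_iff.1 hp)

theorem ncard_N_inter_Type2 {p : Vertex} (hp : p ∈ Type2) : (N p ∩ Type2).ncard = 16 := by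
  have h2 := ncard_dot_type2_type2_two (mem_Type2_iff.1 hp)
  have h3 := ncard_dot_type2_type2_three (mem_Type2_iff.1 hp)
  rw [ncard_vertex (A := {x ∈ corrType2 | expect p.1 ⬝ᵥ x = 2 ∨ expect p.1 ⬝ᵥ x = 3})
    (fun _ => mem_N_inter_Type2_iff hp) fun _ hx => corrType2_subset_extremePoints hx.1,
    setOf_dot_or, Set.ncard_union_eq (disjoint_dot _ _)
      (Set.finite_of_ncard_ne_zero (by rw [h2]; norm_num))
      (Set.finite_of_ncard_ne_zero (by rw [h3]; norm_num)), h2, h3]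

theorem local_structure_type2 {p : Vertex} (hp : p ∈ Type2) :
    (N p ∩ Type1).ncard = 8 ∧ (∀ r ∈ N p ∩ Type1, toOps (N p ∩ Type1) = stabOrbit p r) ∧
      (N p ∩ Type2).ncard = 16 ∧
      ∃ r₁ ∈ N p ∩ Type2, ∃ r₂ ∈ N p ∩ Type2,
        (stabOrbit p r₁).ncard = 8 ∧ (stabOrbit p r₂).ncard = 8 ∧
        Disjoint (stabOrbit p r₁) (stabOrbit p r₂) ∧
        toOps (N p ∩ Type2) = stabOrbit p r₁ ∪ stabOrbit p r₂ := by
  have hp' := mem_Type2_iff.1 hp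
  have h2 := ncard_dot_type2_type2_two hp'
  have h3 := ncard_dot_type2_type2_three hp'
  refine ⟨ncard_N_inter_Type1 hp, fun r hr => ?_, ncard_N_inter_Type2 hp, ?_⟩
  · have hr' := (mem_N_inter_Type1_iff hp).1 hr
    rw [toOps_N_inter_Type1 hp, stabOrbit_type2_type1 hp hr'.1 hr'.2]
  -- One orbit for each of the scalar products 2 and 3; any vertex with that product represents it.
  · obtain ⟨x, hx, hxk⟩ := Set.nonempty_of_ncard_ne_zero (by rw [h2]; norm_num)
    obtain ⟨y, hy, hyk⟩ := Set.nonempty_of_ncard_ne_zero (by rw [h3]; norm_num)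
    obtain ⟨r₁, -, rfl⟩ := exists_vertex (corrType2_subset_extremePoints hx)
    obtain ⟨r₂, -, rfl⟩ := exists_vertex (corrType2_subset_extremePoints hy)
    refine ⟨r₁, (mem_N_inter_Type2_iff hp).2 ⟨hx, Or.inl hxk⟩,
      r₂, (mem_N_inter_Type2_iff hp).2 ⟨hy, Or.inr hyk⟩, ?_⟩
    rw [stabOrbit_type2_type2_two hp hx hxk, stabOrbit_type2_type2_three hp hy hyk,
      Set.ncard_image_of_injective _ opOf_injective, Set.ncard_image_of_injective _ opOf_injective]
    exact ⟨h2, h3, (Set.disjoint_image_iff opOf_injective).2 (disjoint_dot _ _),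
      toOps_N_inter_Type2 hp⟩

/-! ### The operators of the representatives -/

theorem opOf_q0 : opOf (castV q0Z) = (1 / 4 : ℂ) • (1 + X ⊗ₖ Y - Y ⊗ₖ Y + Z ⊗ₖ Y) := by
  rw [opOf, Fintype.sum_prod_type]
  simp only [Fin.sum_univ_three, castV, q0Z, pauliSquare]
  simp
  module

theorem opOf_q1 : opOf (castV q1Z) = (1 / 4 : ℂ) • (1 + Z ⊗ₖ X - Z ⊗ₖ Y + Z ⊗ₖ Z) := by
  rw [opOf, Fintype.sum_prod_type]
  simp only [Fin.sum_univ_three, castV, q1Z, pauliSquare]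
  simp
  module

theorem opOf_p0 : opOf (castV p0Z) =
    (1 / 4 : ℂ) • (1 + X ⊗ₖ X + X ⊗ₖ Y + Y ⊗ₖ X - Y ⊗ₖ Y + Z ⊗ₖ Z) := by
  rw [opOf, Fintype.sum_prod_type]
  simp only [Fin.sum_univ_three, castV, p0Z, pauliSquare]
  simp
  module

theorem opOf_p1 : opOf (castV p1Z) =
    (1 / 4 : ℂ) • (1 + X ⊗ₖ X + X ⊗ₖ Y - Y ⊗ₖ Z + Z ⊗ₖ X - Z ⊗ₖ Y) := by
  rw [opOf, Fintype.sum_prod_type]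
  simp only [Fin.sum_univ_three, castV, p1Z, pauliSquare]
  simp
  module

theorem opOf_p2 : opOf (castV p2Z) =
    (1 / 4 : ℂ) • (1 + X ⊗ₖ X - Y ⊗ₖ Y - Y ⊗ₖ Z - Z ⊗ₖ Y + Z ⊗ₖ Z) := by
  rw [opOf, Fintype.sum_prod_type]
  simp only [Fin.sum_univ_three, castV, p2Z, pauliSquare]
  simp
  module

theorem representatives : ∃ q₀ p₀ p₁ p₂ q₁ : Vertex,
    toOp q₀ = (1 / 4 : ℂ) • (1 + X ⊗ₖ Y - Y ⊗ₖ Y + Z ⊗ₖ Y) ∧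
    toOp p₀ = (1 / 4 : ℂ) • (1 + X ⊗ₖ X + X ⊗ₖ Y + Y ⊗ₖ X - Y ⊗ₖ Y + Z ⊗ₖ Z) ∧
    toOp p₁ = (1 / 4 : ℂ) • (1 + X ⊗ₖ X + X ⊗ₖ Y - Y ⊗ₖ Z + Z ⊗ₖ X - Z ⊗ₖ Y) ∧
    toOp p₂ = (1 / 4 : ℂ) • (1 + X ⊗ₖ X - Y ⊗ₖ Y - Y ⊗ₖ Z - Z ⊗ₖ Y + Z ⊗ₖ Z) ∧
    toOp q₁ = (1 / 4 : ℂ) • (1 + Z ⊗ₖ X - Z ⊗ₖ Y + Z ⊗ₖ Z) ∧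
    q₀ ∈ Type1 ∧ p₀ ∈ Type2 ∧ p₁ ∈ Type2 ∧ p₂ ∈ Type2 ∧ q₁ ∈ Type1 ∧
    toOps (N q₀) = stabOrbit q₀ p₀ ∧
    toOps (N p₀ ∩ Type1) = stabOrbit p₀ q₀ ∧
    toOps (N p₀ ∩ Type2) = stabOrbit p₀ p₁ ∪ stabOrbit p₀ p₂ ∧
    Disjoint (stabOrbit p₀ p₁) (stabOrbit p₀ p₂) ∧
    q₁ ∉ N p₀ ∧
    ∃ (L : Finset Meas) (φ : {m : Meas // m ∈ L} → ℤˣ), IsLoop L ∧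
      (p₀ : Dist) + (1 / 2 : ℝ) • loopDir L φ = (q₁ : Dist) := by
  obtain ⟨q₀, -, hq₀⟩ := exists_vertex (corrType1_subset_extremePoints q0_mem_corrType1)
  obtain ⟨p₀, hp₀', hp₀⟩ := exists_vertex (corrType2_subset_extremePoints p0_mem_corrType2)
  obtain ⟨p₁, -, hp₁⟩ := exists_vertex (corrType2_subset_extremePoints p1_mem_corrType2)
  obtain ⟨p₂, -, hp₂⟩ := exists_vertex (corrType2_subset_extremePoints p2_mem_corrType2)
  obtain ⟨q₁, hq₁', hq₁⟩ := exists_vertex (corrType1_subset_extremePoints q1_mem_corrType1)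
  have tq₀ : q₀ ∈ Type1 := mem_Type1_iff.2 (hq₀ ▸ q0_mem_corrType1)
  have tp₀ : p₀ ∈ Type2 := mem_Type2_iff.2 (hp₀ ▸ p0_mem_corrType2)
  have tp₁ : p₁ ∈ Type2 := mem_Type2_iff.2 (hp₁ ▸ p1_mem_corrType2)
  have tp₂ : p₂ ∈ Type2 := mem_Type2_iff.2 (hp₂ ▸ p2_mem_corrType2)
  have tq₁ : q₁ ∈ Type1 := mem_Type1_iff.2 (hq₁ ▸ q1_mem_corrType1)
  have d00 : expect q₀.1 ⬝ᵥ expect p₀.1 = 2 := by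
    rw [hq₀, hp₀]; exact_mod_cast (castV_dotProduct_eq_iff q0Z p0Z 2).2 (by decide)
  have d01 : expect p₀.1 ⬝ᵥ expect p₁.1 = 2 := by
    rw [hp₀, hp₁]; exact_mod_cast (castV_dotProduct_eq_iff p0Z p1Z 2).2 (by decide)
  have d02 : expect p₀.1 ⬝ᵥ expect p₂.1 = 3 := by
    rw [hp₀, hp₂]; exact_mod_cast (castV_dotProduct_eq_iff p0Z p2Z 3).2 (by decide)
  have d0q : expect p₀.1 ⬝ᵥ expect q₁.1 = 1 := by
    rw [hp₀, hq₁]; exact_mod_cast (castV_dotProduct_eq_iff p0Z q1Z 1).2 (by decide)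
  have o1 := stabOrbit_type2_type2_two tp₀ (mem_Type2_iff.1 tp₁) d01
  have o2 := stabOrbit_type2_type2_three tp₀ (mem_Type2_iff.1 tp₂) d02
  refine ⟨q₀, p₀, p₁, p₂, q₁, ?_, ?_, ?_, ?_, ?_, tq₀, tp₀, tp₁, tp₂, tq₁, ?_, ?_, ?_, ?_, ?_,
    ?_⟩
  · rw [toOp_eq, hq₀, opOf_q0]
  · rw [toOp_eq, hp₀, opOf_p0]
  · rw [toOp_eq, hp₁, opOf_p1]
  · rw [toOp_eq, hp₂, opOf_p2]
  · rw [toOp_eq, hq₁, opOf_q1]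
  · rw [(local_structure_type1 tq₀).2.2, stabOrbit_type1_type2 tq₀ (mem_Type2_iff.1 tp₀) d00]
  · rw [toOps_N_inter_Type1 tp₀, stabOrbit_type2_type1 tp₀ (mem_Type1_iff.1 tq₀)
      (by rw [dotProduct_comm, d00])]
  · rw [toOps_N_inter_Type2 tp₀, o1, o2]
  · rw [o1, o2]
    exact (Set.disjoint_image_iff opOf_injective).2 (disjoint_dot _ _)
  -- Neighbors of type 1 have scalar product 2 with `p₀`, but `q₁` has scalar product 1.
  · intro h
    have := ((mem_N_inter_Type1_iff tp₀).1 ⟨h, tq₁⟩).2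
    rw [d0q] at this
    norm_num at this
  · have h := distOf_add_half_smul_loopDir isLoopVec_q1_sub_p0
    rw [← hp₀', ← hq₁'] at h
    exact ⟨_, _, isLoopVec_q1_sub_p0.isLoop, h⟩

end Mermin

end

open Mermin in
open scoped Kronecker in
theorem theorem2 :
    -- the graph of `MP_0` is the complete graph on 16 vertices
    Nonempty (polytopeGraph (MP beta0) ≃g (⊤ : SimpleGraph (Fin 16))) ∧
    -- points of `MP_1` are identified with operators, on which `G_1` acts
    (Set.InjOn toOp (MP beta1) ∧ ∀ g ∈ G1, g '' (toOp '' MP beta1) = toOp '' MP beta1) ∧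
    -- the vertices of `MP_1`
    (Nat.card Vertex = 120 ∧ Type1.ncard = 48 ∧ Type2.ncard = 72 ∧
      Disjoint Type1 Type2 ∧ Type1 ∪ Type2 = Set.univ) ∧
    -- the edges of `MP_1` are given by signed loops
    (∀ q₁ q₂ : Vertex, q₂ ∈ N q₁ →
      ∃ (L : Finset Meas) (φ : {m : Meas // m ∈ L} → ℤˣ), IsLoop L ∧
        segment ℝ (q₁ : Dist) (q₂ : Dist) =
          (fun α : ℝ => (q₁ : Dist) + α • loopDir L φ) '' Set.Icc 0 (1 / 2) ∧
        (q₁ : Dist) + (1 / 2 : ℝ) • loopDir L φ = (q₂ : Dist)) ∧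
    -- local structure at the vertices of type 1
    (∀ q ∈ Type1, (N q).ncard = 12 ∧ N q ⊆ Type2 ∧
      ∀ r ∈ N q, toOps (N q) = stabOrbit q r) ∧
    -- local structure at the vertices of type 2
    (∀ p ∈ Type2,
      (N p ∩ Type1).ncard = 8 ∧ (∀ r ∈ N p ∩ Type1, toOps (N p ∩ Type1) = stabOrbit p r) ∧
      (N p ∩ Type2).ncard = 16 ∧
      ∃ r₁ ∈ N p ∩ Type2, ∃ r₂ ∈ N p ∩ Type2,
        (stabOrbit p r₁).ncard = 8 ∧ (stabOrbit p r₂).ncard = 8 ∧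
        Disjoint (stabOrbit p r₁) (stabOrbit p r₂) ∧
        toOps (N p ∩ Type2) = stabOrbit p r₁ ∪ stabOrbit p r₂) ∧
    -- representatives of the orbits, and a vertex on a signed loop that is not a neighbor
    (∃ q₀ p₀ p₁ p₂ q₁ : Vertex,
      toOp q₀ = (1 / 4 : ℂ) • (1 + X ⊗ₖ Y - Y ⊗ₖ Y + Z ⊗ₖ Y) ∧
      toOp p₀ = (1 / 4 : ℂ) • (1 + X ⊗ₖ X + X ⊗ₖ Y + Y ⊗ₖ X - Y ⊗ₖ Y + Z ⊗ₖ Z) ∧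
      toOp p₁ = (1 / 4 : ℂ) • (1 + X ⊗ₖ X + X ⊗ₖ Y - Y ⊗ₖ Z + Z ⊗ₖ X - Z ⊗ₖ Y) ∧
      toOp p₂ = (1 / 4 : ℂ) • (1 + X ⊗ₖ X - Y ⊗ₖ Y - Y ⊗ₖ Z - Z ⊗ₖ Y + Z ⊗ₖ Z) ∧
      toOp q₁ = (1 / 4 : ℂ) • (1 + Z ⊗ₖ X - Z ⊗ₖ Y + Z ⊗ₖ Z) ∧
      q₀ ∈ Type1 ∧ p₀ ∈ Type2 ∧ p₁ ∈ Type2 ∧ p₂ ∈ Type2 ∧ q₁ ∈ Type1 ∧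
      toOps (N q₀) = stabOrbit q₀ p₀ ∧
      toOps (N p₀ ∩ Type1) = stabOrbit p₀ q₀ ∧
      toOps (N p₀ ∩ Type2) = stabOrbit p₀ p₁ ∪ stabOrbit p₀ p₂ ∧
      Disjoint (stabOrbit p₀ p₁) (stabOrbit p₀ p₂) ∧
      q₁ ∉ N p₀ ∧
      ∃ (L : Finset Meas) (φ : {m : Meas // m ∈ L} → ℤˣ), IsLoop L ∧
        (p₀ : Dist) + (1 / 2 : ℝ) • loopDir L φ = (q₁ : Dist)) := by
  exact ⟨polytopeGraph_MP_beta0, ⟨injOn_toOp, fun _ hg => G1_image_toOp hg⟩,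
    ⟨card_vertex, ncard_Type1, ncard_Type2, disjoint_Type1_Type2, Type1_union_Type2⟩,
    fun _ _ h => exists_loop_of_mem_N h,
    fun q hq => ⟨(local_structure_type1 hq).1, (local_structure_type1 hq).2.1, fun r hr => by
      have hr' := (mem_N_iff_of_mem_Type1 hq).1 hr
      rw [(local_structure_type1 hq).2.2, stabOrbit_type1_type2 hq hr'.1 hr'.2]⟩,
    fun _ hp => local_structure_type2 hp, representatives⟩
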